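/- **Conventions.** Let $p:\mathcal E\to\mathcal B$ be a fibration with fibres $\mathcal E_b$ and reindexing functors $u^*$. It has *fibred* (co)limits of a given type if the fibres have them and all $u^*$ preserve them. Call $p$ *suitable* if it has fibred pullbacks, fibred finite coproducts and fibred (small) filtered colimits; finite coproducts and filtered colimits are universal (stable under pullback) in the fibres; and filtered colimits commute with pullbacks in the fibres. Say that $p$ has *disjoint* coproducts if binary coproducts in every fibre are disjoint (the injections are monic and their pullback is initial). A monad $(T,\eta,\mu)$ on $\mathcal E$ is *fibred* over $p$ if $pT=p$ and the components of $\eta,\mu$ are vertical. It is *suitable relative to* $p$ if it is fibred over $p$, its restriction to every fibre is cartesian (it preserves pullbacks, and the naturality squares of $\eta$ and $\mu$ are pullbacks), and $T$ preserves filtered colimits in the fibres. $Gph(T,p)$ is the category of relative $T$-graphs: spans $O\xleftarrow{\gamma}A\xrightarrow{\delta}T(O)$ with $\gamma,\delta$ vertical; a morphism is a pair $(f:A\to A',\,u:O\to O')$ with $\gamma' f=u\gamma$ and $\delta' f=T(u)\delta$. Let $p_T:Gph(T,p)\to\mathcal E$ send $(A,O,\gamma,\delta)$ to $O$. Graphs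 over the same $O$ have the tensor $A\otimes A'=A\times_{T(O)}T(A')$ (pullback in the fibre of $\delta_A$ and $T(\gamma_{A'})$), with $\gamma_\otimes=\gamma_A\pi_1$ and $\delta_\otimes=\mu_O T(\delta_{A'})\pi_2$, the unit $I_O=(O,1_O,\eta_O)$, and the canonical coherence morphisms $\alpha:A\otimes(A'\otimes A'')\to(A\otimes A')\otimes A''$, $\lambda:A\to I_O\otimes A$, $\varrho:A\otimes I_O\to A$. $Mon(T,p)$ is the category of monoids (relative $T$-categories) for this structure, with morphisms over arbitrary morphisms of $\mathcal E$; $\mathcal U_T:Mon(T,p)\to Gph(T,p)$ is the forgetful functor and $q_T=p_T\,\mathcal U_T$. An adjunction $\mathcal F\dashv\mathcal U_T$ is *fibred over* $\mathcal E$ if $q_T\mathcal F=p_T$ and its unit and counit are vertical. **Theorem.** Let $p:\mathcal E\to\mathcal B$ be a suitable fibration and $(T,\eta,\mu)$ a monad that is suitable relative to $p$. Then: 1. $p_T:Gph(T,p)\to\mathcal E$ is a suitable fibration; if $p$ has disjoint coproducts, then so has $p_T$. 2. $\mathcal U_T:Mon(T,p)\to Gph(T,p)$ is monadic. 3. $\mathcal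 U_T$ has a left adjoint fibred over $\mathcal E$. For every adjunction $\mathcal F_T\dashv\mathcal U_T$ fibred over $\mathcal E$, the induced monad $\widetilde T$ on $Gph(T,p)$ is fibred over $p_T$ and preserves filtered colimits in the fibres of $p_T$; if $p$ has disjoint coproducts, then $\widetilde T$ is suitable relative to $p_T$. 4. If $p$ has disjoint coproducts, the construction can be iterated: there is a tower $\mathcal E_0=\mathcal E$, $T_0=T$, $\mathcal E_{n+1}=Gph(T_n,p_n)$, $p_{n+1}=p_{T_n}:\mathcal E_{n+1}\to\mathcal E_n$, $T_{n+1}=\widetilde{T_n}$ (with $p_0=p$, each $\widetilde{T_n}$ induced by an adjunction fibred over $\mathcal E_n$), and in every such tower all $p_n$ are suitable with disjoint coproducts and all $T_n$ are suitable relative to $p_n$. 5. The fibration $!:\mathrm{Set}\to\mathbf 1$ is suitable with disjoint coproducts and the identity monad on $\mathrm{Set}$ is suitable relative to it; so the construction, started with this pair, yields a tower as in 4 (the tower by means of which opetopic sets are defined), all of whose stages are suitable. -/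

import Mathlib

open CategoryTheory CategoryTheory.Limits CategoryTheory.Functor

universe w v v₁ v₂ u u₁ u₂

namespace Burroni

section Fibrations

variable {B : Type u₁} [Category.{v₁} B] {E : Type u₂} [Category.{v₂} E]

/-- The object of the total category underlying an object of a fibre. -/
abbrev tot {p : E ⥤ B} {b : B} (X : Fiber p b) : E := Fiber.fiberInclusion.obj X

/-- The morphism of the total category underlying a morphism of a fibre. -/
abbrev totMap {p : E ⥤ B} {b : B} {X Y : Fiber p b} (f : X ⟶ Y) : tot X ⟶ tot Y :=
  Fiber.fiberInclusion.map f

instance {p : E ⥤ B} {b : B} {X Y : Fiber p b} (f : X ⟶ Y) : p.IsHomLift (𝟙 b) (totMap f) := f.2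

theorem obj_tot {p : E ⥤ B} {b : B} (X : Fiber p b) : p.obj (tot X) = b := X.2

/-- A vertical morphism, as a morphism of the fibre. -/
def vert {p : E ⥤ B} {b : B} {X Y : Fiber p b} (f : tot X ⟶ tot Y) (h : p.IsHomLift (𝟙 b) f) :
    X ⟶ Y := ⟨f, h⟩

theorem totMap_comp {p : E ⥤ B} {b : B} {X Y Z : Fiber p b} (f : X ⟶ Y) (g : Y ⟶ Z) :
    totMap (f ≫ g) = totMap f ≫ totMap g := rfl

@[simp]
theorem totMap_vert {p : E ⥤ B} {b : B} {X Y : Fiber p b} (f : tot X ⟶ tot Y)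
    (h : p.IsHomLift (𝟙 b) f) : totMap (vert f h) = f := rfl

/-- The object `u^* X`, for a choice of prone (cartesian) morphisms. -/
noncomputable def reindexObj (p : E ⥤ B) [p.IsFibered] {b b' : B} (u : b ⟶ b') (X : Fiber p b') :
    Fiber p b :=
  Fiber.mk (IsPreFibered.pullbackObj_proj (obj_tot X) u)

/-- The prone (cartesian) morphism `u^* X ⟶ X` over `u`. -/
noncomputable def proneMap (p : E ⥤ B) [p.IsFibered] {b b' : B} (u : b ⟶ b') (X : Fiber p b') :
    tot (reindexObj p u X) ⟶ tot X :=
  IsPreFibered.pullbackMap (obj_tot X) u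

instance (p : E ⥤ B) [p.IsFibered] {b b' : B} (u : b ⟶ b') (X : Fiber p b') :
    p.IsCartesian u (proneMap p u X) :=
  IsPreFibered.pullbackMap.IsCartesian (obj_tot X) u

/-- The reindexing functor `u^* : E_b' ⥤ E_b` of a fibration along `u : b ⟶ b'`. -/
noncomputable def reindex (p : E ⥤ B) [p.IsFibered] {b b' : B} (u : b ⟶ b') :
    Fiber p b' ⥤ Fiber p b where
  obj X := reindexObj p u X
  map {X Y} f := vert (IsCartesian.map p u (proneMap p u Y) (proneMap p u X ≫ totMap f))
    (IsCartesian.map_isHomLift p u (proneMap p u Y) (proneMap p u X ≫ totMap f))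
  map_id X := by
    apply Fiber.hom_ext
    symm
    refine IsCartesian.map_uniq p u _ _ (totMap (𝟙 (reindexObj p u X))) ?_
    simp
  map_comp {X Y Z} f g := by
    apply Fiber.hom_ext
    symm
    refine IsCartesian.map_uniq p u (proneMap p u Z) (proneMap p u X ≫ totMap (f ≫ g))
      (IsCartesian.map p u (proneMap p u Y) (proneMap p u X ≫ totMap f) ≫
        IsCartesian.map p u (proneMap p u Z) (proneMap p u Y ≫ totMap g)) ?_
    rw [Category.assoc, IsCartesian.fac, IsCartesian.fac_assoc, totMap_comp, Category.assoc]

/-- The prone (cartesian) morphism `u^* X ⟶ X`, with domain written through `reindex`. -/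
noncomputable def prone (p : E ⥤ B) [p.IsFibered] {b b' : B} (u : b ⟶ b') (X : Fiber p b') :
    tot ((reindex p u).obj X) ⟶ tot X :=
  proneMap p u X

instance (p : E ⥤ B) [p.IsFibered] {b b' : B} (u : b ⟶ b') (X : Fiber p b') :
    p.IsCartesian u (prone p u X) :=
  IsPreFibered.pullbackMap.IsCartesian (obj_tot X) u

/-- The fibration `p` has fibred pullbacks: its fibres have pullbacks and the reindexing functors
preserve them. -/
class HasFibredPullbacks (p : E ⥤ B) [p.IsFibered] : Prop where
  hasPullbacks (b : B) : HasPullbacks (Fiber p b)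
  preserves {b b' : B} (u : b ⟶ b') : PreservesLimitsOfShape WalkingCospan (reindex p u)

attribute [instance] HasFibredPullbacks.hasPullbacks HasFibredPullbacks.preserves

/-- The fibration `p` has fibred finite coproducts. -/
class HasFibredFiniteCoproducts (p : E ⥤ B) [p.IsFibered] : Prop where
  hasFiniteCoproducts (b : B) : HasFiniteCoproducts (Fiber p b)
  preserves {b b' : B} (u : b ⟶ b') (ι : Type) [Finite ι] :
    PreservesColimitsOfShape (Discrete ι) (reindex p u)

/-- The fibration `p` has fibred `w`-small filtered colimits. -/
class HasFibredFilteredColimits (p : E ⥤ B) [p.IsFibered] : Prop where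
  hasColimits (b : B) (J : Type w) [SmallCategory J] [IsFiltered J] :
    HasColimitsOfShape J (Fiber p b)
  preserves {b b' : B} (u : b ⟶ b') (J : Type w) [SmallCategory J] [IsFiltered J] :
    PreservesColimitsOfShape J (reindex p u)

/-- Suitable fibrations (small filtered colimits are those indexed by `w`-small categories). -/
structure IsSuitable (p : E ⥤ B) : Prop where
  isFibered : p.IsFibered
  fibredPullbacks : HasFibredPullbacks p
  fibredFiniteCoproducts : HasFibredFiniteCoproducts p
  fibredFilteredColimits : HasFibredFilteredColimits.{w} p
  /-- finite coproducts are universal in the fibres -/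
  universal_coproducts (b : B) (ι : Type) [Finite ι] (X : ι → Fiber p b) (c : Cofan X) :
    IsColimit c → IsUniversalColimit c
  /-- filtered colimits are universal in the fibres -/
  universal_filteredColimits (b : B) (J : Type w) [SmallCategory J] [IsFiltered J]
    (D : J ⥤ Fiber p b) (c : Cocone D) : IsColimit c → IsUniversalColimit c
  /-- filtered colimits commute with pullbacks in the fibres -/
  colim_preserves_pullbacks (b : B) (J : Type w) [SmallCategory J] [IsFiltered J] :
    haveI := fibredFilteredColimits.hasColimits b J
    PreservesLimitsOfShape WalkingCospan (colim : (J ⥤ Fiber p b) ⥤ Fiber p b)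

/-- Finite coproducts are disjoint in the fibres of `p`. -/
def HasDisjointFibreCoproducts (p : E ⥤ B) : Prop :=
  ∀ b : B, BinaryCoproductsDisjoint (Fiber p b)

/-- `T` is a fibred monad over `p`: `p ∘ T = p` and the components of the unit and of the
multiplication are vertical. -/
class IsFibredMonad (p : E ⥤ B) (T : Monad E) : Prop where
  comp_eq : T.toFunctor ⋙ p = p
  unit_vertical (X : E) : p.IsHomLift (𝟙 (p.obj X)) (T.η.app X)
  mul_vertical (X : E) : p.IsHomLift (𝟙 (p.obj X)) (T.μ.app X)

theorem obj_monad (p : E ⥤ B) (T : Monad E) [h : IsFibredMonad p T] (X : E) :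
    p.obj (T.obj X) = p.obj X :=
  Functor.congr_obj h.comp_eq X

theorem isHomLift_monad_map (p : E ⥤ B) (T : Monad E) [h : IsFibredMonad p T] {b b' : B}
    (u : b ⟶ b') {X Y : E} (f : X ⟶ Y) [p.IsHomLift u f] : p.IsHomLift u (T.map f) := by
  have key : p.map (T.map f) = eqToHom (obj_monad p T X) ≫ p.map f ≫
      eqToHom (obj_monad p T Y).symm := Functor.congr_hom h.comp_eq f
  refine IsHomLift.of_fac' p u _ ((obj_monad p T X).trans (IsHomLift.domain_eq p u f))
    ((obj_monad p T Y).trans (IsHomLift.codomain_eq p u f)) ?_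
  rw [key, IsHomLift.fac' p u f]
  simp

theorem isHomLift_unit (p : E ⥤ B) (T : Monad E) [h : IsFibredMonad p T] {b : B} {X : E}
    (hX : p.obj X = b) : p.IsHomLift (𝟙 b) (T.η.app X) := by
  subst hX
  exact h.unit_vertical X

theorem isHomLift_mul (p : E ⥤ B) (T : Monad E) [h : IsFibredMonad p T] {b : B} {X : E}
    (hX : p.obj X = b) : p.IsHomLift (𝟙 b) (T.μ.app X) := by
  subst hX
  exact h.mul_vertical X

/-- The restriction of a fibred monad to the fibre over `b`. -/
def fibreMonad (p : E ⥤ B) (T : Monad E) [h : IsFibredMonad p T] (b : B) : Monad (Fiber p b) where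
  obj X := Fiber.mk ((obj_monad p T (tot X)).trans (obj_tot X))
  map f := vert (T.map (totMap f)) (isHomLift_monad_map p T (𝟙 b) (totMap f))
  map_id X := Fiber.hom_ext (T.map_id (tot X))
  map_comp f g := Fiber.hom_ext ((congrArg T.map (Functor.map_comp _ f g)).trans (T.map_comp _ _))
  η :=
    { app := fun X => vert (T.η.app (tot X)) (isHomLift_unit p T (obj_tot X))
      naturality := fun X Y f => Fiber.hom_ext (T.η.naturality (totMap f)) }
  μ :=
    { app := fun X => vert (T.μ.app (tot X)) (isHomLift_mul p T (obj_tot X))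
      naturality := fun X Y f => Fiber.hom_ext (T.μ.naturality (totMap f)) }
  assoc X := Fiber.hom_ext (T.assoc (tot X))
  left_unit X := Fiber.hom_ext (T.left_unit (tot X))
  right_unit X := Fiber.hom_ext (T.right_unit (tot X))

/-- A monad is cartesian if its functor part preserves pullbacks and the naturality squares of its
unit and of its multiplication are pullbacks. -/
structure IsCartesianMonad {C : Type u} [Category.{v} C] (T : Monad C) : Prop where
  preserves : PreservesLimitsOfShape WalkingCospan T.toFunctor
  unit {X Y : C} (f : X ⟶ Y) : IsPullback f (T.η.app X) (T.η.app Y) (T.map f)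
  mul {X Y : C} (f : X ⟶ Y) : IsPullback (T.map (T.map f)) (T.μ.app X) (T.μ.app Y) (T.map f)

/-- `T` is cartesian relative to `p`. -/
structure IsRelCartesian (p : E ⥤ B) (T : Monad E) : Prop where
  fibred : IsFibredMonad p T
  cartesian (b : B) : IsCartesianMonad (fibreMonad p T b)

/-- The fibred monad `T` preserves `w`-small filtered colimits in the fibres of `p`. -/
def PreservesFibreFilteredColimits (p : E ⥤ B) (T : Monad E) [IsFibredMonad p T] : Prop :=
  ∀ (b : B) (J : Type w) [SmallCategory J] [IsFiltered J],
    PreservesColimitsOfShape J (fibreMonad p T b).toFunctor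

/-- `T` is suitable relative to `p`. -/
structure IsSuitableMonad (p : E ⥤ B) (T : Monad E) : Prop where
  relCartesian : IsRelCartesian p T
  preserves : haveI := relCartesian.fibred; PreservesFibreFilteredColimits.{w} p T

theorem reindex_map_prone (p : E ⥤ B) [p.IsFibered] {b b' : B} (u : b ⟶ b') {X Y : Fiber p b'}
    (f : X ⟶ Y) : totMap ((reindex p u).map f) ≫ prone p u Y = prone p u X ≫ totMap f :=
  IsCartesian.fac p u (proneMap p u Y) (proneMap p u X ≫ totMap f)

theorem isHomLift_of_comp_vertical (p : E ⥤ B) {a b : B} (v : a ⟶ b) {W X Y : E} (h : W ⟶ X)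
    (f : X ⟶ Y) [hf : p.IsHomLift (𝟙 b) f] [hv : p.IsHomLift v (h ≫ f)] : p.IsHomLift v h := by
  have hX : p.obj X = b := IsHomLift.domain_eq p (𝟙 b) f
  subst hX
  have hW : p.obj W = a := IsHomLift.domain_eq p v (h ≫ f)
  subst hW
  have h1 := IsHomLift.fac p v (h ≫ f)
  have h2 := IsHomLift.fac' p (𝟙 (p.obj X)) f
  refine IsHomLift.of_fac p v h rfl rfl ?_
  rw [h1, p.map_comp, h2]
  simp

/-- A morphism over `v` factors through the prone morphism over `v`. -/
theorem exists_fac (p : E ⥤ B) [p.IsFibered] {b b' : B} (v : b ⟶ b') (X : Fiber p b')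
    (W : Fiber p b) (k : tot W ⟶ tot X) (hk : p.IsHomLift v k) :
    ∃ l : W ⟶ (reindex p v).obj X, totMap l ≫ prone p v X = k :=
  ⟨vert (IsCartesian.map p v (prone p v X) k) (IsCartesian.map_isHomLift p v (prone p v X) k),
    IsCartesian.fac p v (prone p v X) k⟩

theorem prone_ext (p : E ⥤ B) [p.IsFibered] {b b' : B} (v : b ⟶ b') {X : Fiber p b'}
    {W : Fiber p b} {l l' : W ⟶ (reindex p v).obj X}
    (h : totMap l ≫ prone p v X = totMap l' ≫ prone p v X) : l = l' :=
  Fiber.hom_ext (IsCartesian.ext p v (prone p v X) (totMap l) (totMap l') h)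

/-- If `p` has fibred pullbacks, a pullback square in a fibre is a pullback square in the total
category. -/
theorem isPullback_of_fibre (p : E ⥤ B) [p.IsFibered] [HasFibredPullbacks p] {b : B}
    {P X Y Z : Fiber p b} {fst : P ⟶ X} {snd : P ⟶ Y} {f : X ⟶ Z} {g : Y ⟶ Z}
    (sq : IsPullback fst snd f g) :
    IsPullback (totMap fst) (totMap snd) (totMap f) (totMap g) := by
  have ex : ∀ {a : B} (W : Fiber p a) (h : tot W ⟶ tot X) (k : tot W ⟶ tot Y), h ≫ totMap f = k ≫ totMap g →
      ∃ l : tot W ⟶ tot P, l ≫ totMap fst = h ∧ l ≫ totMap snd = k := by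
    intro a W h k hk
    let v : a ⟶ b := eqToHom (obj_tot W).symm ≫ p.map h ≫ eqToHom (obj_tot X)
    have hv : p.IsHomLift v h := IsHomLift.of_fac p v h (obj_tot W) (obj_tot X) rfl
    have hkg : p.IsHomLift v (k ≫ totMap g) := hk ▸ inferInstance
    have kv : p.IsHomLift v k := isHomLift_of_comp_vertical p v k (totMap g)
    obtain ⟨h', hh'⟩ := exists_fac p v X W h hv
    obtain ⟨k', hk'⟩ := exists_fac p v Y W k kv
    have e : h' ≫ (reindex p v).map f = k' ≫ (reindex p v).map g := by
      apply prone_ext p v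
      rw [totMap_comp, totMap_comp, Category.assoc, Category.assoc,
        reindex_map_prone, reindex_map_prone, reassoc_of% hh', reassoc_of% hk']
      exact hk
    have l1 := congrArg totMap ((sq.map (reindex p v)).lift_fst h' k' e)
    have l2 := congrArg totMap ((sq.map (reindex p v)).lift_snd h' k' e)
    rw [totMap_comp] at l1 l2
    refine ⟨totMap ((sq.map (reindex p v)).lift h' k' e) ≫ prone p v P, ?_, ?_⟩
    · rw [Category.assoc, ← reindex_map_prone, reassoc_of% l1, hh']
    · rw [Category.assoc, ← reindex_map_prone, reassoc_of% l2, hk']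
  have un : ∀ {a : B} (W : Fiber p a) (l l' : tot W ⟶ tot P), l ≫ totMap fst = l' ≫ totMap fst →
      l ≫ totMap snd = l' ≫ totMap snd → l = l' := by
    intro a W l l' h1 h2
    let v : a ⟶ b := eqToHom (obj_tot W).symm ≫ p.map l ≫ eqToHom (obj_tot P)
    have hv : p.IsHomLift v l := IsHomLift.of_fac p v l (obj_tot W) (obj_tot P) rfl
    have hv2 : p.IsHomLift v (l' ≫ totMap fst) := h1 ▸ inferInstance
    have hv' : p.IsHomLift v l' := isHomLift_of_comp_vertical p v l' (totMap fst)
    obtain ⟨m, hm⟩ := exists_fac p v P W l hv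
    obtain ⟨m', hm'⟩ := exists_fac p v P W l' hv'
    have e : m = m' := by
      refine (sq.map (reindex p v)).hom_ext ?_ ?_
      · apply prone_ext p v
        rw [totMap_comp, totMap_comp, Category.assoc, Category.assoc,
          reindex_map_prone, reassoc_of% hm, reassoc_of% hm']
        exact h1
      · apply prone_ext p v
        rw [totMap_comp, totMap_comp, Category.assoc, Category.assoc,
          reindex_map_prone, reassoc_of% hm, reassoc_of% hm']
        exact h2
    rw [← hm, ← hm', e]
  refine ⟨⟨?_⟩, ⟨PullbackCone.IsLimit.mk _
    (fun s => (ex (Fiber.mk (a := s.pt) rfl) s.fst s.snd s.condition).choose)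
    (fun s => (ex (Fiber.mk (a := s.pt) rfl) s.fst s.snd s.condition).choose_spec.1)
    (fun s => (ex (Fiber.mk (a := s.pt) rfl) s.fst s.snd s.condition).choose_spec.2) ?_⟩⟩
  · rw [← totMap_comp, sq.w, totMap_comp]
  · intro s m h1 h2
    exact un (Fiber.mk (a := s.pt) rfl) _ _ (h1.trans (ex (Fiber.mk (a := s.pt) rfl) s.fst s.snd s.condition).choose_spec.1.symm)
      (h2.trans (ex (Fiber.mk (a := s.pt) rfl) s.fst s.snd s.condition).choose_spec.2.symm)

end Fibrations

section Graphs

variable {B : Type u₁} [Category.{v₁} B] {E : Type u₂} [Category.{v₂} E]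

/-- A `T`-graph relative to `p` with object of objects `O`: a span `O ⟵ A ⟶ T O` in a fibre
of `p`. -/
structure GraphOver (p : E ⥤ B) (T : Monad E) (O : E) where
  apex : E
  cod : apex ⟶ O
  dom : apex ⟶ T.obj O
  cod_vertical : p.IsHomLift (𝟙 (p.obj O)) cod
  dom_vertical : p.IsHomLift (𝟙 (p.obj O)) dom

attribute [instance] GraphOver.cod_vertical GraphOver.dom_vertical

variable {p : E ⥤ B} {T : Monad E}

/-- Morphisms of relative `T`-graphs over a given morphism `u : O ⟶ Q`. -/
@[ext]
structure GraphOver.Hom {O Q : E} (A : GraphOver p T O) (u : O ⟶ Q) (A' : GraphOver p T Q) where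
  map : A.apex ⟶ A'.apex
  cod_comm : map ≫ A'.cod = A.cod ≫ u
  dom_comm : map ≫ A'.dom = A.dom ≫ T.map u

/-- The identity, over `𝟙 O`. -/
@[simps]
def GraphOver.idHom {O : E} (A : GraphOver p T O) : A.Hom (𝟙 O) A where
  map := 𝟙 _
  cod_comm := by simp
  dom_comm := by simp

/-- Composition of morphisms over `u` and over `v`. -/
@[simps]
def GraphOver.Hom.comp {O Q R : E} {u : O ⟶ Q} {v : Q ⟶ R} {A₁ : GraphOver p T O}
    {A₂ : GraphOver p T Q} {A₃ : GraphOver p T R} (f : A₁.Hom u A₂) (g : A₂.Hom v A₃) :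
    A₁.Hom (u ≫ v) A₃ where
  map := f.map ≫ g.map
  cod_comm := by rw [Category.assoc, g.cod_comm, reassoc_of% f.cod_comm]
  dom_comm := by rw [Category.assoc, g.dom_comm, reassoc_of% f.dom_comm, T.map_comp]

variable (p T) in
/-- The objects of `Gph(T,p)`. -/
structure RelGraph where
  base : E
  graph : GraphOver p T base

/-- The morphisms of `Gph(T,p)`. -/
structure RelGraph.Hom (A A' : RelGraph p T) where
  base : A.base ⟶ A'.base
  hom : A.graph.Hom base A'.graph

theorem RelGraph.Hom.ext' {A A' : RelGraph p T} {f g : RelGraph.Hom A A'} (h₁ : f.base = g.base)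
    (h₂ : f.hom.map = g.hom.map) : f = g := by
  obtain ⟨u, f⟩ := f
  obtain ⟨u', g⟩ := g
  obtain rfl : u = u' := h₁
  obtain rfl : f = g := GraphOver.Hom.ext h₂
  rfl

instance : Category (RelGraph p T) where
  Hom := RelGraph.Hom
  id A := ⟨𝟙 _, A.graph.idHom⟩
  comp f g := ⟨f.base ≫ g.base, f.hom.comp g.hom⟩
  id_comp f := RelGraph.Hom.ext' (Category.id_comp _) (Category.id_comp _)
  comp_id f := RelGraph.Hom.ext' (Category.comp_id _) (Category.comp_id _)
  assoc f g h := RelGraph.Hom.ext' (Category.assoc _ _ _) (Category.assoc _ _ _)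

variable (p T) in
/-- The relative Burroni fibration `p_T : Gph(T,p) ⥤ E`. -/
@[simps]
def proj : RelGraph p T ⥤ E where
  obj A := A.base
  map f := f.base

end Graphs

section Tensor

variable {B : Type u₁} [Category.{v₁} B] {E : Type u₂} [Category.{v₂} E]
variable {p : E ⥤ B} {T : Monad E} [p.IsFibered] [HasFibredPullbacks p] [IsFibredMonad p T]
variable {O Q : E}

namespace GraphOver

/-- `δ_A : A ⟶ T O` as a morphism of the fibre. -/
def domV (A : GraphOver p T O) :
    (Fiber.mk (IsHomLift.domain_eq p (𝟙 (p.obj O)) A.dom) : Fiber p (p.obj O)) ⟶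
      Fiber.mk (obj_monad p T O) :=
  vert A.dom A.dom_vertical

/-- `T(γ_A) : T A ⟶ T O` as a morphism of the fibre. -/
def mapCodV (A : GraphOver p T O) :
    (Fiber.mk ((obj_monad p T A.apex).trans (IsHomLift.domain_eq p (𝟙 (p.obj O)) A.cod)) :
      Fiber p (p.obj O)) ⟶ Fiber.mk (obj_monad p T O) :=
  vert (T.map A.cod) (isHomLift_monad_map p T (𝟙 (p.obj O)) A.cod)

/-- The tensor product `A ⊗ A'`: the pullback of `δ_A : A ⟶ T O` and `T(γ_A') : T A' ⟶ T O` in the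
fibre, with codomain map `γ_A ∘ π₁` and domain map `μ_O ∘ T(δ_A') ∘ π₂`. -/
noncomputable def tensor (A A' : GraphOver p T O) : GraphOver p T O where
  apex := tot (pullback A.domV A'.mapCodV)
  cod := totMap (pullback.fst A.domV A'.mapCodV) ≫ A.cod
  dom := totMap (pullback.snd A.domV A'.mapCodV) ≫ T.map A'.dom ≫ T.μ.app O
  cod_vertical := (pullback.fst A.domV A'.mapCodV ≫ vert A.cod A.cod_vertical :
    _ ⟶ Fiber.mk rfl).2
  dom_vertical := (pullback.snd A.domV A'.mapCodV ≫
    vert (T.map A'.dom ≫ T.μ.app O) (by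
      have := isHomLift_monad_map p T (𝟙 (p.obj O)) A'.dom
      have := isHomLift_mul p T (X := O) rfl
      exact IsHomLift.comp_of_lift_id p (p.obj O) (T.map A'.dom) (T.μ.app O)) :
    _ ⟶ Fiber.mk (obj_monad p T O)).2

/-- `π₁ : A ⊗ A' ⟶ A`. -/
noncomputable def fst (A A' : GraphOver p T O) : (tensor A A').apex ⟶ A.apex :=
  totMap (pullback.fst A.domV A'.mapCodV)

/-- `π₂ : A ⊗ A' ⟶ T A'`. -/
noncomputable def snd (A A' : GraphOver p T O) : (tensor A A').apex ⟶ T.obj A'.apex :=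
  totMap (pullback.snd A.domV A'.mapCodV)

theorem tensor_cod (A A' : GraphOver p T O) : (tensor A A').cod = fst A A' ≫ A.cod := rfl

theorem tensor_dom (A A' : GraphOver p T O) :
    (tensor A A').dom = snd A A' ≫ T.map A'.dom ≫ T.μ.app O := rfl

theorem isPullback (A A' : GraphOver p T O) :
    IsPullback (fst A A') (snd A A') A.dom (T.map A'.cod) :=
  isPullback_of_fibre p (IsPullback.of_hasPullback A.domV A'.mapCodV)

/-- The tensor product `f ⊗_u f'` of two morphisms over `u`. -/
noncomputable def tensorHom {u : O ⟶ Q} {A A' : GraphOver p T O} {C C' : GraphOver p T Q}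
    (f : A.Hom u C) (f' : A'.Hom u C') : (tensor A A').Hom u (tensor C C') where
  map := (isPullback C C').lift (fst A A' ≫ f.map) (snd A A' ≫ T.map f'.map) (by
    rw [Category.assoc, f.dom_comm, (isPullback A A').w_assoc, Category.assoc, ← T.map_comp,
      ← T.map_comp, f'.cod_comm])
  cod_comm := by
    rw [tensor_cod, tensor_cod, IsPullback.lift_fst_assoc, Category.assoc, f.cod_comm,
      Category.assoc]
  dom_comm := by
    rw [tensor_dom, tensor_dom, IsPullback.lift_snd_assoc, Category.assoc, ← T.map_comp_assoc,
      f'.dom_comm, T.map_comp, Category.assoc, Category.assoc, Category.assoc]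
    congr 2
    exact T.μ.naturality u

variable (p T) in
/-- The unit `I_O = (O, 1_O, η_O)`. -/
abbrev unit (O : E) : GraphOver p T O where
  apex := O
  cod := 𝟙 O
  dom := T.η.app O
  cod_vertical := inferInstance
  dom_vertical := isHomLift_unit p T rfl

variable (p T) in
/-- The morphism `I_u : I_O ⟶ I_Q` over `u`. -/
def unitHom (u : O ⟶ Q) : (unit p T O).Hom u (unit p T Q) where
  map := u
  cod_comm := by simp [unit]
  dom_comm := T.η.naturality u

/-- `α : A ⊗ (A' ⊗ A'') ⟶ (A ⊗ A') ⊗ A''`. -/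
noncomputable def assoc (A A' A'' : GraphOver p T O) :
    (tensor A (tensor A' A'')).Hom (𝟙 O) (tensor (tensor A A') A'') where
  map := (isPullback (tensor A A') A'').lift
    ((isPullback A A').lift (fst A (tensor A' A''))
      (snd A (tensor A' A'') ≫ T.map (fst A' A'')) (by
        rw [(isPullback A (tensor A' A'')).w, Category.assoc, ← T.map_comp, tensor_cod]))
    (snd A (tensor A' A'') ≫ T.map (snd A' A'') ≫ T.μ.app A''.apex) (by
      have := T.μ.naturality A''.cod
      rw [tensor_dom, IsPullback.lift_snd_assoc, Category.assoc, Category.assoc, Category.assoc,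
        ← T.map_comp_assoc, (isPullback A' A'').w, T.map_comp, Category.assoc]
      exact congrArg (fun x => snd A (tensor A' A'') ≫ T.map (snd A' A'') ≫ x) this)
  cod_comm := by
    rw [Category.comp_id, tensor_cod A (tensor A' A''), tensor_cod (tensor A A') A'',
      IsPullback.lift_fst_assoc, tensor_cod A A', IsPullback.lift_fst_assoc]
  dom_comm := by
    have h1 : T.map (T.map A''.dom) ≫ T.μ.app (T.obj O) = T.μ.app A''.apex ≫ T.map A''.dom :=
      T.μ.naturality A''.dom
    have h2 : T.map (T.μ.app O) ≫ T.μ.app O = T.μ.app (T.obj O) ≫ T.μ.app O := T.assoc O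
    rw [T.map_id, Category.comp_id, tensor_dom A (tensor A' A''), tensor_dom (tensor A A') A'',
      IsPullback.lift_snd_assoc, tensor_dom A' A'', T.map_comp, T.map_comp]
    simp only [Category.assoc]
    rw [h2, reassoc_of% h1]

/-- `λ : A ⟶ I ⊗ A`. -/
noncomputable def lam (A : GraphOver p T O) : A.Hom (𝟙 O) (tensor (unit p T O) A) where
  map := (isPullback (unit p T O) A).lift A.cod (T.η.app A.apex) (T.η.naturality A.cod)
  cod_comm := by
    rw [tensor_cod, IsPullback.lift_fst_assoc]
  dom_comm := by
    have h1 : A.dom ≫ T.η.app (T.obj O) = T.η.app A.apex ≫ T.map A.dom := T.η.naturality A.dom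
    rw [tensor_dom, IsPullback.lift_snd_assoc, ← reassoc_of% h1, T.left_unit, T.map_id]
    rfl

/-- `ρ : A ⊗ I ⟶ A`. -/
noncomputable def rho (A : GraphOver p T O) : (tensor A (unit p T O)).Hom (𝟙 O) A where
  map := fst A (unit p T O)
  cod_comm := by
    rw [tensor_cod, Category.comp_id]
  dom_comm := by
    rw [(isPullback A (unit p T O)).w, tensor_dom, T.right_unit, T.map_id, Category.comp_id]
    exact ((Category.comp_id _).trans (Category.comp_id _)).symm

end GraphOver

end Tensor

section Monoids

variable {B : Type u₁} [Category.{v₁} B] {E : Type u₂} [Category.{v₂} E]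
variable (p : E ⥤ B) (T : Monad E) [p.IsFibered] [HasFibredPullbacks p] [IsFibredMonad p T]

open GraphOver

/-- The objects of `Mon(T,p)`: monoids in the fibres of the lax monoidal fibration `p_T`, that is,
relative `T`-categories. -/
structure RelMon where
  base : E
  graph : GraphOver p T base
  mul : (tensor graph graph).Hom (𝟙 base) graph
  one : (unit p T base).Hom (𝟙 base) graph
  mul_assoc : (assoc graph graph graph).map ≫ (tensorHom mul graph.idHom).map ≫ mul.map =
    (tensorHom graph.idHom mul).map ≫ mul.map
  one_mul : (lam graph).map ≫ (tensorHom one graph.idHom).map ≫ mul.map = 𝟙 graph.apex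
  mul_one : (tensorHom graph.idHom one).map ≫ mul.map = (rho graph).map

variable {p T}

/-- The morphisms of `Mon(T,p)`. -/
structure RelMon.Hom (M N : RelMon p T) where
  base : M.base ⟶ N.base
  hom : M.graph.Hom base N.graph
  mul_comm : (tensorHom hom hom).map ≫ N.mul.map = M.mul.map ≫ hom.map
  one_comm : M.one.map ≫ hom.map = (unitHom p T base).map ≫ N.one.map

theorem tensorHom_idHom {O : E} (A A' : GraphOver p T O) :
    (tensorHom A.idHom A'.idHom).map = 𝟙 (tensor A A').apex := by
  refine (isPullback A A').hom_ext ?_ ?_ <;> simp [tensorHom]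

theorem tensorHom_comp {O Q R : E} {u : O ⟶ Q} {v : Q ⟶ R} {A A' : GraphOver p T O}
    {C C' : GraphOver p T Q} {D D' : GraphOver p T R} (f : A.Hom u C) (g : C.Hom v D)
    (f' : A'.Hom u C') (g' : C'.Hom v D') :
    (tensorHom (f.comp g) (f'.comp g')).map = (tensorHom f f').map ≫ (tensorHom g g').map := by
  refine (isPullback D D').hom_ext ?_ ?_ <;> simp [tensorHom]

theorem RelMon.Hom.ext' {M N : RelMon p T} {f g : RelMon.Hom M N} (h₁ : f.base = g.base)
    (h₂ : f.hom.map = g.hom.map) : f = g := by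
  obtain ⟨u, f, _, _⟩ := f
  obtain ⟨u', g, _, _⟩ := g
  obtain rfl : u = u' := h₁
  obtain rfl : f = g := GraphOver.Hom.ext h₂
  rfl

instance : Category (RelMon p T) where
  Hom := RelMon.Hom
  id M := ⟨𝟙 _, M.graph.idHom, by rw [tensorHom_idHom]; simp, by simp [unitHom]⟩
  comp {M N P} f g := ⟨f.base ≫ g.base, f.hom.comp g.hom, by
      rw [tensorHom_comp, Category.assoc, g.mul_comm, reassoc_of% f.mul_comm]
      rfl, by
      rw [Hom.comp_map, reassoc_of% f.one_comm, g.one_comm]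
      simp [unitHom]⟩
  id_comp f := RelMon.Hom.ext' (Category.id_comp _) (Category.id_comp _)
  comp_id f := RelMon.Hom.ext' (Category.comp_id _) (Category.comp_id _)
  assoc f g h := RelMon.Hom.ext' (Category.assoc _ _ _) (Category.assoc _ _ _)

variable (p T) in
/-- The forgetful functor `U_T : Mon(T,p) ⥤ Gph(T,p)`. -/
def forget : RelMon p T ⥤ RelGraph p T where
  obj M := ⟨M.base, M.graph⟩
  map f := ⟨f.base, f.hom⟩

variable (p T) in
/-- The projection `q_T : Mon(T,p) ⥤ E`. -/
def monProj : RelMon p T ⥤ E where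
  obj M := M.base
  map f := f.base

/-- An adjunction `F ⊣ U_T` is fibred over `E`: `F` commutes with the projections to `E`, and the
unit and the counit have vertical components. -/
structure IsFibredAdjunction {F : RelGraph p T ⥤ RelMon p T} (adj : F ⊣ forget p T) : Prop where
  comp_eq : F ⋙ monProj p T = proj p T
  unit_vertical (A : RelGraph p T) :
    (proj p T).IsHomLift (𝟙 ((proj p T).obj A)) (adj.unit.app A)
  counit_vertical (M : RelMon p T) :
    (monProj p T).IsHomLift (𝟙 ((monProj p T).obj M)) (adj.counit.app M)

end Monoids

section Tower

/-- A stage of a tower: a category `Total` over `Base` with a monad on it. -/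
structure Stage where
  Base : Type (max u v)
  [baseCategory : Category.{v} Base]
  Total : Type (max u v)
  [totalCategory : Category.{v} Total]
  fib : Total ⥤ Base
  monad : Monad Total

attribute [instance] Stage.baseCategory Stage.totalCategory

/-- `S` arises from `(p, T)` by one step of the construction: it is `p_T : Gph(T,p) ⥤ E` with the
monad induced by a fibred adjunction `F ⊣ U_T`. -/
def IsIterate {B : Type u₁} [Category.{v₁} B] {E : Type (max u v)} [Category.{v} E]
    (p : E ⥤ B) (T : Monad E) (S : Stage.{v, u}) : Prop :=
  ∃ (_ : p.IsFibered) (_ : HasFibredPullbacks p) (_ : IsFibredMonad p T)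
    (F : RelGraph p T ⥤ RelMon p T) (adj : F ⊣ forget p T),
    IsFibredAdjunction adj ∧
      S = { Base := E, Total := RelGraph p T, fib := proj p T, monad := adj.toMonad }

/-- `S 0, S 1, …` is a tower obtained by iterating the construction, starting with `(p, T)`. -/
structure IsTower {B : Type u₁} [Category.{v₁} B] {E : Type (max u v)} [Category.{v} E]
    (p : E ⥤ B) (T : Monad E) (S : ℕ → Stage.{v, u}) : Prop where
  zero : IsIterate p T (S 0)
  succ (n : ℕ) : IsIterate (S n).fib (S n).monad (S (n + 1))

/-- The unique functor from `Set` to the terminal category. -/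
def setToOne : Type w ⥤ Discrete PUnit.{1} := Functor.star (Type w)

end Tower

end Burroni

/-!
Pullbacks and colimits of graphs over a fixed object `O` are created by the functor sending a graph
to its apex in the fibre of `p` over `p O` (`GraphOver.apexF`), so the category of these graphs
inherits the exactness properties of that fibre; and it is equivalent to
the fibre of `p_T` over `O`. The reindexing of a graph along `u : O ⟶ Q` is the limit, relative
to `p`, of `O ⟶ Q ⟵ A ⟶ T Q ⟵ T O`. On apices it maps to the reindexing of `p` by an equifibered natural
transformation, so it preserves colimits because these are universal
(`preservesColimitsOfShape_of_equifibered`). Hence `p_T` is a suitable fibration.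

When `T` is cartesian in the fibres, the coherence morphisms `α` and `λ` are invertible and graphs
over `O` form a monoidal category, whose monoids are the relative categories over `O`. The tensor
product preserves pullbacks and filtered colimits in both variables jointly, and preserves finite
coproducts in the left one, but in general not in the right one. So the free monoid on `A` is not
a sum of tensor powers; it is the colimit of the chain `I`, `I + A ⊗ I`, `I + A ⊗ (I + A ⊗ I)`, …,
that is, the initial algebra of `X ↦ I + A ⊗ X`. Since `- ⊗ X` preserves this colimit and these
coproducts, one can define morphisms out of `free A ⊗ X` by recursion (`FreeMonoid.exists_rec`,
`FreeMonoid.rec_unique`); the multiplication, the monoid laws and the universal property all follow.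
The chain also gives the exactness of the free monoid functor: it preserves filtered colimits, and
when coproducts are disjoint, universality and disjointness show by induction along the chain that
the free monoid monad is cartesian (`FreeMonoid.isCartesianMonad`).

The structure of a relative category can be reindexed, so a morphism over `u` from a graph to a
relative category `N` factors through the monoid `u^* N` over `O`, and the free monoids in the
categories of graphs over fixed objects assemble to a left adjoint of the forgetful functor which is
fibred over `E` (`freeAdj`). Left adjoints are unique, and the comparison between any two fibred ones
is vertical; so the monad induced by any fibred adjunction restricts, on the fibre over `O`, to
the free monoid monad (`fibreComparison`), from which the suitability of the induced monad follows.
Monadicity is Beck's theorem: a split coequalizer of graphs transports the structure of a relative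
category, as all operations are natural in morphisms over arbitrary morphisms of `E`
(`SplitQuotient.relMon`).

The properties established for one step are the hypotheses for the next one, so towers exist and
all their stages are suitable, by induction. In the category of sets, filtered colimits are universal
and commute with pullbacks, and finite coproducts are universal and disjoint; the identity monad is
suitable relative to every fibration.
-/

namespace Burroni

/-! ### Colimits that are stable under pullback -/

section Universal

variable {J : Type*} [Category* J] {C : Type*} [Category* C]

/-- A natural transformation whose naturality squares become pullbacks after composing with
cocones on both sides is equifibered. -/
theorem equifibered_of_isPullback_cocone {F F' : J ⥤ C} (α : F ⟶ F') (c : Cocone F)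
    (c' : Cocone F') (f : c.pt ⟶ c'.pt)
    (h : ∀ j, IsPullback (c.ι.app j) (α.app j) f (c'.ι.app j)) : NatTrans.Equifibered α := by
  intro i j g
  refine IsPullback.of_right ?_ (α.naturality g) (h j)
  simpa using h i

/-- A commutative square whose left side is a morphism of colimits is a pullback as soon as it is
so on each piece, provided the lower colimit is universal. -/
theorem isPullback_of_universal [HasPullbacks C] {F F' : J ⥤ C} {c : Cocone F} {c' : Cocone F'}
    (hc : IsColimit c) (hc' : IsUniversalColimit c') (α : F ⟶ F') {t : c.pt ⟶ c'.pt}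
    (ht : ∀ j, c.ι.app j ≫ t = α.app j ≫ c'.ι.app j) {Z Z' : C} {g : c.pt ⟶ Z} {g' : c'.pt ⟶ Z'}
    {ζ : Z ⟶ Z'} (h : ∀ j, IsPullback (c.ι.app j ≫ g) (α.app j) ζ (c'.ι.app j ≫ g')) :
    IsPullback g t ζ g' := by
  have w : g ≫ ζ = t ≫ g' := hc.hom_ext fun j => by
    rw [← Category.assoc, (h j).w, reassoc_of% (ht j)]
  obtain ⟨k, hk₁, hk₂⟩ : ∃ k : c.pt ⟶ pullback ζ g',
      k ≫ pullback.fst ζ g' = g ∧ k ≫ pullback.snd ζ g' = t :=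
    ⟨pullback.lift g t w, pullback.lift_fst _ _ _, pullback.lift_snd _ _ _⟩
  -- The pullback `Z ×_{Z'} c'.pt` is, by universality, a colimit of the same pieces as `c`.
  let d : Cocone F := c.extend k
  have hd : ∀ j, IsPullback (d.ι.app j) (α.app j) (pullback.snd ζ g') (c'.ι.app j) := fun j => by
    refine IsPullback.of_right (h₁₂ := pullback.fst ζ g') (h₂₂ := g') (v₁₃ := ζ) ?_ ?_ ?_
    · simpa [d, hk₁] using h j
    · simp [d, hk₂, ht]
    · exact IsPullback.of_hasPullback ζ g'
  obtain ⟨hd'⟩ := hc' d α (pullback.snd ζ g') (by ext j; simpa using ((hd j).w).symm)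
    (equifibered_of_isPullback_cocone α d c' _ hd) hd
  have : IsIso k := by
    have : (hc.coconePointUniqueUpToIso hd').hom = k := hc.hom_ext fun j => by simp [d]
    rw [← this]
    infer_instance
  exact IsPullback.of_iso_pullback ⟨w⟩ (asIso k) hk₁ hk₂

/-- If `κ : G₁ ⟶ G₂` is equifibered, `G₂` preserves colimits of shape `J` and these are universal
in the target, then `G₁` preserves colimits of shape `J`. -/
theorem preservesColimitsOfShape_of_equifibered {D : Type*} [Category* D] {G₁ G₂ : D ⥤ C}
    (κ : G₁ ⟶ G₂) (hκ : NatTrans.Equifibered κ) [PreservesColimitsOfShape J G₂]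
    (univ : ∀ (F : J ⥤ C) (c : Cocone F), IsColimit c → IsUniversalColimit c) :
    PreservesColimitsOfShape J G₁ where
  preservesColimit {F} :=
    { preserves := fun {c} hc => by
        refine univ _ _ (isColimitOfPreserves G₂ hc) (G₁.mapCocone c) (F.whiskerLeft κ)
          (κ.app c.pt) ?_ (hκ.whiskerLeft F) fun j => hκ (c.ι.app j)
        ext j
        simp }

end Universal

/-! ### Categories with the exactness properties of the fibres of a suitable fibration -/

section Suitable

variable {J : Type*} [Category* J] {C : Type*} [Category* C]

/-- Colimits of shape `J` commute with pullbacks in `C`: the colimit of a pointwise pullback square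
of diagrams is a pullback square. -/
def ColimitsCommutePullbacks (J : Type*) [Category* J] (C : Type*) [Category* C] : Prop :=
  ∀ ⦃P X Y Z : J ⥤ C⦄ (fst : P ⟶ X) (snd : P ⟶ Y) (f : X ⟶ Z) (g : Y ⟶ Z),
    (∀ j, IsPullback (fst.app j) (snd.app j) (f.app j) (g.app j)) →
    ∀ (cP : Cocone P) (cX : Cocone X) (cY : Cocone Y) (cZ : Cocone Z),
      IsColimit cP → IsColimit cX → IsColimit cY → IsColimit cZ →
    ∀ (fst' : cP.pt ⟶ cX.pt) (snd' : cP.pt ⟶ cY.pt) (f' : cX.pt ⟶ cZ.pt) (g' : cY.pt ⟶ cZ.pt),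
      (∀ j, cP.ι.app j ≫ fst' = fst.app j ≫ cX.ι.app j) →
      (∀ j, cP.ι.app j ≫ snd' = snd.app j ≫ cY.ι.app j) →
      (∀ j, cX.ι.app j ≫ f' = f.app j ≫ cZ.ι.app j) →
      (∀ j, cY.ι.app j ≫ g' = g.app j ≫ cZ.ι.app j) → IsPullback fst' snd' f' g'

theorem colimitsCommutePullbacks_of_preserves [HasColimitsOfShape J C]
    [PreservesLimitsOfShape WalkingCospan (colim : (J ⥤ C) ⥤ C)] :
    ColimitsCommutePullbacks J C := by
  intro P X Y Z fst snd f g h cP cX cY cZ hP hX hY hZ fst' snd' f' g' h₁ h₂ h₃ h₄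
  have key := (IsPullback.of_forall_isPullback_app h).map (colim : (J ⥤ C) ⥤ C)
  refine key.of_iso ((colimit.isColimit P).coconePointUniqueUpToIso hP)
    ((colimit.isColimit X).coconePointUniqueUpToIso hX)
    ((colimit.isColimit Y).coconePointUniqueUpToIso hY)
    ((colimit.isColimit Z).coconePointUniqueUpToIso hZ) ?_ ?_ ?_ ?_ <;>
  · refine colimit.hom_ext fun j => ?_
    simp [*]

theorem ColimitsCommutePullbacks.preserves [HasPullbacks C] [HasColimitsOfShape J C]
    (H : ColimitsCommutePullbacks J C) :
    PreservesLimitsOfShape WalkingCospan (colim : (J ⥤ C) ⥤ C) := by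
  refine preservesLimitsOfShape_walkingCospan_of_forall_isPullback fun X Y Z f g => ?_
  exact ⟨_, _, _, IsPullback.of_hasPullback f g,
    H _ _ _ _ (fun j => (IsPullback.of_hasPullback f g).app j) _ _ _ _ (colimit.isColimit _)
      (colimit.isColimit _) (colimit.isColimit _) (colimit.isColimit _) _ _ _ _
      (by simp) (by simp) (by simp) (by simp)⟩

theorem ColimitsCommutePullbacks.of_equivalence {K : Type*} [Category* K] (e : J ≌ K)
    (H : ColimitsCommutePullbacks J C) : ColimitsCommutePullbacks K C :=
  fun _ _ _ _ fst snd f g h _ _ _ _ hP hX hY hZ fst' snd' f' g' h₁ h₂ h₃ h₄ =>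
    H (e.functor.whiskerLeft fst) (e.functor.whiskerLeft snd) (e.functor.whiskerLeft f)
      (e.functor.whiskerLeft g) (fun j => h (e.functor.obj j)) _ _ _ _ (hP.whiskerEquivalence e)
      (hX.whiskerEquivalence e) (hY.whiskerEquivalence e) (hZ.whiskerEquivalence e) fst' snd' f' g'
      (fun j => h₁ (e.functor.obj j)) (fun j => h₂ (e.functor.obj j))
      (fun j => h₃ (e.functor.obj j)) (fun j => h₄ (e.functor.obj j))

/-- Commutation of colimits with pullbacks lifts along a functor that reflects pullbacks and
preserves the pullbacks and colimits in question. -/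
theorem ColimitsCommutePullbacks.of_functor {D : Type*} [Category* D] (G : D ⥤ C)
    [PreservesLimitsOfShape WalkingCospan G] [ReflectsLimitsOfShape WalkingCospan G]
    [PreservesColimitsOfShape J G] (H : ColimitsCommutePullbacks J C) :
    ColimitsCommutePullbacks J D := by
  intro P X Y Z fst snd f g h cP cX cY cZ hP hX hY hZ fst' snd' f' g' h₁ h₂ h₃ h₄
  refine IsPullback.of_map G ?_ ?_
  · refine hP.hom_ext fun j => ?_
    rw [reassoc_of% (h₁ j), h₃, reassoc_of% (h₂ j), h₄, ← Category.assoc, ← Category.assoc,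
      (h j).w]
  · refine H (whiskerRight fst G) (whiskerRight snd G) (whiskerRight f G) (whiskerRight g G)
      (fun j => (h j).map G) _ _ _ _ (isColimitOfPreserves G hP) (isColimitOfPreserves G hX)
      (isColimitOfPreserves G hY) (isColimitOfPreserves G hZ) _ _ _ _ ?_ ?_ ?_ ?_ <;>
    · intro j
      simp [← Functor.map_comp, *]

end Suitable

section SuitableCategory

/-- The exactness properties which a suitable fibration requires of each of its fibres: pullbacks,
universal finite coproducts, and universal `w`-small filtered colimits commuting with pullbacks. -/
structure IsSuitableCategory (C : Type*) [Category* C] : Prop where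
  hasPullbacks : HasPullbacks C
  hasFiniteCoproducts : HasFiniteCoproducts C
  hasFilteredColimits (J : Type w) [SmallCategory J] [IsFiltered J] : HasColimitsOfShape J C
  universal_coproducts (ι : Type) [Finite ι] (X : ι → C) (c : Cofan X) :
    IsColimit c → IsUniversalColimit c
  universal_filteredColimits (J : Type w) [SmallCategory J] [IsFiltered J] (D : J ⥤ C)
    (c : Cocone D) : IsColimit c → IsUniversalColimit c
  commute (J : Type w) [SmallCategory J] [IsFiltered J] : ColimitsCommutePullbacks J C

variable {C : Type*} [Category* C]

theorem IsSuitable.fibre {B : Type u₁} [Category.{v₁} B] {E : Type u₂} [Category.{v₂} E]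
    {p : E ⥤ B} (hp : IsSuitable.{w} p) (b : B) : IsSuitableCategory.{w} (Fiber p b) where
  hasPullbacks := by
    have := hp.isFibered
    exact hp.fibredPullbacks.hasPullbacks b
  hasFiniteCoproducts := by
    have := hp.isFibered
    exact hp.fibredFiniteCoproducts.hasFiniteCoproducts b
  hasFilteredColimits J _ _ := by
    have := hp.isFibered
    exact hp.fibredFilteredColimits.hasColimits b J
  universal_coproducts := hp.universal_coproducts b
  universal_filteredColimits := hp.universal_filteredColimits b
  commute J _ _ := by
    have := hp.isFibered
    have := hp.fibredFilteredColimits.hasColimits b J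
    have := hp.colim_preserves_pullbacks b J
    exact colimitsCommutePullbacks_of_preserves

theorem IsSuitable.mk_of_fibres {B : Type u₁} [Category.{v₁} B] {E : Type u₂} [Category.{v₂} E]
    {p : E ⥤ B} [hp : p.IsFibered] (h : ∀ b, IsSuitableCategory.{w} (Fiber p b))
    (h₁ : ∀ {b b' : B} (u : b ⟶ b'), PreservesLimitsOfShape WalkingCospan (reindex p u))
    (h₂ : ∀ {b b' : B} (u : b ⟶ b') (ι : Type) [Finite ι],
      PreservesColimitsOfShape (Discrete ι) (reindex p u))
    (h₃ : ∀ {b b' : B} (u : b ⟶ b') (J : Type w) [SmallCategory J] [IsFiltered J],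
      PreservesColimitsOfShape J (reindex p u)) : IsSuitable.{w} p where
  isFibered := hp
  fibredPullbacks := ⟨fun b => (h b).hasPullbacks, h₁⟩
  fibredFiniteCoproducts := ⟨fun b => (h b).hasFiniteCoproducts, h₂⟩
  fibredFilteredColimits := ⟨fun b => (h b).hasFilteredColimits, h₃⟩
  universal_coproducts b := (h b).universal_coproducts
  universal_filteredColimits b := (h b).universal_filteredColimits
  colim_preserves_pullbacks b J _ _ := by
    have := (h b).hasPullbacks
    have := (h b).hasFilteredColimits J
    exact ((h b).commute J).preserves

theorem IsSuitableCategory.isUniversalColimit_of_finite (h : IsSuitableCategory.{w} C)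
    {ι : Type} [Finite ι] {F : Discrete ι ⥤ C} {c : Cocone F} (hc : IsColimit c) :
    IsUniversalColimit c := by
  let e : F ≅ Discrete.functor fun i => F.obj ⟨i⟩ := Discrete.natIsoFunctor
  have key := h.universal_coproducts ι _ ((Cocone.precompose e.inv).obj c)
    ((IsColimit.precomposeInvEquiv e c).symm hc)
  exact (key.precompose_isIso e.hom).of_iso (Cocone.ext (Iso.refl _) (by simp))

/-- The exactness properties lift along a functor creating the (co)limits in question. -/
theorem IsSuitableCategory.of_creates {D : Type*} [Category* D] (h : IsSuitableCategory.{w} C)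
    (G : D ⥤ C) [CreatesLimitsOfShape WalkingCospan G]
    [∀ (ι : Type) [Finite ι], CreatesColimitsOfShape (Discrete ι) G]
    [∀ (J : Type w) [SmallCategory J] [IsFiltered J], CreatesColimitsOfShape J G] :
    IsSuitableCategory.{w} D where
  hasPullbacks := by
    have := h.hasPullbacks
    exact hasLimitsOfShape_of_hasLimitsOfShape_createsLimitsOfShape G
  hasFiniteCoproducts := ⟨fun n => by
    have := h.hasFiniteCoproducts
    exact hasColimitsOfShape_of_hasColimitsOfShape_createsColimitsOfShape G⟩
  hasFilteredColimits J _ _ := by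
    have := h.hasFilteredColimits J
    exact hasColimitsOfShape_of_hasColimitsOfShape_createsColimitsOfShape G
  universal_coproducts ι _ X c hc := by
    have := h.hasPullbacks
    have := h.hasFiniteCoproducts
    exact IsUniversalColimit.of_mapCocone G
      (h.isUniversalColimit_of_finite (isColimitOfPreserves G hc))
  universal_filteredColimits J _ _ F c hc := by
    have := h.hasPullbacks
    have := h.hasFilteredColimits J
    exact IsUniversalColimit.of_mapCocone G
      (h.universal_filteredColimits J _ _ (isColimitOfPreserves G hc))
  commute J _ _ := by
    have := h.hasPullbacks
    have := h.hasFilteredColimits J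
    exact (h.commute J).of_functor G

/-- A filtered category that is small in the universe `0`, such as `ℕ`, is equivalent to a `w`-small
one; so the exactness properties of filtered colimits hold for it too. -/
theorem IsSuitableCategory.exists_asSmall (J : Type) [SmallCategory J] [IsFiltered J] :
    ∃ (K : Type w) (_ : SmallCategory K) (_ : IsFiltered K), Nonempty (K ≌ J) :=
  ⟨AsSmall.{w} J, inferInstance, IsFiltered.of_equivalence AsSmall.equiv,
    ⟨AsSmall.equiv.symm⟩⟩

theorem IsSuitableCategory.hasColimitsOfShape (h : IsSuitableCategory.{w} C) (J : Type)
    [SmallCategory J] [IsFiltered J] : HasColimitsOfShape J C := by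
  obtain ⟨K, _, _, ⟨e⟩⟩ := exists_asSmall.{w} J
  have := h.hasFilteredColimits K
  exact hasColimitsOfShape_of_equivalence e

theorem IsSuitableCategory.isUniversalColimit (h : IsSuitableCategory.{w} C) {J : Type}
    [SmallCategory J] [IsFiltered J] {F : J ⥤ C} {c : Cocone F} (hc : IsColimit c) :
    IsUniversalColimit c := by
  obtain ⟨K, _, _, ⟨e⟩⟩ := exists_asSmall.{w} J
  exact (IsUniversalColimit.whiskerEquivalence_iff e).1
    (h.universal_filteredColimits K _ _ (hc.whiskerEquivalence e))

theorem IsSuitableCategory.colimitsCommutePullbacks (h : IsSuitableCategory.{w} C) (J : Type)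
    [SmallCategory J] [IsFiltered J] : ColimitsCommutePullbacks J C := by
  obtain ⟨K, _, _, ⟨e⟩⟩ := exists_asSmall.{w} J
  exact (h.commute K).of_equivalence e

/-- A functor preserving `w`-small filtered colimits preserves those indexed by filtered categories
that are small in the universe `0`. -/
theorem preservesColimitsOfShape_of_preservesFiltered {D : Type*} [Category* D] (G : C ⥤ D)
    (J : Type) [SmallCategory J] [IsFiltered J]
    (hG : ∀ (K : Type w) [SmallCategory K] [IsFiltered K], PreservesColimitsOfShape K G) :
    PreservesColimitsOfShape J G := by
  obtain ⟨K, _, _, ⟨e⟩⟩ := IsSuitableCategory.exists_asSmall.{w} J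
  have := hG K
  exact preservesColimitsOfShape_of_equiv e G

end SuitableCategory

/-! ### Disjoint coproducts -/

section Disjoint

variable {C : Type*} [Category* C] [HasPullbacks C]

/-- In a category with universal and disjoint binary coproducts, the squares formed by a coproduct
injection and a coproduct of two morphisms are pullbacks. -/
theorem isPullback_inl_of_disjoint [HasFiniteCoproducts C]
    (univ : ∀ {X Y : C} (c : BinaryCofan X Y), IsColimit c → IsUniversalColimit c)
    [BinaryCoproductsDisjoint C] {X Y S X' Y' S' : C} {i : X ⟶ S} {j : Y ⟶ S} {i' : X' ⟶ S'}
    {j' : Y' ⟶ S'} (hc : IsColimit (BinaryCofan.mk i j)) (hc' : IsColimit (BinaryCofan.mk i' j'))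
    {f : X ⟶ X'} {g : Y ⟶ Y'} {t : S ⟶ S'} (hf : i ≫ t = f ≫ i') (hg : j ≫ t = g ≫ j') :
    IsPullback i f t i' := by
  have : HasStrictInitialObjects C := by
    have : IsIso (BinaryCofan.mk (𝟙 (⊥_ C)) (𝟙 (⊥_ C))).inr := inferInstanceAs (IsIso (𝟙 (⊥_ C)))
    exact hasStrictInitial_of_isUniversal (univ _
      ((BinaryCofan.isColimit_iff_isIso_inr initialIsInitial _).mpr this).some)
  have : Mono i' := Mono.of_binaryCoproductDisjoint_left j' hc'
  -- The pullback `Q` of `i'` along `t` is the coproduct of its pullbacks to `X` and to `Y`;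
  -- the first is `X`, and the second is initial because it maps to `X' ×_{S'} Y'`.
  let Q := pullback t i'
  obtain ⟨k, hk₁, hk₂⟩ : ∃ k : X ⟶ Q, k ≫ pullback.fst _ _ = i ∧ k ≫ pullback.snd _ _ = f :=
    ⟨pullback.lift i f hf, pullback.lift_fst _ _ _, pullback.lift_snd _ _ _⟩
  have h₁ : IsPullback k (𝟙 X) (pullback.fst t i') i :=
    IsPullback.of_vert_isIso_mono ⟨by rw [hk₁, Category.id_comp]⟩
  have h₂ : IsPullback (initial.to Q) (initial.to Y) (pullback.fst t i') j := by
    have ini (s : PullbackCone (pullback.fst t i') j) : IsInitial s.pt := by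
      refine IsInitial.ofStrict (pullback.lift (s.fst ≫ pullback.snd t i') (s.snd ≫ g) ?_)
        (IsInitial.ofBinaryCoproductDisjointOfIsColimit hc')
      rw [Category.assoc, ← pullback.condition, s.condition_assoc, hg, Category.assoc]
    exact ⟨⟨initial.hom_ext _ _⟩, ⟨PullbackCone.IsLimit.mk _ (fun s => (ini s).to _)
      (fun s => (ini s).hom_ext _ _) (fun s => (ini s).hom_ext _ _)
      (fun s _ _ _ => (ini s).hom_ext _ _)⟩⟩
  obtain ⟨hQ⟩ := univ _ hc (BinaryCofan.mk k (initial.to Q)) (mapPair (𝟙 X) (initial.to Y))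
    (pullback.fst t i') (by ext ⟨⟨⟩⟩; exacts [h₁.w.symm, h₂.w.symm]) (.of_discrete _)
    (by rintro ⟨⟨⟩⟩; exacts [h₁, h₂])
  have : IsIso k := (BinaryCofan.isColimit_iff_isIso_inl initialIsInitial _).1 ⟨hQ⟩
  exact IsPullback.of_iso_pullback ⟨hf⟩ (@asIso _ _ _ _ k this) hk₁ hk₂

theorem isPullback_inr_of_disjoint [HasFiniteCoproducts C]
    (univ : ∀ {X Y : C} (c : BinaryCofan X Y), IsColimit c → IsUniversalColimit c)
    [BinaryCoproductsDisjoint C] {X Y S X' Y' S' : C} {i : X ⟶ S} {j : Y ⟶ S} {i' : X' ⟶ S'}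
    {j' : Y' ⟶ S'} (hc : IsColimit (BinaryCofan.mk i j)) (hc' : IsColimit (BinaryCofan.mk i' j'))
    {f : X ⟶ X'} {g : Y ⟶ Y'} {t : S ⟶ S'} (hf : i ≫ t = f ≫ i') (hg : j ≫ t = g ≫ j') :
    IsPullback j g t j' :=
  isPullback_inl_of_disjoint univ (BinaryCofan.isColimitFlip hc) (BinaryCofan.isColimitFlip hc')
    hg hf

/-- The binary form of `isPullback_of_universal`. -/
theorem isPullback_of_universal_cofan
    (univ : ∀ {X Y : C} (c : BinaryCofan X Y), IsColimit c → IsUniversalColimit c)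
    {X Y S X' Y' S' : C} {i : X ⟶ S} {j : Y ⟶ S} {i' : X' ⟶ S'}
    {j' : Y' ⟶ S'} (hc : IsColimit (BinaryCofan.mk i j)) (hc' : IsColimit (BinaryCofan.mk i' j'))
    {f : X ⟶ X'} {g : Y ⟶ Y'} {t : S ⟶ S'} (hf : i ≫ t = f ≫ i') (hg : j ≫ t = g ≫ j')
    {Z Z' : C} {k : S ⟶ Z} {k' : S' ⟶ Z'} {ζ : Z ⟶ Z'} (h₁ : IsPullback (i ≫ k) f ζ (i' ≫ k'))
    (h₂ : IsPullback (j ≫ k) g ζ (j' ≫ k')) : IsPullback k t ζ k' :=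
  isPullback_of_universal hc (univ _ hc') (mapPair f g)
    (by rintro ⟨⟨⟩⟩; exacts [hf, hg]) (by rintro ⟨⟨⟩⟩; exacts [h₁, h₂])

/-- In a category with universal and disjoint binary coproducts, the coproduct of two pullback
squares is a pullback square. -/
theorem isPullback_coprod_of_disjoint [HasFiniteCoproducts C]
    (univ : ∀ {X Y : C} (c : BinaryCofan X Y), IsColimit c → IsUniversalColimit c)
    [BinaryCoproductsDisjoint C] {P X Y Z P' X' Y' Z' : C} {fst : P ⟶ X} {snd : P ⟶ Y} {f : X ⟶ Z}
    {g : Y ⟶ Z} {fst' : P' ⟶ X'} {snd' : P' ⟶ Y'} {f' : X' ⟶ Z'} {g' : Y' ⟶ Z'}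
    (h : IsPullback fst snd f g) (h' : IsPullback fst' snd' f' g') :
    IsPullback (coprod.map fst fst') (coprod.map snd snd') (coprod.map f f')
      (coprod.map g g') := by
  have c (A B : C) : IsColimit (BinaryCofan.mk (coprod.inl : A ⟶ A ⨿ B) coprod.inr) :=
    coprodIsCoprod A B
  refine isPullback_of_universal_cofan univ (c P P') (c Y Y') (coprod.inl_map _ _)
    (coprod.inr_map _ _) ?_ ?_
  · rw [coprod.inl_map, coprod.inl_map]
    exact h.flip.paste_vert (isPullback_inl_of_disjoint univ (c X X') (c Z Z') (coprod.inl_map _ _)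
      (coprod.inr_map _ _)).flip |>.flip
  · rw [coprod.inr_map, coprod.inr_map]
    exact h'.flip.paste_vert (isPullback_inr_of_disjoint univ (c X X') (c Z Z')
      (coprod.inl_map _ _) (coprod.inr_map _ _)).flip |>.flip

end Disjoint

end Burroni

/-! ### Free monoids in a monoidal category -/

namespace Burroni.FreeMonoid

open MonoidalCategory

section Chain

variable (C : Type u) [Category.{v} C] [MonoidalCategory C] [HasBinaryCoproducts C]

/-- The endofunctor `P ↦ (A ↦ I + A ⊗ P A)` of the category of endofunctors of `C`. -/
@[simps]
noncomputable def step : (C ⥤ C) ⥤ (C ⥤ C) where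
  obj P :=
    { obj := fun A => 𝟙_ C ⨿ (A ⊗ P.obj A)
      map := fun f => coprod.map (𝟙 _) (f ⊗ₘ P.map f)
      map_id := fun A => by simp
      map_comp := fun f g => by simp }
  map {P Q} τ :=
    { app := fun A => coprod.map (𝟙 _) (A ◁ τ.app A)
      naturality := fun A A' f => by
        have : (f ⊗ₘ P.map f) ≫ A' ◁ τ.app A' = A ◁ τ.app A ≫ (f ⊗ₘ Q.map f) := by
          rw [← id_tensorHom, ← id_tensorHom, tensorHom_comp_tensorHom, tensorHom_comp_tensorHom,
            τ.naturality, Category.comp_id, Category.id_comp]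
        simp only [coprod.map_map, this] }
  map_id P := by ext A : 2; simp
  map_comp σ τ := by ext A : 2; simp

/-- The functors `A ↦ I + A ⊗ (I + A ⊗ (⋯ ⊗ (I + A ⊗ I)))`. -/
noncomputable def iter : ℕ → (C ⥤ C)
  | 0 => (Functor.const C).obj (𝟙_ C)
  | n + 1 => (step C).obj (iter n)

/-- The transition morphisms between successive `iter n`. -/
noncomputable def incl : ∀ n, iter C n ⟶ iter C (n + 1)
  | 0 =>
    { app := fun _ => (coprod.inl : 𝟙_ C ⟶ _)
      naturality := fun _ _ f => (Category.id_comp _).trans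
        ((coprod.inl_map (𝟙 (𝟙_ C)) (f ⊗ₘ 𝟙 (𝟙_ C))).trans (Category.id_comp _)).symm }
  | n + 1 => (step C).map (incl n)

/-- The chain of the functors `iter n`. -/
noncomputable def chain : ℕ ⥤ C ⥤ C := Functor.ofSequence (incl C)

end Chain

section Iter

variable {C : Type u} [Category.{v} C] [MonoidalCategory C] [HasBinaryCoproducts C]

/-- `iter 0 A` is the unit object. -/
noncomputable def iterZero (A : C) : 𝟙_ C ≅ (iter C 0).obj A := Iso.refl _

/-- The left coproduct injection into `iter (n + 1) A = I + A ⊗ iter n A`. -/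
noncomputable def iterOne (n : ℕ) (A : C) : 𝟙_ C ⟶ (iter C (n + 1)).obj A :=
  (coprod.inl : _ ⟶ 𝟙_ C ⨿ (A ⊗ (iter C n).obj A))

/-- The right coproduct injection into `iter (n + 1) A = I + A ⊗ iter n A`. -/
noncomputable def iterAct (n : ℕ) (A : C) : A ⊗ (iter C n).obj A ⟶ (iter C (n + 1)).obj A :=
  (coprod.inr : _ ⟶ 𝟙_ C ⨿ (A ⊗ (iter C n).obj A))

/-- `iter (n + 1) A` is the coproduct of `I` and `A ⊗ iter n A`. -/
noncomputable def isColimitIter (n : ℕ) (A : C) :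
    IsColimit (BinaryCofan.mk (iterOne n A) (iterAct n A)) :=
  coprodIsCoprod _ _

theorem iterZero_map {A A' : C} (f : A ⟶ A') :
    (iterZero A).hom ≫ (iter C 0).map f = (iterZero A').hom :=
  Category.id_comp _

theorem iterZero_inv {A A' : C} (f : A ⟶ A') :
    (iter C 0).map f ≫ (iterZero A').inv = (iterZero A).inv :=
  Category.id_comp _

theorem iterOne_map (n : ℕ) {A A' : C} (f : A ⟶ A') :
    iterOne n A ≫ (iter C (n + 1)).map f = iterOne n A' :=
  (coprod.inl_map _ _).trans (Category.id_comp _)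

theorem iterAct_map (n : ℕ) {A A' : C} (f : A ⟶ A') :
    iterAct n A ≫ (iter C (n + 1)).map f = (f ⊗ₘ (iter C n).map f) ≫ iterAct n A' :=
  coprod.inr_map _ _

theorem iterZero_incl (A : C) : (iterZero A).hom ≫ (incl C 0).app A = iterOne 0 A :=
  Category.id_comp _

theorem iterOne_incl (n : ℕ) (A : C) :
    iterOne n A ≫ (incl C (n + 1)).app A = iterOne (n + 1) A :=
  (coprod.inl_map _ _).trans (Category.id_comp _)

theorem iterAct_incl (n : ℕ) (A : C) :
    iterAct n A ≫ (incl C (n + 1)).app A = A ◁ (incl C n).app A ≫ iterAct (n + 1) A :=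
  coprod.inr_map _ _

end Iter

section Right

variable {C : Type u} [Category.{v} C] [MonoidalCategory C] [HasBinaryCoproducts C]
variable [∀ X : C, PreservesColimitsOfShape (Discrete WalkingPair) (tensorRight X)]

/-- `iter (n + 1) A ⊗ X` is the coproduct of `I ⊗ X` and `(A ⊗ iter n A) ⊗ X`. -/
noncomputable def isColimitIterRight (n : ℕ) (A X : C) :
    IsColimit (BinaryCofan.mk (iterOne n A ▷ X) (iterAct n A ▷ X)) :=
  mapIsColimitOfPreservesOfIsColimit (tensorRight X) _ _ (isColimitIter n A)

theorem iter_whiskerRight_hom_ext {n : ℕ} {A X D : C} {f g : (iter C (n + 1)).obj A ⊗ X ⟶ D}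
    (h₁ : iterOne n A ▷ X ≫ f = iterOne n A ▷ X ≫ g)
    (h₂ : iterAct n A ▷ X ≫ f = iterAct n A ▷ X ≫ g) : f = g :=
  BinaryCofan.IsColimit.hom_ext (isColimitIterRight n A X) h₁ h₂

theorem exists_iter_whiskerRight_desc {n : ℕ} {A X D : C} (f : 𝟙_ C ⊗ X ⟶ D)
    (g : (A ⊗ (iter C n).obj A) ⊗ X ⟶ D) :
    ∃ k : (iter C (n + 1)).obj A ⊗ X ⟶ D, iterOne n A ▷ X ≫ k = f ∧ iterAct n A ▷ X ≫ k = g :=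
  let k := BinaryCofan.IsColimit.desc' (isColimitIterRight n A X) f g
  ⟨k.1, k.2.1, k.2.2⟩

variable {A X D : C} (f : X ⟶ D) (a : A ⊗ D ⟶ D)

/-- The morphism `iter n A ⊗ X ⟶ D` defined by `f : X ⟶ D` and an action of `A` on `D`. -/
noncomputable def recIter : ∀ n, (iter C n).obj A ⊗ X ⟶ D
  | 0 => (iterZero A).inv ▷ X ≫ (λ_ X).hom ≫ f
  | n + 1 => (exists_iter_whiskerRight_desc ((λ_ X).hom ≫ f)
      ((α_ A _ X).hom ≫ A ◁ recIter n ≫ a)).choose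

theorem iterOne_recIter (n : ℕ) :
    iterOne n A ▷ X ≫ recIter f a (n + 1) = (λ_ X).hom ≫ f :=
  (exists_iter_whiskerRight_desc _ _).choose_spec.1

theorem iterAct_recIter (n : ℕ) :
    iterAct n A ▷ X ≫ recIter f a (n + 1) = (α_ A _ X).hom ≫ A ◁ recIter f a n ≫ a :=
  (exists_iter_whiskerRight_desc _ _).choose_spec.2

theorem incl_recIter (n : ℕ) :
    (incl C n).app A ▷ X ≫ recIter f a (n + 1) = recIter f a n := by
  induction n with
  | zero =>
    rw [← cancel_epi ((iterZero A).hom ▷ X), ← comp_whiskerRight_assoc, iterZero_incl,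
      iterOne_recIter, recIter, ← comp_whiskerRight_assoc, Iso.hom_inv_id, id_whiskerRight,
      Category.id_comp]
  | succ n ih =>
    refine iter_whiskerRight_hom_ext ?_ ?_
    · rw [iterOne_recIter, ← comp_whiskerRight_assoc, iterOne_incl, iterOne_recIter]
    · rw [iterAct_recIter, ← comp_whiskerRight_assoc, iterAct_incl, comp_whiskerRight_assoc,
        iterAct_recIter, ← ih]
      simp

end Right

section Free

variable (C : Type u) [Category.{v} C] [MonoidalCategory C] [HasBinaryCoproducts C]
variable [HasColimitsOfShape ℕ C]

/-- The underlying functor of the free monoid functor. -/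
noncomputable def free : C ⥤ C := colimit (chain C)

/-- The colimit cocone of the chain. -/
noncomputable def ι (n : ℕ) : iter C n ⟶ free C := colimit.ι (chain C) n

theorem incl_ι (n : ℕ) : incl C n ≫ ι C (n + 1) = ι C n := by
  have := colimit.w (chain C) (homOfLE (Nat.le_add_right n 1))
  rwa [chain, Functor.ofSequence_map_homOfLE_succ] at this

end Free

section Free

variable {C : Type u} [Category.{v} C] [MonoidalCategory C] [HasBinaryCoproducts C]

/-- The chain of the objects `iter n A`. -/
noncomputable abbrev chainAt (A : C) : ℕ ⥤ C := chain C ⋙ (evaluation C C).obj A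

theorem chainAt_map (A : C) (n : ℕ) :
    (chainAt A).map (homOfLE (Nat.le_add_right n 1)) = (incl C n).app A :=
  congrArg (fun τ => NatTrans.app τ A) (Functor.ofSequence_map_homOfLE_succ (incl C) n)

variable [HasColimitsOfShape ℕ C]

theorem incl_ι_app (n : ℕ) (A : C) : (incl C n).app A ≫ (ι C (n + 1)).app A = (ι C n).app A :=
  NatTrans.congr_app (incl_ι C n) A

/-- The colimit cocone of the chain, evaluated at an object. -/
noncomputable abbrev coconeAt (A : C) : Cocone (chainAt A) :=
  ((evaluation C C).obj A).mapCocone (colimit.cocone (chain C))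

/-- `free A` is the colimit of the objects `iter n A`. -/
noncomputable def isColimitAt (A : C) : IsColimit (coconeAt A) :=
  isColimitOfPreserves ((evaluation C C).obj A) (colimit.isColimit (chain C))

/-- Morphisms out of `G (free A)`, for `G` preserving sequential colimits, can be glued. -/
theorem exists_desc {D : Type*} [Category* D] (G : C ⥤ D) [PreservesColimitsOfShape ℕ G] (A : C)
    {Y : D} (h : ∀ n, G.obj ((iter C n).obj A) ⟶ Y)
    (w : ∀ n, G.map ((incl C n).app A) ≫ h (n + 1) = h n) :
    ∃ k : G.obj ((free C).obj A) ⟶ Y, ∀ n, G.map ((ι C n).app A) ≫ k = h n := by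
  let s : Cocone (chainAt A ⋙ G) :=
    { pt := Y
      ι := NatTrans.ofSequence h fun n => by
        rw [Functor.comp_map, chainAt_map]
        exact (w n).trans (Category.comp_id _).symm }
  exact ⟨(isColimitOfPreserves G (isColimitAt A)).desc s,
    (isColimitOfPreserves G (isColimitAt A)).fac s⟩

theorem hom_ext_free {D : Type*} [Category* D] (G : C ⥤ D) [PreservesColimitsOfShape ℕ G] {A : C}
    {Y : D} {k l : G.obj ((free C).obj A) ⟶ Y}
    (h : ∀ n, G.map ((ι C n).app A) ≫ k = G.map ((ι C n).app A) ≫ l) : k = l :=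
  (isColimitOfPreserves G (isColimitAt A)).hom_ext h

/-- The unit `I ⟶ free A`. -/
noncomputable def one (A : C) : 𝟙_ C ⟶ (free C).obj A := (iterZero A).hom ≫ (ι C 0).app A

theorem iterOne_ι (n : ℕ) (A : C) : iterOne n A ≫ (ι C (n + 1)).app A = one A := by
  induction n with
  | zero => rw [one, ← incl_ι_app 0, reassoc_of% iterZero_incl]
  | succ n ih => rw [← ih, ← incl_ι_app (n + 1) A, reassoc_of% iterOne_incl]

theorem one_map {A A' : C} (f : A ⟶ A') : one A ≫ (free C).map f = one A' := by
  rw [one, Category.assoc, ← (ι C 0).naturality, reassoc_of% (iterZero_map f), one]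

section Act

variable [∀ X : C, PreservesColimitsOfShape ℕ (tensorLeft X)]

theorem exists_act (A : C) : ∃ s : A ⊗ (free C).obj A ⟶ (free C).obj A,
    ∀ n, A ◁ (ι C n).app A ≫ s = iterAct n A ≫ (ι C (n + 1)).app A :=
  exists_desc (tensorLeft A) A (fun n => iterAct n A ≫ (ι C (n + 1)).app A) fun n => by
    rw [← incl_ι_app (n + 1) A, reassoc_of% iterAct_incl]
    rfl

/-- The action `A ⊗ free A ⟶ free A`. -/
noncomputable def act (A : C) : A ⊗ (free C).obj A ⟶ (free C).obj A := (exists_act A).choose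

theorem whiskerLeft_ι_act (A : C) (n : ℕ) :
    A ◁ (ι C n).app A ≫ act A = iterAct n A ≫ (ι C (n + 1)).app A :=
  (exists_act A).choose_spec n

theorem act_map {A A' : C} (f : A ⟶ A') :
    act A ≫ (free C).map f = (f ⊗ₘ (free C).map f) ≫ act A' := by
  refine hom_ext_free (tensorLeft A) fun n => ?_
  change A ◁ _ ≫ _ = A ◁ _ ≫ _
  rw [reassoc_of% whiskerLeft_ι_act, ← (ι C (n + 1)).naturality, reassoc_of% iterAct_map,
    ← whiskerLeft_ι_act, ← id_tensorHom, ← id_tensorHom,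
    tensorHom_comp_tensorHom_assoc, tensorHom_comp_tensorHom_assoc,
    ← (ι C n).naturality, Category.comp_id, Category.id_comp]

end Act

variable [∀ X : C, PreservesColimitsOfShape ℕ (tensorLeft X)]
variable [∀ X : C, PreservesColimitsOfShape ℕ (tensorRight X)]
variable [∀ X : C, PreservesColimitsOfShape (Discrete WalkingPair) (tensorRight X)]

section Rec

variable {A X D : C} (f : X ⟶ D) (a : A ⊗ D ⟶ D)

/-- Recursion over `free A`, with a parameter `X`: there is a morphism `free A ⊗ X ⟶ D` extending
`f : X ⟶ D` and commuting with the actions of `A`. It is unique by `rec_unique`. -/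
theorem exists_rec : ∃ h : (free C).obj A ⊗ X ⟶ D, one A ▷ X ≫ h = (λ_ X).hom ≫ f ∧
    act A ▷ X ≫ h = (α_ A _ X).hom ≫ A ◁ h ≫ a := by
  obtain ⟨h, hh⟩ := exists_desc (tensorRight X) A (recIter f a) (incl_recIter f a)
  replace hh : ∀ n, (ι C n).app A ▷ X ≫ h = recIter f a n := hh
  refine ⟨h, ?_, hom_ext_free (tensorLeft A ⋙ tensorRight X) fun n => ?_⟩
  · rw [one, comp_whiskerRight_assoc, hh, recIter, ← comp_whiskerRight_assoc, Iso.hom_inv_id,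
      id_whiskerRight, Category.id_comp]
  · change (A ◁ (ι C n).app A) ▷ X ≫ _ = (A ◁ (ι C n).app A) ▷ X ≫ _
    rw [← comp_whiskerRight_assoc, whiskerLeft_ι_act, comp_whiskerRight_assoc, hh, iterAct_recIter,
      ← hh n]
    simp

variable {f a} in
theorem rec_unique {h k : (free C).obj A ⊗ X ⟶ D} (h₁ : one A ▷ X ≫ h = (λ_ X).hom ≫ f)
    (h₂ : act A ▷ X ≫ h = (α_ A _ X).hom ≫ A ◁ h ≫ a) (k₁ : one A ▷ X ≫ k = (λ_ X).hom ≫ f)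
    (k₂ : act A ▷ X ≫ k = (α_ A _ X).hom ≫ A ◁ k ≫ a) : h = k := by
  refine hom_ext_free (tensorRight X) fun n => ?_
  change (ι C n).app A ▷ X ≫ h = (ι C n).app A ▷ X ≫ k
  induction n with
  | zero =>
    rw [one, comp_whiskerRight_assoc] at h₁ k₁
    rw [← cancel_epi ((iterZero A).hom ▷ X), h₁, k₁]
  | succ n ih =>
    refine iter_whiskerRight_hom_ext ?_ ?_
    · rw [← comp_whiskerRight_assoc, ← comp_whiskerRight_assoc, iterOne_ι, h₁, k₁]
    · rw [← comp_whiskerRight_assoc, ← comp_whiskerRight_assoc, ← whiskerLeft_ι_act,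
        comp_whiskerRight_assoc, comp_whiskerRight_assoc, h₂, k₂,
        associator_naturality_middle_assoc,
        associator_naturality_middle_assoc, ← MonoidalCategory.whiskerLeft_comp_assoc, ih,
        MonoidalCategory.whiskerLeft_comp_assoc]

end Rec

/-- The multiplication of the free monoid extends the identity of `free A`. -/
noncomputable def mul (A : C) : (free C).obj A ⊗ (free C).obj A ⟶ (free C).obj A :=
  (exists_rec (𝟙 ((free C).obj A)) (act A)).choose

theorem one_mul (A : C) : one A ▷ (free C).obj A ≫ mul A = (λ_ _).hom :=
  (exists_rec (𝟙 ((free C).obj A)) (act A)).choose_spec.1.trans (Category.comp_id _)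

theorem act_mul (A : C) : act A ▷ (free C).obj A ≫ mul A = (α_ _ _ _).hom ≫ A ◁ mul A ≫ act A :=
  (exists_rec (𝟙 ((free C).obj A)) (act A)).choose_spec.2

theorem ι_mul_zero (A : C) : (ι C 0).app A ▷ (free C).obj A ≫ mul A =
    (iterZero A).inv ▷ _ ≫ (λ_ _).hom := by
  rw [← one_mul, ← comp_whiskerRight_assoc, one, Iso.inv_hom_id_assoc]

theorem iterOne_ι_mul (n : ℕ) (A : C) :
    iterOne n A ▷ (free C).obj A ≫ (ι C (n + 1)).app A ▷ (free C).obj A ≫ mul A =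
      (λ_ _).hom := by
  rw [← comp_whiskerRight_assoc, iterOne_ι, one_mul]

theorem iterAct_ι_mul (n : ℕ) (A : C) :
    iterAct n A ▷ (free C).obj A ≫ (ι C (n + 1)).app A ▷ (free C).obj A ≫ mul A =
      (α_ _ _ _).hom ≫ (𝟙 A ⊗ₘ ((ι C n).app A ▷ (free C).obj A ≫ mul A)) ≫ act A := by
  rw [← comp_whiskerRight_assoc, ← whiskerLeft_ι_act, comp_whiskerRight_assoc, act_mul]
  simp

/-- Existence in the universal property of `free A` as the initial object `D` with a morphism
`I ⟶ D` and an action of `A`. -/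
theorem exists_desc_act {A D : C} (f : 𝟙_ C ⟶ D) (a : A ⊗ D ⟶ D) :
    ∃ h : (free C).obj A ⟶ D, one A ≫ h = f ∧ act A ≫ h = A ◁ h ≫ a := by
  obtain ⟨h, h₁, h₂⟩ := exists_rec f a
  refine ⟨(ρ_ _).inv ≫ h, ?_, ?_⟩
  · rw [rightUnitor_inv_naturality_assoc, h₁, ← unitors_inv_equal,
      Iso.inv_hom_id_assoc]
  · rw [rightUnitor_inv_naturality_assoc, h₂]
    simp

/-- Morphisms out of `free A` are determined by the recursion over the action of `A` that they
satisfy. -/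
theorem hom_ext_act {A D : C} {f : 𝟙_ C ⟶ D} {a : A ⊗ D ⟶ D} {h k : (free C).obj A ⟶ D}
    (h₁ : one A ≫ h = f) (h₂ : act A ≫ h = A ◁ h ≫ a) (k₁ : one A ≫ k = f)
    (k₂ : act A ≫ k = A ◁ k ≫ a) : h = k := by
  rw [← cancel_epi (ρ_ _).hom]
  refine rec_unique (f := f) (a := a) ?_ ?_ ?_ ?_
  · rw [unitors_equal, rightUnitor_naturality_assoc, h₁]
  · rw [rightUnitor_naturality_assoc, h₂]
    simp
  · rw [unitors_equal, rightUnitor_naturality_assoc, k₁]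
  · rw [rightUnitor_naturality_assoc, k₂]
    simp

/-- `free A` is the coproduct of `I` and `A ⊗ free A`. -/
theorem isColimit_one_act (A : C) : Nonempty (IsColimit (BinaryCofan.mk (one A) (act A))) := by
  -- As for every initial algebra, the inverse of `[one, act]` is defined by recursion.
  let S := 𝟙_ C ⨿ (A ⊗ (free C).obj A)
  let d : S ⟶ (free C).obj A := coprod.desc (one A) (act A)
  obtain ⟨h, h₁, h₂⟩ := exists_desc_act (coprod.inl : _ ⟶ S) (A ◁ d ≫ coprod.inr)
  have hd : h ≫ d = 𝟙 _ := hom_ext_act (f := one A) (a := act A)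
    (by rw [reassoc_of% h₁, coprod.inl_desc])
    (by rw [reassoc_of% h₂, coprod.inr_desc, MonoidalCategory.whiskerLeft_comp_assoc])
    (Category.comp_id _) (by simp)
  have dh : d ≫ h = 𝟙 _ := by
    ext
    · rw [coprod.inl_desc_assoc, h₁, Category.comp_id]
    · rw [coprod.inr_desc_assoc, h₂, ← MonoidalCategory.whiskerLeft_comp_assoc, hd,
        MonoidalCategory.whiskerLeft_id, Category.id_comp, Category.comp_id]
  let e : S ≅ (free C).obj A := ⟨d, h, dh, hd⟩
  exact ⟨(coprodIsCoprod _ _).ofIsoColimit (BinaryCofan.ext e (coprod.inl_desc _ _)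
    (coprod.inr_desc _ _))⟩

/-- Both sides satisfy the recursion over the left factor with initial value `one A`. -/
theorem mul_one (A : C) : (free C).obj A ◁ one A ≫ mul A = (ρ_ _).hom := by
  refine rec_unique (f := one A) (a := act A) ?_ ?_ ?_ ?_
  · rw [← whisker_exchange_assoc, one_mul, leftUnitor_naturality]
  · rw [← whisker_exchange_assoc, act_mul]
    simp
  · rw [rightUnitor_naturality, unitors_equal]
  · simp

theorem mul_assoc (A : C) : mul A ▷ (free C).obj A ≫ mul A =
    (α_ _ _ _).hom ≫ (free C).obj A ◁ mul A ≫ mul A := by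
  rw [← Iso.inv_comp_eq]
  refine rec_unique (f := mul A) (a := act A) ?_ ?_ ?_ ?_
  · rw [associator_inv_naturality_left_assoc, ← comp_whiskerRight_assoc, one_mul]
    simp
  · rw [associator_inv_naturality_left_assoc, ← comp_whiskerRight_assoc, act_mul]
    simp [act_mul]
  · rw [← whisker_exchange_assoc, one_mul, leftUnitor_naturality]
  · rw [← whisker_exchange_assoc, act_mul]
    simp

@[simps]
noncomputable instance monObj (A : C) : MonObj ((free C).obj A) where
  one := one A
  mul := mul A
  one_mul := one_mul A
  mul_one := mul_one A
  mul_assoc := mul_assoc A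

/-- The inclusion of `A` into the free monoid on `A`. -/
noncomputable def unit (A : C) : A ⟶ (free C).obj A := (ρ_ A).inv ≫ A ◁ one A ≫ act A

theorem unit_mul (A : C) : unit A ▷ (free C).obj A ≫ mul A = act A := by
  rw [unit, comp_whiskerRight, comp_whiskerRight, Category.assoc, Category.assoc, act_mul,
    associator_naturality_middle_assoc, ← MonoidalCategory.whiskerLeft_comp_assoc, one_mul]
  simp

section Lift

variable {A N : C} [MonObj N]

open scoped MonObj

theorem exists_lift (k : A ⟶ N) : ∃ h : (free C).obj A ⟶ N, one A ≫ h = η ∧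
    act A ≫ h = A ◁ h ≫ k ▷ N ≫ μ :=
  exists_desc_act η (k ▷ N ≫ μ)

/-- The monoid homomorphism out of the free monoid extending a given morphism. -/
noncomputable def lift (k : A ⟶ N) : (free C).obj A ⟶ N := (exists_lift k).choose

@[simp]
theorem one_lift (k : A ⟶ N) : one A ≫ lift k = η := (exists_lift k).choose_spec.1

theorem act_lift (k : A ⟶ N) : act A ≫ lift k = (k ⊗ₘ lift k) ≫ μ := by
  rw [MonoidalCategory.tensorHom_def', Category.assoc]
  exact (exists_lift k).choose_spec.2

@[simp]
theorem unit_lift (k : A ⟶ N) : unit A ≫ lift k = k := by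
  rw [unit, Category.assoc, Category.assoc, act_lift, ← id_tensorHom,
    tensorHom_comp_tensorHom_assoc, one_lift, Category.id_comp, MonObj.mul_one_hom,
    Iso.inv_hom_id_assoc]

/-- Compatibility with the multiplications holds because both sides satisfy the same recursion over
the left factor. -/
instance (k : A ⟶ N) : IsMonHom (lift k) where
  one_hom := one_lift k
  mul_hom := by
    refine rec_unique (f := lift k) (a := k ▷ N ≫ μ) ?_ ?_ ?_ ?_
    · rw [monObj_mul, reassoc_of% one_mul]
    · rw [monObj_mul, reassoc_of% act_mul, act_lift]
      simp [MonoidalCategory.tensorHom_def']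
    · rw [← tensorHom_id, tensorHom_comp_tensorHom_assoc, one_lift, Category.id_comp,
        MonObj.one_mul_hom]
    · rw [← tensorHom_id, tensorHom_comp_tensorHom_assoc, act_lift, Category.id_comp,
        ← Category.comp_id (lift k), ← tensorHom_comp_tensorHom_assoc, tensorHom_id,
        MonObj.mul_assoc, Category.comp_id, associator_naturality_assoc, ← id_tensorHom,
        ← id_tensorHom, ← tensorHom_id, tensorHom_comp_tensorHom_assoc,
        tensorHom_comp_tensorHom_assoc]
      simp

/-- Monoid homomorphisms commute with the actions of `A`, so they are determined by recursion. -/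
theorem hom_ext {f g : (free C).obj A ⟶ N} [IsMonHom f] [IsMonHom g] (h : unit A ≫ f = unit A ≫ g) :
    f = g := by
  have aux (f : (free C).obj A ⟶ N) [IsMonHom f] :
      act A ≫ f = A ◁ f ≫ (unit A ≫ f) ▷ N ≫ μ := by
    have := IsMonHom.mul_hom f
    rw [monObj_mul] at this
    rw [← unit_mul, Category.assoc, this, MonoidalCategory.tensorHom_def', Category.assoc,
      ← whisker_exchange_assoc, comp_whiskerRight_assoc]
  exact hom_ext_act (IsMonHom.one_hom f) (aux f) (IsMonHom.one_hom g) (h ▸ aux g)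

end Lift

section Functoriality

variable {A A' : C} (f : A ⟶ A')

theorem map_eq_lift : (free C).map f = lift (f ≫ unit A') :=
  hom_ext_act (one_map f) (a := f ▷ _ ≫ act A')
    (by rw [act_map, MonoidalCategory.tensorHom_def', Category.assoc])
    (one_lift _) (by rw [act_lift, MonoidalCategory.tensorHom_def', Category.assoc,
      comp_whiskerRight_assoc, monObj_mul, unit_mul])

instance : IsMonHom ((free C).map f) := by
  rw [map_eq_lift]
  infer_instance

theorem unit_map : unit A ≫ (free C).map f = f ≫ unit A' := by
  rw [map_eq_lift, unit_lift]

end Functoriality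

variable (C) in
/-- The free monoid functor. -/
noncomputable def freeMon : C ⥤ Mon C where
  obj A := ⟨(free C).obj A⟩
  map f := ⟨(free C).map f⟩
  map_id A := Mon.Hom.ext ((free C).map_id A)
  map_comp f g := Mon.Hom.ext ((free C).map_comp f g)

/-- Monoid homomorphisms out of the free monoid on `A` are morphisms out of `A`. -/
noncomputable def homEquiv (A : C) (N : Mon C) :
    ((⟨(free C).obj A⟩ : Mon C) ⟶ N) ≃ (A ⟶ N.X) where
  toFun g := unit A ≫ g.hom
  invFun k := ⟨lift k⟩
  left_inv _ := Mon.Hom.ext (hom_ext (unit_lift _))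
  right_inv k := unit_lift k

variable (C) in
/-- The free monoid functor is left adjoint to the forgetful functor. -/
noncomputable def adjunction : freeMon C ⊣ Mon.forget C :=
  Adjunction.mkOfHomEquiv
    { homEquiv := homEquiv
      homEquiv_naturality_left_symm := fun {A A' N} f g => (homEquiv A N).injective (by
        refine ((homEquiv A N).apply_symm_apply (f ≫ g)).trans ?_
        exact ((reassoc_of% (unit_map f)) _).trans
          (congrArg (f ≫ ·) (unit_lift (N := N.X) g)) |>.symm)
      homEquiv_naturality_right := fun f g => (Category.assoc _ _ _).symm }

theorem adjunction_unit_app (A : C) : (adjunction C).unit.app A = unit A :=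
  Category.comp_id _

end Free

end Burroni.FreeMonoid

/-! ### Exactness properties of the free monoid functor -/

namespace Burroni

open MonoidalCategory

/-- A functor that is pointwise a colimit of functors preserving colimits of shape `J` preserves
them too, since colimits commute with colimits. -/
theorem preservesColimitsOfShape_of_pointwise {J K : Type*} [Category* J] [Category* K]
    {C D : Type*} [Category* C] [Category* D] [HasColimitsOfShape K D] {F : K ⥤ C ⥤ D}
    {c : Cocone F} (hc : ∀ X, Nonempty (IsColimit (((evaluation C D).obj X).mapCocone c)))
    (hF : ∀ k, PreservesColimitsOfShape J (F.obj k)) : PreservesColimitsOfShape J c.pt := by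
  have : PreservesColimitsOfShape J F.flip := ⟨fun {G} ↦ ⟨fun {s} hs ↦
    ⟨evaluationJointlyReflectsColimits _ fun k ↦ isColimitOfPreserves (F.obj k) hs⟩⟩⟩
  let e : F.flip ⋙ colim ≅ c.pt := NatIso.ofComponents
    (fun X ↦ (colimit.isColimit (F.flip.obj X)).coconePointUniqueUpToIso (hc X).some) fun {X Y} f =>
      colimit.hom_ext fun k => by simp [IsColimit.coconePointUniqueUpToIso]
  exact preservesColimitsOfShape_of_natIso e

section Tensor

variable {C : Type*} [Category* C] [MonoidalCategory C]

/-- The pointwise tensor product of two diagrams. -/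
@[simps]
def tensorDiagram {J : Type*} [Category* J] (F G : J ⥤ C) : J ⥤ C where
  obj j := F.obj j ⊗ G.obj j
  map f := F.map f ⊗ₘ G.map f

/-- The pointwise tensor product of two cocones. -/
@[simps]
def tensorCocone {J : Type*} [Category* J] {F G : J ⥤ C} (c : Cocone F) (d : Cocone G) :
    Cocone (tensorDiagram F G) where
  pt := c.pt ⊗ d.pt
  ι :=
    { app := fun j => c.ι.app j ⊗ₘ d.ι.app j
      naturality := fun i j f => by
        refine (tensorHom_comp_tensorHom _ _ _ _).trans ?_
        rw [c.w, d.w]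
        exact (Category.comp_id _).symm }

theorem whiskerRight_comp_tensorHom {X Y X' Y' W W' : C} {a : X ⟶ Y} {b : X' ⟶ Y'} {s : X ⟶ X'}
    {t : Y ⟶ Y'} (h : a ≫ t = s ≫ b) (k : W ⟶ W') :
    a ▷ W ≫ (t ⊗ₘ k) = (s ⊗ₘ k) ≫ b ▷ W' := by
  rw [← tensorHom_id, ← tensorHom_id, tensorHom_comp_tensorHom, tensorHom_comp_tensorHom,
    Category.id_comp, Category.comp_id, h]

/-- The exactness properties of a tensor product on which the construction of free monoids, and the
proof that they form a suitable monad, depend. -/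
structure IsSuitableTensor (C : Type*) [Category* C] [MonoidalCategory C] : Prop where
  isPullback {P X Y Z P' X' Y' Z' : C} {fst : P ⟶ X} {snd : P ⟶ Y} {f : X ⟶ Z} {g : Y ⟶ Z}
    {fst' : P' ⟶ X'} {snd' : P' ⟶ Y'} {f' : X' ⟶ Z'} {g' : Y' ⟶ Z'}
    (h : IsPullback fst snd f g) (h' : IsPullback fst' snd' f' g') :
    IsPullback (fst ⊗ₘ fst') (snd ⊗ₘ snd') (f ⊗ₘ f') (g ⊗ₘ g')
  filtered (J : Type w) [SmallCategory J] [IsFiltered J] {F G : J ⥤ C} (c : Cocone F)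
    (d : Cocone G) (hc : IsColimit c) (hd : IsColimit d) : Nonempty (IsColimit (tensorCocone c d))
  coproducts (X : C) : PreservesColimitsOfShape (Discrete WalkingPair) (tensorRight X)

/-- The constant diagram at `X` has colimit `X`, because a filtered category is connected. -/
theorem IsSuitableTensor.tensorLeft (h : IsSuitableTensor.{w} C) (X : C) (J : Type w)
    [SmallCategory J] [IsFiltered J] : PreservesColimitsOfShape J (tensorLeft X) where
  preservesColimit {F} :=
    { preserves := fun {c} hc => by
        have : IsConnected J := IsFiltered.isConnected J
        obtain ⟨hd⟩ := h.filtered J _ c (isColimitConstCocone J X) hc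
        let e : F ⋙ MonoidalCategory.tensorLeft X ≅ tensorDiagram ((Functor.const J).obj X) F :=
          NatIso.ofComponents (fun j => Iso.refl _) fun f =>
            (Category.comp_id _).trans
              ((id_tensorHom X (F.map f)).symm.trans (Category.id_comp _).symm)
        refine ⟨((IsColimit.precomposeHomEquiv e _).symm hd).ofIsoColimit
          (Cocone.ext (Iso.refl _) fun j => ?_)⟩
        refine (Category.comp_id _).trans ((Category.id_comp _).trans ?_)
        exact id_tensorHom X (c.ι.app j) }

theorem IsSuitableTensor.tensorRight (h : IsSuitableTensor.{w} C) (X : C) (J : Type w)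
    [SmallCategory J] [IsFiltered J] : PreservesColimitsOfShape J (tensorRight X) where
  preservesColimit {F} :=
    { preserves := fun {c} hc => by
        have : IsConnected J := IsFiltered.isConnected J
        obtain ⟨hd⟩ := h.filtered J c _ hc (isColimitConstCocone J X)
        let e : F ⋙ MonoidalCategory.tensorRight X ≅ tensorDiagram F ((Functor.const J).obj X) :=
          NatIso.ofComponents (fun j => Iso.refl _) fun f =>
            (Category.comp_id _).trans
              ((tensorHom_id (F.map f) X).symm.trans (Category.id_comp _).symm)
        refine ⟨((IsColimit.precomposeHomEquiv e _).symm hd).ofIsoColimit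
          (Cocone.ext (Iso.refl _) fun j => ?_)⟩
        refine (Category.comp_id _).trans ((Category.id_comp _).trans ?_)
        exact tensorHom_id (c.ι.app j) X }

theorem IsSuitableTensor.tensorLeft_nat (h : IsSuitableTensor.{w} C) (X : C) :
    PreservesColimitsOfShape ℕ (MonoidalCategory.tensorLeft X) :=
  preservesColimitsOfShape_of_preservesFiltered.{w} _ ℕ fun K _ _ => h.tensorLeft X K

theorem IsSuitableTensor.tensorRight_nat (h : IsSuitableTensor.{w} C) (X : C) :
    PreservesColimitsOfShape ℕ (MonoidalCategory.tensorRight X) :=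
  preservesColimitsOfShape_of_preservesFiltered.{w} _ ℕ fun K _ _ => h.tensorRight X K

end Tensor

theorem IsSuitableCategory.isUniversalColimit_cofan {C : Type*} [Category* C]
    (h : IsSuitableCategory.{w} C) {X Y : C} (c : BinaryCofan X Y) (hc : IsColimit c) :
    IsUniversalColimit c :=
  h.isUniversalColimit_of_finite hc

namespace FreeMonoid

variable {C : Type u} [Category.{v} C] [MonoidalCategory C] [HasBinaryCoproducts C]

section Filtered

variable {J : Type w} [SmallCategory J] [IsFiltered J]

/-- By induction on `n`: `iter (n + 1)` is pointwise the coproduct of a constant functor and of the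
tensor product of the identity with `iter n`. -/
theorem preservesColimitsOfShape_iter (hT : IsSuitableTensor.{w} C) (n : ℕ) :
    PreservesColimitsOfShape J (iter C n) := by
  induction n with
  | zero =>
    have : IsConnected J := IsFiltered.isConnected J
    exact ⟨fun {F} => ⟨fun {c} _ => ⟨isColimitConstCocone J (𝟙_ C)⟩⟩⟩
  | succ n ih =>
    let I : C ⥤ C := (Functor.const C).obj (𝟙_ C)
    let P : C ⥤ C := tensorDiagram (𝟭 C) (iter C n)
    let i : I ⟶ iter C (n + 1) :=
      { app := fun A => iterOne n A
        naturality := fun _ _ f => (Category.id_comp _).trans (iterOne_map n f).symm }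
    let a : P ⟶ iter C (n + 1) :=
      { app := fun A => iterAct n A
        naturality := fun _ _ f => (iterAct_map n f).symm }
    refine preservesColimitsOfShape_of_pointwise (c := BinaryCofan.mk i a) (fun A => ?_) ?_
    · exact ⟨(isColimitMapCoconeBinaryCofanEquiv ((evaluation C C).obj A) i a).symm
        (isColimitIter n A)⟩
    · rintro ⟨⟨⟩⟩
      · have : IsConnected J := IsFiltered.isConnected J
        exact ⟨fun {F} => ⟨fun {c} _ => ⟨isColimitConstCocone J (𝟙_ C)⟩⟩⟩
      · exact ⟨fun {F} => ⟨fun {c} hc =>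
          hT.filtered J c _ hc (isColimitOfPreserves (iter C n) hc)⟩⟩

theorem preservesColimitsOfShape_free [HasColimitsOfShape ℕ C] (hT : IsSuitableTensor.{w} C) :
    PreservesColimitsOfShape J (free C) :=
  preservesColimitsOfShape_of_pointwise (c := colimit.cocone (chain C))
    (fun A => ⟨isColimitAt A⟩) fun n => preservesColimitsOfShape_iter hT n

end Filtered

section Counit

variable [HasColimitsOfShape ℕ C]
variable [∀ X : C, PreservesColimitsOfShape ℕ (tensorLeft X)]
variable [∀ X : C, PreservesColimitsOfShape ℕ (tensorRight X)]
variable [∀ X : C, PreservesColimitsOfShape (Discrete WalkingPair) (tensorRight X)]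

open scoped MonObj

/-- The counit of the free monoid adjunction is cartesian at every monoid homomorphism whose
squares with the units and with the multiplications are pullbacks. -/
theorem isPullback_lift (hC : IsSuitableCategory.{w} C) (hT : IsSuitableTensor.{w} C) {M N : C}
    [MonObj M] [MonObj N] (g : M ⟶ N) (h₁ : IsPullback η[M] (𝟙 _) g η[N])
    (h₂ : IsPullback μ[M] (g ⊗ₘ g) g μ[N]) :
    IsPullback (lift (𝟙 M)) ((free C).map g) g (lift (𝟙 N)) := by
  have := hC.hasPullbacks
  have pz (A : C) [MonObj A] : (FreeMonoid.ι C 0).app A ≫ lift (𝟙 A) = (iterZero A).inv ≫ η[A] := by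
    rw [← one_lift (𝟙 A), one, Category.assoc, Iso.inv_hom_id_assoc]
  have p₁ (A : C) [MonObj A] (n : ℕ) :
      iterOne n A ≫ (FreeMonoid.ι C (n + 1)).app A ≫ lift (𝟙 A) = η[A] := by
    rw [reassoc_of% iterOne_ι, one_lift]
  have p₂ (A : C) [MonObj A] (n : ℕ) : iterAct n A ≫ (FreeMonoid.ι C (n + 1)).app A ≫ lift (𝟙 A) =
      (𝟙 A ⊗ₘ ((FreeMonoid.ι C n).app A ≫ lift (𝟙 A))) ≫ μ[A] := by
    rw [← reassoc_of% whiskerLeft_ι_act, act_lift, ← id_tensorHom, tensorHom_comp_tensorHom_assoc,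
      Category.id_comp]
  have key (n : ℕ) : IsPullback ((FreeMonoid.ι C n).app M ≫ lift (𝟙 M)) ((iter C n).map g) g
      ((FreeMonoid.ι C n).app N ≫ lift (𝟙 N)) := by
    induction n with
    | zero =>
      rw [pz, pz]
      refine (IsPullback.of_horiz_isIso ⟨?_⟩).paste_horiz h₁
      rw [iterZero_inv, Category.comp_id]
    | succ n ih =>
      refine isPullback_of_universal_cofan hC.isUniversalColimit_cofan (isColimitIter n M)
        (isColimitIter n N) (f := 𝟙 _) (g := g ⊗ₘ (iter C n).map g) ?_ (iterAct_map n g) ?_ ?_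
      · exact (iterOne_map n g).trans (Category.id_comp _).symm
      · rwa [p₁, p₁]
      · rw [p₂, p₂]
        exact (hT.isPullback (IsPullback.of_horiz_isIso ⟨by simp⟩) ih).paste_horiz h₂
  exact isPullback_of_universal (isColimitAt M) (hC.isUniversalColimit (isColimitAt N))
    ((chain C).whiskerLeft ((evaluation C C).map g))
    (fun n => ((FreeMonoid.ι C n).naturality g).symm) key

end Counit

section Cartesian

variable [BinaryCoproductsDisjoint C]

theorem isPullback_iter (hC : IsSuitableCategory.{w} C) (hT : IsSuitableTensor.{w} C)
    {P X Y Z : C} {fst : P ⟶ X} {snd : P ⟶ Y} {f : X ⟶ Z} {g : Y ⟶ Z}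
    (h : IsPullback fst snd f g) (n : ℕ) : IsPullback ((iter C n).map fst) ((iter C n).map snd)
      ((iter C n).map f) ((iter C n).map g) := by
  have := hC.hasPullbacks
  have := hC.hasFiniteCoproducts
  induction n with
  | zero =>
    have : IsPullback (𝟙 (𝟙_ C)) (𝟙 _) (𝟙 _) (𝟙 _) := IsPullback.of_vert_isIso ⟨rfl⟩
    exact this
  | succ n ih =>
    exact isPullback_coprod_of_disjoint hC.isUniversalColimit_cofan (IsPullback.of_vert_isIso ⟨rfl⟩)
      (hT.isPullback h ih)

variable [HasColimitsOfShape ℕ C]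

/-- The free monoid functor is a sequential colimit of functors preserving pullbacks, hence
preserves them, too. -/
theorem isPullback_free (hC : IsSuitableCategory.{w} C) (hT : IsSuitableTensor.{w} C)
    {P X Y Z : C} {fst : P ⟶ X} {snd : P ⟶ Y} {f : X ⟶ Z} {g : Y ⟶ Z}
    (h : IsPullback fst snd f g) : IsPullback ((free C).map fst) ((free C).map snd)
      ((free C).map f) ((free C).map g) := by
  let τ {A A' : C} (f : A ⟶ A') : chainAt A ⟶ chainAt A' :=
    (chain C).whiskerLeft ((evaluation C C).map f)
  refine hC.colimitsCommutePullbacks ℕ (τ fst) (τ snd) (τ f) (τ g) (isPullback_iter hC hT h)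
    _ _ _ _ (isColimitAt P) (isColimitAt X) (isColimitAt Y) (isColimitAt Z) _ _ _ _ ?_ ?_ ?_ ?_ <;>
  exact fun n => ((ι C n).naturality _).symm

variable [∀ X : C, PreservesColimitsOfShape ℕ (tensorLeft X)]
variable [∀ X : C, PreservesColimitsOfShape ℕ (tensorRight X)]
variable [∀ X : C, PreservesColimitsOfShape (Discrete WalkingPair) (tensorRight X)]

/-- `free A` is the coproduct of `I` and `A ⊗ free A`, so disjointness makes these squares
pullbacks. -/
theorem isPullback_one (hC : IsSuitableCategory.{w} C) {A A' : C} (f : A ⟶ A') :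
    IsPullback (one A) (𝟙 _) ((free C).map f) (one A') := by
  have := hC.hasPullbacks
  have := hC.hasFiniteCoproducts
  exact isPullback_inl_of_disjoint hC.isUniversalColimit_cofan (isColimit_one_act A).some
    (isColimit_one_act A').some ((one_map f).trans (Category.id_comp _).symm) (act_map f)

theorem isPullback_act (hC : IsSuitableCategory.{w} C) {A A' : C} (f : A ⟶ A') :
    IsPullback (act A) (f ⊗ₘ (free C).map f) ((free C).map f) (act A') := by
  have := hC.hasPullbacks
  have := hC.hasFiniteCoproducts
  exact isPullback_inr_of_disjoint hC.isUniversalColimit_cofan (isColimit_one_act A).some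
    (isColimit_one_act A').some ((one_map f).trans (Category.id_comp _).symm) (act_map f)

theorem isPullback_unit (hC : IsSuitableCategory.{w} C) (hT : IsSuitableTensor.{w} C) {A A' : C}
    (f : A ⟶ A') : IsPullback (unit A) f ((free C).map f) (unit A') := by
  have h₁ : IsPullback (ρ_ A).inv f (f ⊗ₘ 𝟙 (𝟙_ C)) (ρ_ A').inv :=
    IsPullback.of_horiz_isIso ⟨by simp⟩
  have h₂ := hT.isPullback (IsPullback.of_horiz_isIso (fst := 𝟙 A) (snd := f) (f := f)
    (g := 𝟙 A') ⟨by simp⟩) (isPullback_one hC f)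
  rw [id_tensorHom, id_tensorHom] at h₂
  exact h₁.paste_horiz (h₂.paste_horiz (isPullback_act hC f))

/-- The multiplication of the free monoid is glued from its restrictions to `iter n A ⊗ free A`,
and these are built inductively from coherence isomorphisms and from `act A`. -/
theorem isPullback_mul (hC : IsSuitableCategory.{w} C) (hT : IsSuitableTensor.{w} C) {A A' : C}
    (f : A ⟶ A') : IsPullback (mul A) ((free C).map f ⊗ₘ (free C).map f) ((free C).map f)
      (mul A') := by
  have := hC.hasPullbacks
  have key (n : ℕ) : IsPullback ((ι C n).app A ▷ (free C).obj A ≫ mul A)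
      ((iter C n).map f ⊗ₘ (free C).map f) ((free C).map f)
      ((ι C n).app A' ▷ (free C).obj A' ≫ mul A') := by
    induction n with
    | zero =>
      rw [ι_mul_zero, ι_mul_zero]
      refine IsPullback.of_horiz_isIso ⟨?_⟩
      rw [← tensorHom_id (iterZero A').inv, tensorHom_comp_tensorHom_assoc, iterZero_inv,
        Category.comp_id, Category.assoc, ← leftUnitor_naturality, MonoidalCategory.tensorHom_def,
        Category.assoc]
    | succ n ih =>
      refine isPullback_of_universal_cofan hC.isUniversalColimit_cofan (isColimitIterRight n A _)
        (isColimitIterRight n A' _) (f := 𝟙 _ ⊗ₘ (free C).map f)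
        (g := (f ⊗ₘ (iter C n).map f) ⊗ₘ (free C).map f) ?_ ?_ ?_ ?_
      · rw [← tensorHom_id, ← tensorHom_id, tensorHom_comp_tensorHom, tensorHom_comp_tensorHom,
          iterOne_map]
        simp
      · rw [← tensorHom_id, ← tensorHom_id, tensorHom_comp_tensorHom, tensorHom_comp_tensorHom,
          iterAct_map]
        simp
      · rw [iterOne_ι_mul, iterOne_ι_mul]
        exact IsPullback.of_horiz_isIso ⟨by simp⟩
      · rw [iterAct_ι_mul, iterAct_ι_mul]
        have h₁ : IsPullback (α_ A ((iter C n).obj A) ((free C).obj A)).hom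
            ((f ⊗ₘ (iter C n).map f) ⊗ₘ (free C).map f) (f ⊗ₘ (iter C n).map f ⊗ₘ (free C).map f)
            (α_ A' ((iter C n).obj A') ((free C).obj A')).hom :=
          IsPullback.of_horiz_isIso ⟨by simp⟩
        exact h₁.paste_horiz ((hT.isPullback (IsPullback.of_horiz_isIso ⟨by simp⟩) ih).paste_horiz
          (isPullback_act hC f))
  have u := hC.isUniversalColimit
    (isColimitOfPreserves (tensorRight ((free C).obj A')) (isColimitAt A'))
  refine isPullback_of_universal
    (isColimitOfPreserves (tensorRight ((free C).obj A)) (isColimitAt A)) u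
    { app := fun n => (iter C n).map f ⊗ₘ (free C).map f
      naturality := fun m n g => ?_ } (fun n => ?_) key
  · exact whiskerRight_comp_tensorHom (((chain C).map g).naturality f).symm _
  · exact whiskerRight_comp_tensorHom ((ι C n).naturality f).symm _

variable (C) in
/-- The free monoid monad of a category with disjoint coproducts is cartesian. -/
theorem isCartesianMonad (hC : IsSuitableCategory.{w} C) (hT : IsSuitableTensor.{w} C) :
    IsCartesianMonad (adjunction C).toMonad where
  preserves := preservesLimitsOfShape_walkingCospan_of_forall_isPullback fun X Y Z f g _ =>
    ⟨_, _, _, IsPullback.of_hasPullback f g,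
      isPullback_free hC hT (IsPullback.of_hasPullback f g)⟩
  unit {A A'} f := by
    change IsPullback f ((adjunction C).unit.app A) ((adjunction C).unit.app A') ((free C).map f)
    rw [adjunction_unit_app, adjunction_unit_app]
    exact (isPullback_unit hC hT f).flip
  -- The multiplication at `A` is the counit at the free monoid on `A`.
  mul f := (isPullback_lift hC hT ((free C).map f) (isPullback_one hC f)
    (isPullback_mul hC hT f)).flip

end Cartesian

end FreeMonoid

end Burroni

/-! ### The category of graphs over a fixed object -/

namespace Burroni

/-- Disjointness of binary coproducts lifts along a faithful functor that preserves pullbacks and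
binary coproducts and reflects initial objects. -/
theorem binaryCoproductsDisjoint_of_functor {C D : Type*} [Category* C] [Category* D]
    [BinaryCoproductsDisjoint C] [HasBinaryCoproducts D] [HasPullbacks D] (G : D ⥤ C) [G.Faithful]
    [PreservesLimitsOfShape WalkingCospan G] [PreservesColimitsOfShape (Discrete WalkingPair) G]
    [ReflectsColimitsOfShape (Discrete PEmpty.{1}) G] : BinaryCoproductsDisjoint D :=
  BinaryCoproductsDisjoint.mk fun X Y => by
    let i : X ⟶ X ⨿ Y := coprod.inl
    let j : Y ⟶ X ⨿ Y := coprod.inr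
    have hc : IsColimit (BinaryCofan.mk i j) := coprodIsCoprod X Y
    have hG : IsColimit (BinaryCofan.mk (G.map i) (G.map j)) :=
      mapIsColimitOfPreservesOfIsColimit G _ _ hc
    have : Mono (G.map i) := Mono.of_binaryCoproductDisjoint_left _ hG
    have : Mono (G.map j) := Mono.of_binaryCoproductDisjoint_right _ hG
    have : Mono (BinaryCofan.mk i j).inl := G.mono_of_mono_map ‹Mono (G.map i)›
    have : Mono (BinaryCofan.mk i j).inr := G.mono_of_mono_map ‹Mono (G.map j)›
    have sq := IsPullback.of_hasPullback i j
    exact BinaryCoproductDisjoint.of_binaryCofan hc sq.isLimit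
      (IsInitial.isInitialOfObj G _
        (IsInitial.ofBinaryCoproductDisjointOfIsColimitOfIsLimit hG (sq.map G).isLimit))

theorem cone_comp_app {C D J : Type*} [Category* C] [Category* D] [Category* J] {K : J ⥤ D}
    {F : D ⥤ C} {X : C} (ν : F ⟶ (Functor.const D).obj X) (c : Cone (K ⋙ F)) {i j : J}
    (f : i ⟶ j) : c.π.app i ≫ ν.app (K.obj i) = c.π.app j ≫ ν.app (K.obj j) := by
  have := ν.naturality (K.map f)
  rw [← c.w f]
  simp [this]

variable {B : Type u₁} [Category.{v₁} B] {E : Type u₂} [Category.{v₂} E]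
variable {p : E ⥤ B} {T : Monad E} {O : E}

namespace GraphOver

/-- Graphs over a fixed object `O`, with the morphisms over the identity of `O`. -/
instance : Category (GraphOver p T O) where
  Hom A A' := A.Hom (𝟙 O) A'
  id A := A.idHom
  comp f g :=
    { map := f.map ≫ g.map
      cod_comm := by rw [Category.assoc, g.cod_comm, Category.comp_id, f.cod_comm]
      dom_comm := by
        rw [Category.assoc, g.dom_comm, T.map_id, Category.comp_id, f.dom_comm, T.map_id] }
  id_comp f := Hom.ext (Category.id_comp _)
  comp_id f := Hom.ext (Category.comp_id _)
  assoc f g h := Hom.ext (Category.assoc _ _ _)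

@[ext]
theorem hom_ext {A A' : GraphOver p T O} {f g : A ⟶ A'} (h : f.map = g.map) : f = g :=
  Hom.ext h

@[simp]
theorem id_map (A : GraphOver p T O) : Hom.map (𝟙 A) = 𝟙 A.apex := rfl

@[simp]
theorem comp_map {A A' A'' : GraphOver p T O} (f : A ⟶ A') (g : A' ⟶ A'') :
    Hom.map (f ≫ g) = f.map ≫ g.map := rfl

@[simp]
theorem map_cod {A A' : GraphOver p T O} (f : A ⟶ A') : f.map ≫ A'.cod = A.cod :=
  f.cod_comm.trans (Category.comp_id _)

@[simp]
theorem map_dom {A A' : GraphOver p T O} (f : A ⟶ A') : f.map ≫ A'.dom = A.dom := by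
  rw [f.dom_comm, T.map_id, Category.comp_id]

theorem comp_map_assoc {A A' A'' : GraphOver p T O} (f : A ⟶ A') (g : A' ⟶ A'') {Z : E}
    (h : A''.apex ⟶ Z) : Hom.map (f ≫ g) ≫ h = f.map ≫ g.map ≫ h := by
  rw [comp_map, Category.assoc]

@[simp]
theorem map_cod_assoc {A A' : GraphOver p T O} (f : A ⟶ A') {Z : E} (h : O ⟶ Z) :
    f.map ≫ A'.cod ≫ h = A.cod ≫ h := by
  rw [← Category.assoc, map_cod]

@[simp]
theorem map_dom_assoc {A A' : GraphOver p T O} (f : A ⟶ A') {Z : E} (h : T.obj O ⟶ Z) :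
    f.map ≫ A'.dom ≫ h = A.dom ≫ h := by
  rw [← Category.assoc, map_dom]

/-- A morphism of graphs over `O`, from its map of apices. -/
@[simps]
def homMk {A A' : GraphOver p T O} (f : A.apex ⟶ A'.apex) (h₁ : f ≫ A'.cod = A.cod)
    (h₂ : f ≫ A'.dom = A.dom) : A ⟶ A' where
  map := f
  cod_comm := h₁.trans (Category.comp_id _).symm
  dom_comm := by rw [h₂, T.map_id, Category.comp_id]

theorem isHomLift_map {A A' : GraphOver p T O} (f : A ⟶ A') :
    p.IsHomLift (𝟙 (p.obj O)) f.map :=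
  have : p.IsHomLift (𝟙 (p.obj O)) (f.map ≫ A'.cod) := by
    rw [map_cod]
    infer_instance
  isHomLift_of_comp_vertical p (𝟙 (p.obj O)) f.map A'.cod

theorem obj_apex (A : GraphOver p T O) : p.obj A.apex = p.obj O :=
  IsHomLift.domain_eq p (𝟙 (p.obj O)) A.cod

variable (p T O) in
/-- The apex of a graph over `O`, as an object of the fibre. -/
@[simps]
def apexF : GraphOver p T O ⥤ Fiber p (p.obj O) where
  obj A := Fiber.mk A.obj_apex
  map f := vert f.map (isHomLift_map f)
  map_id _ := rfl
  map_comp _ _ := rfl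

instance : (apexF p T O).Faithful where
  map_injective h := hom_ext (congrArg totMap h)

theorem isIso_of_isIso_map {A A' : GraphOver p T O} (f : A ⟶ A') [IsIso f.map] : IsIso f :=
  ⟨homMk (inv f.map) (by rw [IsIso.inv_comp_eq, map_cod]) (by rw [IsIso.inv_comp_eq, map_dom]),
    hom_ext (IsIso.hom_inv_id f.map), hom_ext (IsIso.inv_hom_id f.map)⟩

instance : (apexF p T O).ReflectsIsomorphisms where
  reflects f _ := by
    have : IsIso f.map :=
      inferInstanceAs (IsIso ((Fiber.fiberInclusion).map ((apexF p T O).map f)))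
    exact isIso_of_isIso_map f

variable (p O) in
/-- The object `O` in its own fibre. -/
abbrev baseV : Fiber p (p.obj O) := Fiber.mk rfl

/-- The map `γ_A` as a morphism of the fibre. -/
def codV (A : GraphOver p T O) : (apexF p T O).obj A ⟶ baseV p O := vert A.cod A.cod_vertical

theorem isPullback_of_map {P X Y Z : GraphOver p T O}
    {fst : P ⟶ X} {snd : P ⟶ Y} {f : X ⟶ Z} {g : Y ⟶ Z}
    (h : IsPullback fst.map snd.map f.map g.map) :
    IsPullback fst snd f g := by
  refine ⟨⟨hom_ext h.w⟩, ⟨PullbackCone.IsLimit.mk _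
    (fun s => homMk (h.lift s.fst.map s.snd.map (congrArg Hom.map s.condition)) ?_ ?_)
    (fun s => hom_ext (h.lift_fst _ _ _)) (fun s => hom_ext (h.lift_snd _ _ _))
    fun s m h₁ h₂ => hom_ext (h.hom_ext ?_ ?_)⟩⟩
  · rw [← map_cod fst, h.lift_fst_assoc, map_cod]
  · rw [← map_dom fst, h.lift_fst_assoc, map_dom]
  · exact (congrArg Hom.map h₁).trans (h.lift_fst _ _ _).symm
  · exact (congrArg Hom.map h₂).trans (h.lift_snd _ _ _).symm

variable (p T O) in
/-- Graphs over `O`, as objects of the fibre of the projection to `E`. -/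
@[simps]
def toFiber : GraphOver p T O ⥤ Fiber (proj p T) O where
  obj A := Fiber.mk (a := ⟨O, A⟩) rfl
  map {A A'} f := vert (p := proj p T) (X := Fiber.mk (a := ⟨O, A⟩) rfl)
    (Y := Fiber.mk (a := ⟨O, A'⟩) rfl) ⟨𝟙 O, f⟩
    (CategoryTheory.IsHomLift.map (proj p T) (a := ⟨O, A⟩) (b := ⟨O, A'⟩) ⟨𝟙 O, f⟩)
  map_id _ := rfl
  map_comp _ _ := Fiber.hom_ext (RelGraph.Hom.ext' (Category.comp_id _).symm rfl)

instance : (toFiber p T O).Faithful where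
  map_injective h := hom_ext (congrArg (fun f => Hom.map (RelGraph.Hom.hom (Subtype.val f))) h)

theorem base_eq_of_isHomLift {A A' : RelGraph p T} {u : A.base ⟶ A'.base} {f : A ⟶ A'}
    (h : (proj p T).IsHomLift u f) : f.base = u :=
  (@IsHomLift.eq_of_isHomLift _ _ _ _ (proj p T) A A' u f h).symm

theorem eq_of_isHomLift_proj {A A' : GraphOver p T O}
    (f : (⟨O, A⟩ : RelGraph p T) ⟶ ⟨O, A'⟩) (h : (proj p T).IsHomLift (𝟙 O) f) :
    ∃ g : A ⟶ A', f = ⟨𝟙 O, g⟩ := by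
  obtain ⟨u, f⟩ := f
  obtain rfl : u = 𝟙 O := base_eq_of_isHomLift h
  exact ⟨f, rfl⟩

instance : (toFiber p T O).Full where
  map_surjective f := by
    obtain ⟨g, hg⟩ := eq_of_isHomLift_proj f.1 f.2
    exact ⟨g, Fiber.hom_ext hg.symm⟩

theorem exists_eq_toFiber (X : Fiber (proj p T) O) : ∃ A, X = (toFiber p T O).obj A := by
  obtain ⟨⟨O, A⟩, rfl⟩ := X
  exact ⟨A, rfl⟩

instance : (toFiber p T O).EssSurj where
  mem_essImage X := by
    obtain ⟨A, rfl⟩ := exists_eq_toFiber X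
    exact ⟨A, ⟨Iso.refl _⟩⟩

instance : (toFiber p T O).IsEquivalence where

variable [IsFibredMonad p T]

variable (p T O) in
/-- The object `T O` in the fibre of `O`. -/
abbrev targetV : Fiber p (p.obj O) := Fiber.mk (obj_monad p T O)

/-- The graph formed by a span in the fibre. -/
@[simps]
def ofSpan {X : Fiber p (p.obj O)} (γ : X ⟶ baseV p O) (δ : X ⟶ targetV p T O) :
    GraphOver p T O where
  apex := tot X
  cod := totMap γ
  dom := totMap δ
  cod_vertical := γ.2
  dom_vertical := δ.2

variable (p T O) in
/-- The maps `γ_A` form a natural transformation. -/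
@[simps]
def codN : apexF p T O ⟶ (Functor.const _).obj (baseV p O) where
  app A := A.codV
  naturality _ _ f := Fiber.hom_ext ((map_cod f).trans (Category.comp_id _).symm)

variable (p T O) in
/-- The maps `δ_A` form a natural transformation. -/
@[simps]
def domN : apexF p T O ⟶ (Functor.const _).obj (targetV p T O) where
  app A := A.domV
  naturality _ _ f := Fiber.hom_ext ((map_dom f).trans (Category.comp_id _).symm)

/-- A graph structure on the colimit of the apices is induced by the universal property. -/
noncomputable instance (J : Type*) [Category* J] : CreatesColimitsOfShape J (apexF p T O) where
  CreatesColimit {K} := createsColimitOfReflectsIso fun c hc => by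
    let cγ : Cocone (K ⋙ apexF p T O) := ⟨baseV p O, K.whiskerLeft (codN p T O)⟩
    let cδ : Cocone (K ⋙ apexF p T O) := ⟨targetV p T O, K.whiskerLeft (domN p T O)⟩
    exact
      { liftedCocone :=
          { pt := ofSpan (hc.desc cγ) (hc.desc cδ)
            ι :=
              { app := fun j => homMk (totMap (c.ι.app j)) (congrArg totMap (hc.fac cγ j))
                  (congrArg totMap (hc.fac cδ j))
                naturality := fun i j f => hom_ext (congrArg totMap (c.ι.naturality f)) } }
        validLift := Cocone.ext (Iso.refl c.pt) fun j => Category.comp_id _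
        makesColimit :=
          { desc := fun s => homMk (totMap (hc.desc ((apexF p T O).mapCocone s)))
              (congrArg totMap (hc.hom_ext fun j => by
                refine (hc.fac_assoc _ j _).trans (Eq.trans ?_ (hc.fac cγ j).symm)
                exact Fiber.hom_ext (map_cod (s.ι.app j)) :
                  hc.desc ((apexF p T O).mapCocone s) ≫ s.pt.codV = hc.desc cγ))
              (congrArg totMap (hc.hom_ext fun j => by
                refine (hc.fac_assoc _ j _).trans (Eq.trans ?_ (hc.fac cδ j).symm)
                exact Fiber.hom_ext (map_dom (s.ι.app j)) :
                  hc.desc ((apexF p T O).mapCocone s) ≫ s.pt.domV = hc.desc cδ))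
            fac := fun s j => hom_ext (congrArg totMap (hc.fac ((apexF p T O).mapCocone s) j))
            uniq := fun s m hm => (apexF p T O).map_injective
              (hc.uniq ((apexF p T O).mapCocone s) ((apexF p T O).map m)
                fun j => congrArg (apexF p T O).map (hm j)) } }

/-- Cospans are connected diagrams: composing the cone with the leg `γ` (or `δ`) of the graph at any
index gives the same morphism as at `one`, and this is the leg of the graph on the limit. -/
noncomputable instance : CreatesLimitsOfShape WalkingCospan (apexF p T O) where
  CreatesLimit {K} := createsLimitOfReflectsIso fun c hc => by
    have w {X : Fiber p (p.obj O)} (ν : apexF p T O ⟶ (Functor.const _).obj X) :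
        ∀ j : WalkingCospan, c.π.app j ≫ ν.app (K.obj j) =
          c.π.app WalkingCospan.one ≫ ν.app (K.obj WalkingCospan.one)
      | none => rfl
      | some WalkingPair.left => cone_comp_app ν c WalkingCospan.Hom.inl
      | some WalkingPair.right => cone_comp_app ν c WalkingCospan.Hom.inr
    exact
      { liftedCone :=
          { pt := ofSpan (c.π.app WalkingCospan.one ≫ (codN p T O).app (K.obj WalkingCospan.one))
              (c.π.app WalkingCospan.one ≫ (domN p T O).app (K.obj WalkingCospan.one))
            π :=
              { app := fun j => homMk (totMap (c.π.app j)) (congrArg totMap (w (codN p T O) j))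
                  (congrArg totMap (w (domN p T O) j))
                naturality := fun i j f => hom_ext (congrArg totMap (c.π.naturality f)) } }
        validLift := Cone.ext (Iso.refl c.pt) fun j => (Category.id_comp _).symm
        makesLimit :=
          { lift := fun s => homMk (totMap (hc.lift ((apexF p T O).mapCone s)))
              ((congrArg totMap (hc.fac_assoc ((apexF p T O).mapCone s) _ _)).trans
                (map_cod (s.π.app WalkingCospan.one)))
              ((congrArg totMap (hc.fac_assoc ((apexF p T O).mapCone s) _ _)).trans
                (map_dom (s.π.app WalkingCospan.one)))
            fac := fun s j => hom_ext (congrArg totMap (hc.fac ((apexF p T O).mapCone s) j))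
            uniq := fun s m hm => (apexF p T O).map_injective
              (hc.uniq ((apexF p T O).mapCone s) ((apexF p T O).map m)
                fun j => congrArg (apexF p T O).map (hm j)) } }

theorem isSuitableCategory (h : IsSuitableCategory.{w} (Fiber p (p.obj O))) :
    IsSuitableCategory.{w} (GraphOver p T O) :=
  h.of_creates (apexF p T O)

theorem binaryCoproductsDisjoint (h : IsSuitableCategory.{w} (Fiber p (p.obj O)))
    [BinaryCoproductsDisjoint (Fiber p (p.obj O))] :
    BinaryCoproductsDisjoint (GraphOver p T O) := by
  have := h.hasPullbacks
  have := h.hasFiniteCoproducts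
  have := (isSuitableCategory (T := T) h).hasPullbacks
  have := (isSuitableCategory (T := T) h).hasFiniteCoproducts
  exact binaryCoproductsDisjoint_of_functor (apexF p T O)

theorem isPullback_map [p.IsFibered] [HasFibredPullbacks p] {P X Y Z : GraphOver p T O}
    {fst : P ⟶ X} {snd : P ⟶ Y} {f : X ⟶ Z} {g : Y ⟶ Z} (h : IsPullback fst snd f g) :
    IsPullback fst.map snd.map f.map g.map :=
  isPullback_of_fibre p (h.map (apexF p T O))

end GraphOver

open GraphOver

theorem IsSuitableCategory.fiber_proj (h : IsSuitableCategory.{w} (Fiber p (p.obj O)))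
    [IsFibredMonad p T] : IsSuitableCategory.{w} (Fiber (proj p T) O) :=
  (isSuitableCategory (T := T) h).of_creates (toFiber p T O).inv

theorem binaryCoproductsDisjoint_fiber_proj (h : IsSuitableCategory.{w} (Fiber p (p.obj O)))
    [BinaryCoproductsDisjoint (Fiber p (p.obj O))] [IsFibredMonad p T] :
    BinaryCoproductsDisjoint (Fiber (proj p T) O) := by
  have := binaryCoproductsDisjoint (T := T) h
  have := (IsSuitableCategory.fiber_proj (T := T) h).hasPullbacks
  have := (IsSuitableCategory.fiber_proj (T := T) h).hasFiniteCoproducts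
  exact binaryCoproductsDisjoint_of_functor (toFiber p T O).inv

end Burroni

/-! ### Reindexing of graphs -/

namespace Burroni

section Cartesian

variable {B : Type u₁} [Category.{v₁} B] {E : Type u₂} [Category.{v₂} E] {p : E ⥤ B}

/-- Two functors to a fibre which come with natural cartesian morphisms to the same functor are
isomorphic. -/
theorem nonempty_iso_of_isCartesian {D : Type*} [Category* D] {b b' : B} {u : b ⟶ b'}
    {G₁ G₂ : D ⥤ Fiber p b} {K : D ⥤ Fiber p b'} (c₁ : ∀ X, tot (G₁.obj X) ⟶ tot (K.obj X))
    (c₂ : ∀ X, tot (G₂.obj X) ⟶ tot (K.obj X)) (_ : ∀ X, p.IsCartesian u (c₁ X))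
    (_ : ∀ X, p.IsCartesian u (c₂ X))
    (h₁ : ∀ {X Y} (f : X ⟶ Y), totMap (G₁.map f) ≫ c₁ Y = c₁ X ≫ totMap (K.map f))
    (h₂ : ∀ {X Y} (f : X ⟶ Y), totMap (G₂.map f) ≫ c₂ Y = c₂ X ≫ totMap (K.map f)) :
    Nonempty (G₁ ≅ G₂) := by
  have h (X : D) : ∃ e : G₁.obj X ≅ G₂.obj X, totMap e.hom ≫ c₂ X = c₁ X :=
    ⟨{ hom := vert (IsCartesian.map p u (c₂ X) (c₁ X)) inferInstance
       inv := vert (IsCartesian.map p u (c₁ X) (c₂ X)) inferInstance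
       hom_inv_id := Fiber.hom_ext (IsCartesian.ext p u (c₁ X) (totMap (_ ≫ _)) (totMap (𝟙 _))
         (by simp))
       inv_hom_id := Fiber.hom_ext (IsCartesian.ext p u (c₂ X) (totMap (_ ≫ _)) (totMap (𝟙 _))
         (by simp)) }, IsCartesian.fac p u (c₂ X) (c₁ X)⟩
  choose e he using h
  refine ⟨NatIso.ofComponents e fun {X Y} f => Fiber.hom_ext ?_⟩
  refine IsCartesian.ext p u (c₂ Y) (totMap (_ ≫ _)) (totMap (_ ≫ _)) ?_
  rw [totMap_comp, totMap_comp, Category.assoc, Category.assoc, he, h₁, h₂, reassoc_of% he]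

variable [p.IsFibered]

/-- A morphism in a fibre is the pullback of its reindexing along the cartesian morphisms. -/
theorem isPullback_prone {b b' : B} (u : b ⟶ b') {X Y : Fiber p b'} (f : X ⟶ Y) :
    IsPullback (totMap ((reindex p u).map f)) (prone p u X) (prone p u Y) (totMap f) := by
  have ex {W : E} (k : W ⟶ tot ((reindex p u).obj Y)) (h : W ⟶ tot X)
      (w : k ≫ prone p u Y = h ≫ totMap f) :
      ∃! l : W ⟶ tot ((reindex p u).obj X),
        l ≫ totMap ((reindex p u).map f) = k ∧ l ≫ prone p u X = h := by
    let v : p.obj W ⟶ b := p.map k ≫ eqToHom (obj_tot _)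
    have : p.IsHomLift v k := inferInstance
    have : p.IsHomLift (v ≫ u) (h ≫ totMap f) := w ▸ inferInstance
    have : p.IsHomLift (v ≫ u) h := isHomLift_of_comp_vertical p (v ≫ u) h (totMap f)
    refine ⟨IsStronglyCartesian.map p u (prone p u X) (g := v) rfl h, ⟨?_, by simp⟩, ?_⟩
    · refine IsStronglyCartesian.ext p u (prone p u Y) v ?_
      rw [Category.assoc, reindex_map_prone, IsStronglyCartesian.fac_assoc, w]
    · rintro m ⟨h₁, h₂⟩
      have : p.IsHomLift v (m ≫ totMap ((reindex p u).map f)) := by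
        rw [h₁]
        infer_instance
      have := isHomLift_of_comp_vertical p v m (totMap ((reindex p u).map f))
      exact IsStronglyCartesian.map_uniq p u (prone p u X) rfl h m h₂
  exact ⟨⟨reindex_map_prone p u f⟩, ⟨PullbackCone.IsLimit.mk _
    (fun s => (ex s.fst s.snd s.condition).choose)
    (fun s => (ex s.fst s.snd s.condition).choose_spec.1.1)
    (fun s => (ex s.fst s.snd s.condition).choose_spec.1.2)
    fun s m h₁ h₂ => (ex s.fst s.snd s.condition).choose_spec.2 m ⟨h₁, h₂⟩⟩⟩

/-- The limit of `Y' ⟶ Y ⟵ X ⟶ Z ⟵ Z'` relative to `p`, where the outer morphisms lie over `v`: the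
pullback `P₁` of `Y'` and `X` over `Y`, followed by the pullback `P` of `P₁` and `Z'` over the
reindexing of `Z`. -/
theorem exists_relativeLimit [HasFibredPullbacks p] {b b' : B} (v : b ⟶ b') {X Y Z : Fiber p b'}
    (γ : X ⟶ Y) (δ : X ⟶ Z) {Y' Z' : Fiber p b} {y : tot Y' ⟶ tot Y} {z : tot Z' ⟶ tot Z}
    (hy : p.IsHomLift v y) (hz : p.IsHomLift v z) :
    ∃ (P P₁ : Fiber p b) (a : P₁ ⟶ Y') (c : tot P₁ ⟶ tot X) (e : P₁ ⟶ (reindex p v).obj Z)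
      (t : Z' ⟶ (reindex p v).obj Z) (d : P ⟶ Z') (j : P ⟶ P₁),
      totMap e ≫ prone p v Z = c ≫ totMap δ ∧ totMap t ≫ prone p v Z = z ∧
      IsPullback (totMap a) c y (totMap γ) ∧
      IsPullback (totMap d) (totMap j) (totMap t) (totMap e) := by
  obtain ⟨s, hs⟩ := exists_fac p v Y Y' y hy
  obtain ⟨t, ht⟩ := exists_fac p v Z Z' z hz
  refine ⟨_, _, pullback.fst s ((reindex p v).map γ),
    totMap (pullback.snd s ((reindex p v).map γ)) ≫ prone p v X,
    pullback.snd s ((reindex p v).map γ) ≫ (reindex p v).map δ, t, pullback.fst _ _,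
    pullback.snd _ _, ?_, ht, ?_, isPullback_of_fibre p (IsPullback.of_hasPullback _ _)⟩
  · rw [totMap_comp, Category.assoc, reindex_map_prone, Category.assoc]
  · have := (isPullback_of_fibre p (IsPullback.of_hasPullback s ((reindex p v).map γ))).paste_vert
      (isPullback_prone v γ)
    rwa [hs] at this

end Cartesian

section

variable {B : Type u₁} [Category.{v₁} B] {E : Type u₂} [Category.{v₂} E]
variable {p : E ⥤ B} {T : Monad E} [p.IsFibered] [IsFibredMonad p T]
variable {O Q : E}

namespace GraphOver

variable [HasFibredPullbacks p]

/-- The reindexing `P` of `K` is the limit of `O ⟶ Q ⟵ K ⟶ T Q ⟵ T O` relative to `p`. Morphisms of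
graphs into it over any `v` correspond to morphisms into `K` over `v ≫ u`, and morphisms into its
apex are determined by their composites with the two legs and with the projection to `K`. -/
theorem exists_reindexGraph (u : O ⟶ Q) (K : GraphOver p T Q) :
    ∃ (G : GraphOver p T O) (π : G.Hom u K),
    (∀ {R : E} (v : R ⟶ O) (W : GraphOver p T R) (h : W.Hom (v ≫ u) K),
      ∃ l : W.Hom v G, l.map ≫ π.map = h.map) ∧
    ∀ {W : E} {l l' : W ⟶ G.apex}, l ≫ G.cod = l' ≫ G.cod → l ≫ G.dom = l' ≫ G.dom →
      l ≫ π.map = l' ≫ π.map → l = l' := by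
  obtain ⟨P, P₁, L, a, c, e, t, q, d, j, ha, he, ht, hd, hj, hq, heq, htq, sq₁, sq₂⟩ :
      ∃ (P P₁ L : E) (a : P₁ ⟶ O) (c : P₁ ⟶ K.apex) (e : P₁ ⟶ L) (t : T.obj O ⟶ L)
        (q : L ⟶ T.obj Q) (d : P ⟶ T.obj O) (j : P ⟶ P₁),
        p.IsHomLift (𝟙 (p.obj O)) a ∧ p.IsHomLift (𝟙 (p.obj O)) e ∧ p.IsHomLift (𝟙 (p.obj O)) t ∧
        p.IsHomLift (𝟙 (p.obj O)) d ∧ p.IsHomLift (𝟙 (p.obj O)) j ∧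
        p.IsStronglyCartesian (p.map u) q ∧ e ≫ q = c ≫ K.dom ∧ t ≫ q = T.map u ∧
        IsPullback a c u K.cod ∧ IsPullback d j t e := by
    obtain ⟨P, P₁, a, c, e, t, d, j, h₁, h₂, h₃, h₄⟩ := exists_relativeLimit (p.map u) K.codV K.domV
      (Y' := baseV p O) (Z' := targetV p T O) (y := u) (z := T.map u)
      (inferInstanceAs (p.IsHomLift (p.map u) u)) (isHomLift_monad_map p T (p.map u) u)
    exact ⟨_, _, _, totMap a, c, totMap e, totMap t, prone p (p.map u) _, totMap d, totMap j, a.2,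
      e.2, t.2, d.2, j.2, IsFibered.isStronglyCartesian_of_isCartesian p (p.map u)
        (prone p (p.map u) (Fiber.mk (obj_monad p T Q))), h₁, h₂, h₃, h₄⟩
  refine ⟨⟨P, j ≫ a, d, inferInstance, hd⟩, ⟨j ≫ c, ?_, ?_⟩, fun {R} v W h => ?_,
    fun {W l l'} h₁ h₂ h₃ => sq₂.hom_ext h₂ (sq₁.hom_ext ?_ ?_)⟩
  · rw [Category.assoc, Category.assoc, sq₁.w]
  · rw [Category.assoc, ← heq, ← htq, sq₂.w_assoc]
  · obtain ⟨k, hk₁, hk₂⟩ : ∃ k : W.apex ⟶ P₁, k ≫ a = W.cod ≫ v ∧ k ≫ c = h.map :=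
      have w : (W.cod ≫ v) ≫ u = h.map ≫ K.cod := by rw [h.cod_comm, Category.assoc]
      ⟨sq₁.lift _ _ w, sq₁.lift_fst _ _ w, sq₁.lift_snd _ _ w⟩
    have w : (W.dom ≫ T.map v) ≫ t = k ≫ e := by
      -- Both sides lie over `p v` and agree after composition with a cartesian morphism.
      have hv : p.IsHomLift (p.map v) v := inferInstance
      have : p.IsHomLift (p.map v) (k ≫ a) := by
        rw [hk₁]
        infer_instance
      have := isHomLift_of_comp_vertical p (p.map v) k a
      have := isHomLift_monad_map p T (p.map v) v
      refine IsStronglyCartesian.ext p (p.map u) q (p.map v) ?_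
      rw [Category.assoc, Category.assoc, Category.assoc, htq, heq, reassoc_of% hk₂, h.dom_comm,
        T.map_comp]
    obtain ⟨l, hl₁, hl₂⟩ : ∃ l : W.apex ⟶ P, l ≫ d = W.dom ≫ T.map v ∧ l ≫ j = k :=
      ⟨sq₂.lift _ _ w, sq₂.lift_fst _ _ w, sq₂.lift_snd _ _ w⟩
    exact ⟨⟨l, by rw [reassoc_of% hl₂, hk₁], hl₁⟩, by rw [reassoc_of% hl₂, hk₂]⟩
  · simpa using h₁
  · simpa using h₃

/-- The reindexing of a graph over `Q` along `u : O ⟶ Q`. -/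
noncomputable def reindexGraph (u : O ⟶ Q) (K : GraphOver p T Q) : GraphOver p T O :=
  (exists_reindexGraph u K).choose

/-- The cartesian morphism from the reindexing of a graph. -/
noncomputable def reindexHom (u : O ⟶ Q) (K : GraphOver p T Q) : (reindexGraph u K).Hom u K :=
  (exists_reindexGraph u K).choose_spec.choose

theorem exists_fac_reindexHom {R : E} {v : R ⟶ O} {u : O ⟶ Q} {W : GraphOver p T R}
    {K : GraphOver p T Q} (h : W.Hom (v ≫ u) K) :
    ∃ l : W.Hom v (reindexGraph u K), l.map ≫ (reindexHom u K).map = h.map :=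
  (exists_reindexGraph u K).choose_spec.choose_spec.1 v W h

theorem reindexGraph_ext {u : O ⟶ Q} {K : GraphOver p T Q} {W : E}
    {l l' : W ⟶ (reindexGraph u K).apex}
    (h₁ : l ≫ (reindexGraph u K).cod = l' ≫ (reindexGraph u K).cod)
    (h₂ : l ≫ (reindexGraph u K).dom = l' ≫ (reindexGraph u K).dom)
    (h₃ : l ≫ (reindexHom u K).map = l' ≫ (reindexHom u K).map) : l = l' :=
  (exists_reindexGraph u K).choose_spec.choose_spec.2 h₁ h₂ h₃

theorem reindexGraph_hom_ext {R : E} {v : R ⟶ O} {u : O ⟶ Q} {W : GraphOver p T R}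
    {K : GraphOver p T Q} {l l' : W.Hom v (reindexGraph u K)}
    (h : l.map ≫ (reindexHom u K).map = l'.map ≫ (reindexHom u K).map) : l = l' :=
  Hom.ext (reindexGraph_ext (l.cod_comm.trans l'.cod_comm.symm)
    (l.dom_comm.trans l'.dom_comm.symm) h)

theorem exists_fac_reindexHom' {u : O ⟶ Q} {W : GraphOver p T O} {K : GraphOver p T Q}
    (h : W.Hom u K) : ∃ l : W ⟶ reindexGraph u K, l.map ≫ (reindexHom u K).map = h.map := by
  obtain ⟨l, hl⟩ := exists_fac_reindexHom (v := 𝟙 O) (u := u) (W := W) (K := K)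
    ⟨h.map, by rw [Category.id_comp, h.cod_comm], by rw [Category.id_comp, h.dom_comm]⟩
  exact ⟨l, hl⟩

end GraphOver

open GraphOver

variable [HasFibredPullbacks p]

theorem isStronglyCartesian_reindexHom (u : O ⟶ Q) (K : GraphOver p T Q) :
    (proj p T).IsStronglyCartesian u
      (⟨u, reindexHom u K⟩ : (⟨O, reindexGraph u K⟩ : RelGraph p T) ⟶ ⟨Q, K⟩) where
  toIsHomLift := CategoryTheory.IsHomLift.map (proj p T) (a := ⟨O, reindexGraph u K⟩)
    (b := ⟨Q, K⟩) ⟨u, reindexHom u K⟩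
  universal_property' {W} g φ hφ := by
    obtain ⟨R, W⟩ := W
    obtain ⟨v, h⟩ := φ
    obtain rfl : v = g ≫ u := base_eq_of_isHomLift hφ
    obtain ⟨l, hl⟩ := exists_fac_reindexHom (v := g) h
    refine ⟨⟨g, l⟩, ⟨CategoryTheory.IsHomLift.map (proj p T) (a := ⟨R, W⟩)
      (b := ⟨O, reindexGraph u K⟩) ⟨g, l⟩, RelGraph.Hom.ext' rfl hl⟩, ?_⟩
    rintro ⟨g', l'⟩ ⟨h₁, h₂⟩
    obtain rfl : g' = g := base_eq_of_isHomLift h₁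
    refine RelGraph.Hom.ext' rfl (congrArg Hom.map (reindexGraph_hom_ext ?_))
    exact (congrArg (fun k => k.hom.map) h₂).trans hl.symm

instance : (proj p T).IsFibered :=
  IsFibered.of_exists_isStronglyCartesian fun K _ u =>
    ⟨_, _, isStronglyCartesian_reindexHom u K.graph⟩

namespace GraphOver

theorem exists_reindexMap (u : O ⟶ Q) {K K' : GraphOver p T Q} (f : K ⟶ K') :
    ∃ g : reindexGraph u K ⟶ reindexGraph u K',
      g.map ≫ (reindexHom u K').map = (reindexHom u K).map ≫ f.map :=
  exists_fac_reindexHom' (u := u) (W := reindexGraph u K) (K := K')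
    { map := (reindexHom u K).map ≫ f.map
      cod_comm := by rw [Category.assoc, map_cod, (reindexHom u K).cod_comm]
      dom_comm := by rw [Category.assoc, map_dom, (reindexHom u K).dom_comm] }

/-- The action of reindexing on morphisms of graphs. -/
noncomputable def reindexMap (u : O ⟶ Q) {K K' : GraphOver p T Q} (f : K ⟶ K') :
    reindexGraph u K ⟶ reindexGraph u K' :=
  (exists_reindexMap u f).choose

theorem reindexMap_hom (u : O ⟶ Q) {K K' : GraphOver p T Q} (f : K ⟶ K') :
    (reindexMap u f).map ≫ (reindexHom u K').map = (reindexHom u K).map ≫ f.map :=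
  (exists_reindexMap u f).choose_spec

theorem reindexMap_ext {u : O ⟶ Q} {W : GraphOver p T O} {K : GraphOver p T Q}
    {f g : W ⟶ reindexGraph u K}
    (h : f.map ≫ (reindexHom u K).map = g.map ≫ (reindexHom u K).map) : f = g :=
  reindexGraph_hom_ext (v := 𝟙 O) h

/-- Reindexing of graphs along `u : O ⟶ Q`, as a functor. -/
noncomputable def reindexF (u : O ⟶ Q) : GraphOver p T Q ⥤ GraphOver p T O where
  obj K := reindexGraph u K
  map f := reindexMap u f
  map_id K := reindexMap_ext (by simp [reindexMap_hom])
  map_comp f g := reindexMap_ext (by simp [reindexMap_hom, reassoc_of% reindexMap_hom])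

theorem isPullback_reindexMap (u : O ⟶ Q) {P X Y Z : GraphOver p T Q} {fst : P ⟶ X} {snd : P ⟶ Y}
    {f : X ⟶ Z} {g : Y ⟶ Z} (sq : IsPullback fst snd f g) :
    IsPullback (reindexMap u fst) (reindexMap u snd) (reindexMap u f) (reindexMap u g) := by
  have sq' := isPullback_map sq
  have ex {W : GraphOver p T O} (a : W ⟶ reindexGraph u X) (b : W ⟶ reindexGraph u Y)
      (w : a ≫ reindexMap u f = b ≫ reindexMap u g) :
      ∃! l : W ⟶ reindexGraph u P, l ≫ reindexMap u fst = a ∧ l ≫ reindexMap u snd = b := by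
    have e : (a.map ≫ (reindexHom u X).map) ≫ f.map = (b.map ≫ (reindexHom u Y).map) ≫ g.map := by
      rw [Category.assoc, Category.assoc, ← reindexMap_hom, ← reindexMap_hom,
        ← comp_map_assoc, w, comp_map_assoc]
    obtain ⟨k, hk₁, hk₂⟩ : ∃ k, k ≫ fst.map = a.map ≫ (reindexHom u X).map ∧
        k ≫ snd.map = b.map ≫ (reindexHom u Y).map :=
      ⟨sq'.lift _ _ e, sq'.lift_fst _ _ e, sq'.lift_snd _ _ e⟩
    obtain ⟨l, hl⟩ := exists_fac_reindexHom' (W := W) (u := u) (K := P)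
      { map := k
        cod_comm := by
          rw [← map_cod fst, reassoc_of% hk₁, (reindexHom u X).cod_comm, map_cod_assoc]
        dom_comm := by
          rw [← map_dom fst, reassoc_of% hk₁, (reindexHom u X).dom_comm, map_dom_assoc] }
    refine ⟨l, ⟨reindexMap_ext ?_, reindexMap_ext ?_⟩, fun m hm => reindexMap_ext
      (sq'.hom_ext ?_ ?_)⟩
    · rw [comp_map, Category.assoc, reindexMap_hom, reassoc_of% hl, hk₁]
    · rw [comp_map, Category.assoc, reindexMap_hom, reassoc_of% hl, hk₂]
    · rw [Category.assoc, ← reindexMap_hom, ← comp_map_assoc, hm.1, hl, hk₁]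
    · rw [Category.assoc, ← reindexMap_hom, ← comp_map_assoc, hm.2, hl, hk₂]
  exact ⟨⟨((reindexF u).map_comp _ _).symm.trans ((congrArg (reindexF u).map sq.w).trans
    ((reindexF u).map_comp _ _))⟩, ⟨PullbackCone.IsLimit.mk _
    (fun s => (ex s.fst s.snd s.condition).choose)
    (fun s => (ex s.fst s.snd s.condition).choose_spec.1.1)
    (fun s => (ex s.fst s.snd s.condition).choose_spec.1.2)
    fun s m h₁ h₂ => (ex s.fst s.snd s.condition).choose_spec.2 m ⟨h₁, h₂⟩⟩⟩

theorem isHomLift_reindexHom (u : O ⟶ Q) (K : GraphOver p T Q) :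
    p.IsHomLift (p.map u) (reindexHom u K).map := by
  have : p.IsHomLift (p.map u) ((reindexHom u K).map ≫ K.cod) := by
    rw [(reindexHom u K).cod_comm]
    infer_instance
  exact isHomLift_of_comp_vertical p _ _ K.cod

/-- The square of reindexing morphisms over a morphism of graphs is a pullback, relative to the
fibre. -/
theorem exists_lift_reindexMap {u : O ⟶ Q} {K K' : GraphOver p T Q} {f : K ⟶ K'} {W : E}
    {m : W ⟶ (reindexGraph u K').apex} (hm : p.IsHomLift (𝟙 (p.obj O)) m) {n : W ⟶ K.apex}
    (w : m ≫ (reindexHom u K').map = n ≫ f.map) :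
    ∃! l : W ⟶ (reindexGraph u K).apex,
      l ≫ (reindexMap u f).map = m ∧ l ≫ (reindexHom u K).map = n := by
  let W' : GraphOver p T O :=
    ⟨W, m ≫ (reindexGraph u K').cod, m ≫ (reindexGraph u K').dom, inferInstance, inferInstance⟩
  let m' : W' ⟶ reindexGraph u K' := homMk m rfl rfl
  let n' : W'.Hom u K :=
    { map := n
      cod_comm := by
        rw [← map_cod f, ← reassoc_of% w, (reindexHom u K').cod_comm]
        exact (Category.assoc _ _ _).symm
      dom_comm := by
        rw [← map_dom f, ← reassoc_of% w, (reindexHom u K').dom_comm]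
        exact (Category.assoc _ _ _).symm }
  obtain ⟨l, hl⟩ := exists_fac_reindexHom' n'
  have hl' : l ≫ reindexMap u f = m' := reindexMap_ext (by
    rw [comp_map, Category.assoc, reindexMap_hom, reassoc_of% hl]
    exact w.symm)
  refine ⟨l.map, ⟨congrArg Hom.map hl', hl⟩, fun k hk => reindexGraph_ext ?_ ?_ ?_⟩
  · rw [← map_cod (reindexMap u f), reassoc_of% hk.1]
    rw [map_cod]
    exact (map_cod l).symm
  · rw [← map_dom (reindexMap u f), reassoc_of% hk.1]
    rw [map_dom]
    exact (map_dom l).symm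
  · exact hk.2.trans hl.symm

/-- The comparison between the apex of the reindexed graph and the reindexed apex. -/
noncomputable def apexComparison (u : O ⟶ Q) (K : GraphOver p T Q) :
    (apexF p T O).obj (reindexGraph u K) ⟶ (reindex p (p.map u)).obj ((apexF p T Q).obj K) :=
  (exists_fac p (p.map u) ((apexF p T Q).obj K) ((apexF p T O).obj (reindexGraph u K))
    (reindexHom u K).map (isHomLift_reindexHom u K)).choose

theorem apexComparison_prone (u : O ⟶ Q) (K : GraphOver p T Q) :
    totMap (apexComparison u K) ≫ prone p (p.map u) ((apexF p T Q).obj K) =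
      (reindexHom u K).map :=
  (exists_fac p (p.map u) ((apexF p T Q).obj K) ((apexF p T O).obj (reindexGraph u K))
    (reindexHom u K).map (isHomLift_reindexHom u K)).choose_spec

/-- The apex of a reindexed graph is a pullback of the reindexed apex. -/
theorem isPullback_apexComparison (u : O ⟶ Q) {K K' : GraphOver p T Q} (f : K ⟶ K') :
    IsPullback ((apexF p T O).map (reindexMap u f)) (apexComparison u K) (apexComparison u K')
      ((reindex p (p.map u)).map ((apexF p T Q).map f)) := by
  have h := isPullback_prone (p.map u) ((apexF p T Q).map f)
  have h₁ := apexComparison_prone u K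
  have h₂ := apexComparison_prone u K'
  have h₃ := reindexMap_hom u f
  have ex {W : Fiber p (p.obj O)} (m : W ⟶ (apexF p T O).obj (reindexGraph u K'))
      (n : W ⟶ (reindex p (p.map u)).obj ((apexF p T Q).obj K))
      (w : m ≫ apexComparison u K' = n ≫ (reindex p (p.map u)).map ((apexF p T Q).map f)) :
      ∃! l : W ⟶ (apexF p T O).obj (reindexGraph u K),
        l ≫ (apexF p T O).map (reindexMap u f) = m ∧ l ≫ apexComparison u K = n := by
    have w' : totMap m ≫ (reindexHom u K').map =
        (totMap n ≫ prone p (p.map u) ((apexF p T Q).obj K)) ≫ f.map := by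
      refine (congrArg (totMap m ≫ ·) h₂).symm.trans (((Category.assoc _ _ _).symm.trans
        (congrArg (· ≫ prone p (p.map u) ((apexF p T Q).obj K')) (congrArg totMap w))).trans ?_)
      exact (Category.assoc _ _ _).trans ((congrArg (totMap n ≫ ·) h.w).trans
        (Category.assoc _ _ _).symm)
    obtain ⟨l, ⟨hl₁, hl₂⟩, hl⟩ := exists_lift_reindexMap m.2 w'
    have hv : p.IsHomLift (𝟙 (p.obj O)) l := by
      have := isHomLift_map (reindexMap u f)
      have : p.IsHomLift (𝟙 (p.obj O)) (l ≫ (reindexMap u f).map) := hl₁ ▸ m.2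
      exact isHomLift_of_comp_vertical p _ l (reindexMap u f).map
    refine ⟨vert l hv, ⟨Fiber.hom_ext hl₁, prone_ext p (p.map u) ?_⟩, fun k hk => ?_⟩
    · exact (Category.assoc _ _ _).trans ((congrArg (l ≫ ·) h₁).trans hl₂)
    · refine Fiber.hom_ext (hl (totMap k) ⟨congrArg totMap hk.1, ?_⟩)
      refine (congrArg (totMap k ≫ ·) h₁).symm.trans ((Category.assoc _ _ _).symm.trans ?_)
      exact congrArg (· ≫ prone p (p.map u) ((apexF p T Q).obj K)) (congrArg totMap hk.2)
  refine ⟨⟨prone_ext p (p.map u) ?_⟩, ⟨PullbackCone.IsLimit.mk _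
    (fun s => (ex s.fst s.snd s.condition).choose)
    (fun s => (ex s.fst s.snd s.condition).choose_spec.1.1)
    (fun s => (ex s.fst s.snd s.condition).choose_spec.1.2)
    fun s m h₁ h₂ => (ex s.fst s.snd s.condition).choose_spec.2 m ⟨h₁, h₂⟩⟩⟩
  refine (Category.assoc _ _ _).trans ((congrArg ((reindexMap u f).map ≫ ·) h₂).trans (h₃.trans ?_))
  refine (congrArg (· ≫ f.map) h₁).symm.trans ((Category.assoc _ _ _).trans ?_)
  exact (congrArg (totMap (apexComparison u K) ≫ ·) h.w).symm.trans (Category.assoc _ _ _).symm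

theorem preservesPullbacks_reindexF (u : O ⟶ Q) :
    PreservesLimitsOfShape WalkingCospan (reindexF (p := p) (T := T) u) := by
  have := HasFibredPullbacks.hasPullbacks (p := p) (p.obj Q)
  have : HasPullbacks (GraphOver p T Q) :=
    hasLimitsOfShape_of_hasLimitsOfShape_createsLimitsOfShape (apexF p T Q)
  exact preservesLimitsOfShape_walkingCospan_of_forall_isPullback fun X Y Z f g _ =>
    ⟨_, _, _, IsPullback.of_hasPullback f g,
      isPullback_reindexMap u (IsPullback.of_hasPullback f g)⟩

/-- Over the reindexing of apices, which preserves colimits, the reindexing of graphs is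
equifibered; so it preserves those colimits that are universal in the fibre. -/
theorem preservesColimitsOfShape_reindexF {J : Type*} [Category* J] (u : O ⟶ Q)
    [HasColimitsOfShape J (Fiber p (p.obj O))] [HasColimitsOfShape J (Fiber p (p.obj Q))]
    (univ : ∀ (F : J ⥤ Fiber p (p.obj O)) (c : Cocone F), IsColimit c → IsUniversalColimit c)
    [PreservesColimitsOfShape J (reindex p (p.map u))] :
    PreservesColimitsOfShape J (reindexF (p := p) (T := T) u) := by
  let κ : reindexF (T := T) u ⋙ apexF p T O ⟶ apexF p T Q ⋙ reindex p (p.map u) :=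
    { app := apexComparison u
      naturality := fun _ _ f => (isPullback_apexComparison u f).w }
  have : PreservesColimitsOfShape J (reindexF (T := T) u ⋙ apexF p T O) :=
    preservesColimitsOfShape_of_equifibered κ (fun _ _ f => isPullback_apexComparison u f) univ
  exact preservesColimitsOfShape_of_reflects_of_preserves _ (apexF p T O)

end GraphOver

/-- Up to the identification of graphs with the objects of the fibres of the projection,
reindexing is given by `reindexF`. -/
theorem nonempty_reindex_iso (u : O ⟶ Q) : Nonempty
    (reindex (proj p T) u ≅ (toFiber p T Q).inv ⋙ reindexF u ⋙ toFiber p T O) := by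
  have h (K : GraphOver p T Q) := isStronglyCartesian_reindexHom u K
  obtain ⟨e⟩ := nonempty_iso_of_isCartesian (p := proj p T) (u := u)
    (G₁ := toFiber p T Q ⋙ reindex (proj p T) u) (G₂ := reindexF u ⋙ toFiber p T O)
    (K := toFiber p T Q) (fun K => prone (proj p T) u ((toFiber p T Q).obj K))
    (fun K => (⟨u, reindexHom u K⟩ : (⟨O, reindexGraph u K⟩ : RelGraph p T) ⟶ ⟨Q, K⟩))
    (fun K => inferInstance)
    (fun K => @IsStronglyCartesian.isCartesian_of_isStronglyCartesian _ _ _ _ (proj p T)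
      _ _ _ _ u _ (h K))
    (h₁ := fun f => reindex_map_prone (proj p T) u ((toFiber p T Q).map f))
    (h₂ := fun f => RelGraph.Hom.ext' ((Category.id_comp _).trans (Category.comp_id _).symm)
      (reindexMap_hom u f))
  exact ⟨(Functor.leftUnitor _).symm ≪≫
    isoWhiskerRight (toFiber p T Q).asEquivalence.counitIso.symm _ ≪≫
      isoWhiskerLeft (toFiber p T Q).inv e⟩

end

section

variable {B : Type u₁} [Category.{v₁} B] {E : Type u₂} [Category.{v₂} E]
variable {p : E ⥤ B} {T : Monad E} [IsFibredMonad p T]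

/-- The relative Burroni fibration over a suitable fibration is suitable. -/
theorem isSuitable_proj (hp : IsSuitable.{w} p) : IsSuitable.{w} (proj p T) := by
  have := hp.isFibered
  have := hp.fibredPullbacks
  have := hp.fibredFiniteCoproducts
  have := hp.fibredFilteredColimits
  refine IsSuitable.mk_of_fibres (fun O => (hp.fibre (p.obj O)).fiber_proj) ?_ ?_ ?_
  · intro O Q u
    obtain ⟨e⟩ := nonempty_reindex_iso (p := p) (T := T) u
    have := GraphOver.preservesPullbacks_reindexF (p := p) (T := T) u
    exact preservesLimitsOfShape_of_natIso e.symm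
  · intro O Q u ι _
    obtain ⟨e⟩ := nonempty_reindex_iso (p := p) (T := T) u
    have := hp.fibredFiniteCoproducts.preserves (p.map u) ι
    have := hp.fibredFiniteCoproducts.hasFiniteCoproducts (p.obj O)
    have := hp.fibredFiniteCoproducts.hasFiniteCoproducts (p.obj Q)
    have := GraphOver.preservesColimitsOfShape_reindexF (J := Discrete ι) (p := p) (T := T) u
      fun _ _ hc => (hp.fibre (p.obj O)).isUniversalColimit_of_finite hc
    exact preservesColimitsOfShape_of_natIso e.symm
  · intro O Q u J _ _
    obtain ⟨e⟩ := nonempty_reindex_iso (p := p) (T := T) u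
    have := hp.fibredFilteredColimits.preserves (p.map u) J
    have := hp.fibredFilteredColimits.hasColimits (p.obj O) J
    have := hp.fibredFilteredColimits.hasColimits (p.obj Q) J
    have := GraphOver.preservesColimitsOfShape_reindexF (J := J) (p := p) (T := T) u
      fun F c hc => hp.universal_filteredColimits (p.obj O) J F c hc
    exact preservesColimitsOfShape_of_natIso e.symm

theorem hasDisjointFibreCoproducts_proj (hp : IsSuitable.{w} p) (h : HasDisjointFibreCoproducts p) :
    HasDisjointFibreCoproducts (proj p T) := fun O => by
  have := h (p.obj O)
  exact binaryCoproductsDisjoint_fiber_proj (hp.fibre (p.obj O))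

end

end Burroni

/-! ### The monoidal category of graphs over a fixed object -/

namespace Burroni

variable {B : Type u₁} [Category.{v₁} B] {E : Type u₂} [Category.{v₂} E]

/-- A pullback square of vertical morphisms is a pullback square in the fibre. -/
theorem isPullback_fibre_of_tot {p : E ⥤ B} {b : B} {P X Y Z : Fiber p b} {fst : P ⟶ X}
    {snd : P ⟶ Y} {f : X ⟶ Z} {g : Y ⟶ Z}
    (sq : IsPullback (totMap fst) (totMap snd) (totMap f) (totMap g)) :
    IsPullback fst snd f g := by
  have ex (s : PullbackCone f g) : ∃ l : s.pt ⟶ P, l ≫ fst = s.fst ∧ l ≫ snd = s.snd := by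
    have e : totMap s.fst ≫ totMap f = totMap s.snd ≫ totMap g := congrArg totMap s.condition
    have h₁ := sq.lift_fst _ _ e
    have h₂ := sq.lift_snd _ _ e
    have : p.IsHomLift (𝟙 b) (sq.lift _ _ e ≫ totMap fst) := h₁.symm ▸ s.fst.2
    exact ⟨vert (sq.lift _ _ e) (isHomLift_of_comp_vertical p (𝟙 b) _ (totMap fst)),
      Fiber.hom_ext h₁, Fiber.hom_ext h₂⟩
  exact ⟨⟨Fiber.hom_ext sq.w⟩, ⟨PullbackCone.IsLimit.mk _ (fun s => (ex s).choose)
    (fun s => (ex s).choose_spec.1) (fun s => (ex s).choose_spec.2) fun s m h₁ h₂ =>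
      Fiber.hom_ext (sq.hom_ext (congrArg totMap (h₁.trans (ex s).choose_spec.1.symm))
        (congrArg totMap (h₂.trans (ex s).choose_spec.2.symm)))⟩⟩

variable (p : E ⥤ B) (T : Monad E)

/-- The restrictions of the fibred monad `T` to the fibres of `p` are cartesian monads. -/
class HasCartesianFibres [IsFibredMonad p T] : Prop where
  cartesian (b : B) : IsCartesianMonad (fibreMonad p T b)

variable [p.IsFibered] [HasFibredPullbacks p] [IsFibredMonad p T]

namespace GraphOver

variable {p T} {O Q : E}

@[simp]
theorem tensorHom_fst {u : O ⟶ Q} {A A' : GraphOver p T O} {C C' : GraphOver p T Q}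
    (f : A.Hom u C) (f' : A'.Hom u C') :
    (tensorHom f f').map ≫ fst C C' = fst A A' ≫ f.map :=
  (isPullback C C').lift_fst _ _ _

@[simp]
theorem tensorHom_snd {u : O ⟶ Q} {A A' : GraphOver p T O} {C C' : GraphOver p T Q}
    (f : A.Hom u C) (f' : A'.Hom u C') :
    (tensorHom f f').map ≫ snd C C' = snd A A' ≫ T.map f'.map :=
  (isPullback C C').lift_snd _ _ _

theorem assoc_fst_fst (A A' A'' : GraphOver p T O) :
    (assoc A A' A'').map ≫ fst (tensor A A') A'' ≫ fst A A' = fst A (tensor A' A'') :=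
  ((isPullback (tensor A A') A'').lift_fst_assoc _ _ _ _).trans
    ((isPullback A A').lift_fst _ _ _)

theorem assoc_fst_snd (A A' A'' : GraphOver p T O) :
    (assoc A A' A'').map ≫ fst (tensor A A') A'' ≫ snd A A' =
      snd A (tensor A' A'') ≫ T.map (fst A' A'') :=
  ((isPullback (tensor A A') A'').lift_fst_assoc _ _ _ _).trans
    ((isPullback A A').lift_snd _ _ _)

theorem assoc_snd (A A' A'' : GraphOver p T O) :
    (assoc A A' A'').map ≫ snd (tensor A A') A'' =
      snd A (tensor A' A'') ≫ T.map (snd A' A'') ≫ T.μ.app A''.apex :=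
  (isPullback (tensor A A') A'').lift_snd _ _ _

theorem lam_fst (A : GraphOver p T O) : (lam A).map ≫ fst (unit p T O) A = A.cod :=
  (isPullback (unit p T O) A).lift_fst _ _ _

theorem lam_snd (A : GraphOver p T O) : (lam A).map ≫ snd (unit p T O) A = T.η.app A.apex :=
  (isPullback (unit p T O) A).lift_snd _ _ _

section

variable {u : O ⟶ Q}

theorem tensorHom_assoc {A A' A'' : GraphOver p T O} {C C' C'' : GraphOver p T Q} (f : A.Hom u C)
    (f' : A'.Hom u C') (f'' : A''.Hom u C'') :
    (tensorHom f (tensorHom f' f'')).map ≫ (assoc C C' C'').map =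
      (assoc A A' A'').map ≫ (tensorHom (tensorHom f f') f'').map := by
  have hμ : T.map (T.map f''.map) ≫ T.μ.app C''.apex = T.μ.app A''.apex ≫ T.map f''.map :=
    T.μ.naturality f''.map
  refine (isPullback _ _).hom_ext ((isPullback _ _).hom_ext ?_ ?_) ?_ <;>
    simp only [Category.assoc, tensorHom_fst, tensorHom_snd,
      reassoc_of% tensorHom_snd (p := p), assoc_fst_fst,
      assoc_fst_snd, assoc_snd, reassoc_of% assoc_fst_fst (p := p),
      reassoc_of% assoc_fst_snd (p := p), reassoc_of% assoc_snd (p := p), ← T.map_comp,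
      ← T.map_comp_assoc]
  simp only [T.map_comp, Category.assoc, hμ]

theorem tensorHom_lam {A : GraphOver p T O} {C : GraphOver p T Q} (f : A.Hom u C) :
    (lam A).map ≫ (tensorHom (unitHom p T u) f).map = f.map ≫ (lam C).map := by
  have hη : f.map ≫ T.η.app C.apex = T.η.app A.apex ≫ T.map f.map := T.η.naturality f.map
  refine (isPullback _ _).hom_ext ?_ ?_
  · rw [Category.assoc, Category.assoc, tensorHom_fst, lam_fst, f.cod_comm, ← Category.assoc,
      lam_fst]
    rfl
  · rw [Category.assoc, Category.assoc, tensorHom_snd, lam_snd, reassoc_of% lam_snd (p := p), hη]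

theorem tensorHom_rho {A : GraphOver p T O} {C : GraphOver p T Q} (f : A.Hom u C) :
    (tensorHom f (unitHom p T u)).map ≫ (rho C).map = (rho A).map ≫ f.map :=
  tensorHom_fst _ _

end

theorem isHomLift_fst (A A' : GraphOver p T O) : p.IsHomLift (𝟙 (p.obj O)) (fst A A') :=
  (pullback.fst A.domV A'.mapCodV).2

theorem isHomLift_snd (A A' : GraphOver p T O) : p.IsHomLift (𝟙 (p.obj O)) (snd A A') :=
  (pullback.snd A.domV A'.mapCodV).2

end GraphOver

variable [HasCartesianFibres p T]

theorem isPullback_monad_map (b : B) {P X Y Z : E} {fst : P ⟶ X} {snd : P ⟶ Y}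
    {f : X ⟶ Z} {g : Y ⟶ Z} [h₁ : p.IsHomLift (𝟙 b) fst] [h₂ : p.IsHomLift (𝟙 b) snd]
    [h₃ : p.IsHomLift (𝟙 b) f] [h₄ : p.IsHomLift (𝟙 b) g] (sq : IsPullback fst snd f g) :
    IsPullback (T.map fst) (T.map snd) (T.map f) (T.map g) := by
  have := (HasCartesianFibres.cartesian (p := p) (T := T) b).preserves
  let P' : Fiber p b := Fiber.mk (IsHomLift.domain_eq p (𝟙 b) fst)
  let X' : Fiber p b := Fiber.mk (IsHomLift.codomain_eq p (𝟙 b) fst)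
  let Y' : Fiber p b := Fiber.mk (IsHomLift.codomain_eq p (𝟙 b) snd)
  let Z' : Fiber p b := Fiber.mk (IsHomLift.codomain_eq p (𝟙 b) f)
  have sq' : IsPullback (vert fst h₁ : P' ⟶ X') (vert snd h₂ : P' ⟶ Y') (vert f h₃ : X' ⟶ Z')
      (vert g h₄ : Y' ⟶ Z') := isPullback_fibre_of_tot sq
  exact isPullback_of_fibre p (sq'.map (fibreMonad p T b).toFunctor)

theorem isPullback_monad_unit (b : B) {X Y : E} (f : X ⟶ Y) [hf : p.IsHomLift (𝟙 b) f] :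
    IsPullback f (T.η.app X) (T.η.app Y) (T.map f) :=
  isPullback_of_fibre p ((HasCartesianFibres.cartesian (p := p) (T := T) b).unit
    (vert f hf : (Fiber.mk (IsHomLift.domain_eq p (𝟙 b) f) : Fiber p b) ⟶
      Fiber.mk (IsHomLift.codomain_eq p (𝟙 b) f)))

theorem isPullback_monad_mul (b : B) {X Y : E} (f : X ⟶ Y) [hf : p.IsHomLift (𝟙 b) f] :
    IsPullback (T.map (T.map f)) (T.μ.app X) (T.μ.app Y) (T.map f) :=
  isPullback_of_fibre p ((HasCartesianFibres.cartesian (p := p) (T := T) b).mul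
    (vert f hf : (Fiber.mk (IsHomLift.domain_eq p (𝟙 b) f) : Fiber p b) ⟶
      Fiber.mk (IsHomLift.codomain_eq p (𝟙 b) f)))

namespace GraphOver

variable {p T} {O : E}

theorem isPullback_tensor_map (A A' : GraphOver p T O) :
    IsPullback (T.map (fst A A')) (T.map (snd A A')) (T.map A.dom) (T.map (T.map A'.cod)) := by
  have := isHomLift_fst A A'
  have := isHomLift_snd A A'
  have := isHomLift_monad_map p T (𝟙 (p.obj O)) A'.cod
  exact isPullback_monad_map p T (p.obj O) (isPullback A A')

/-- Cartesianness of `T` makes `A ⊗ (A' ⊗ A'')` a model of the pullback that defines `(A ⊗ A') ⊗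
A''`. -/
theorem isPullback_assoc (A A' A'' : GraphOver p T O) :
    IsPullback ((assoc A A' A'').map ≫ fst (tensor A A') A'')
      ((assoc A A' A'').map ≫ snd (tensor A A') A'') (tensor A A').dom (T.map A''.cod) := by
  have h₁ : IsPullback ((assoc A A' A'').map ≫ fst (tensor A A') A'') (snd A (tensor A' A''))
      (snd A A') (T.map (fst A' A'')) := by
    refine IsPullback.of_right ?_ ?_ (isPullback A A')
    · rw [Category.assoc, assoc_fst_fst, ← T.map_comp]
      exact isPullback A (tensor A' A'')
    · rw [Category.assoc, assoc_fst_snd]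
  have h₂ := (h₁.paste_vert (isPullback_tensor_map A' A'')).paste_vert
    (isPullback_monad_mul p T (p.obj O) A''.cod)
  rw [Category.assoc, Category.assoc] at h₂
  rw [assoc_snd]
  exact h₂

instance (A A' A'' : GraphOver p T O) : IsIso (assoc A A' A'').map := by
  have h := isPullback_assoc A A' A''
  have e : (assoc A A' A'').map = (h.isoIsPullback _ _ (isPullback (tensor A A') A'')).hom :=
    (isPullback (tensor A A') A'').hom_ext (h.isoIsPullback_hom_fst _ _ _).symm
      (h.isoIsPullback_hom_snd _ _ _).symm
  rw [e]
  infer_instance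

instance (A : GraphOver p T O) : IsIso (lam A).map := by
  have h := isPullback_monad_unit p T (p.obj O) A.cod
  have e : (lam A).map = (h.isoIsPullback _ _ (isPullback (unit p T O) A)).hom :=
    (isPullback (unit p T O) A).hom_ext ((lam_fst A).trans (h.isoIsPullback_hom_fst _ _ _).symm)
      ((lam_snd A).trans (h.isoIsPullback_hom_snd _ _ _).symm)
  rw [e]
  infer_instance

instance (A : GraphOver p T O) : IsIso (rho A).map := by
  have h := isPullback A (unit p T O)
  have : IsIso (T.map (unit p T O).cod) := by
    dsimp
    infer_instance
  exact h.isIso_fst_of_isIso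

variable (p T O) in
/-- The canonical morphisms `α` and `λ` are invertible because `T` is cartesian. Mathlib's
associator and left unitor have the opposite direction, so they are the inverses of `α` and `λ`. -/
noncomputable instance : MonoidalCategoryStruct (GraphOver p T O) where
  tensorObj A A' := tensor A A'
  tensorHom f f' := homMk (tensorHom f f').map (map_cod (tensorHom f f')) (map_dom (tensorHom f f'))
  whiskerLeft A _ _ f := homMk (tensorHom A.idHom f).map (map_cod (tensorHom A.idHom f))
    (map_dom (tensorHom A.idHom f))
  whiskerRight f A := homMk (tensorHom f A.idHom).map (map_cod (tensorHom f A.idHom))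
    (map_dom (tensorHom f A.idHom))
  tensorUnit := unit p T O
  associator A A' A'' :=
    letI f : tensor A (tensor A' A'') ⟶ tensor (tensor A A') A'' := assoc A A' A''
    haveI : IsIso f.map := inferInstanceAs (IsIso (assoc A A' A'').map)
    haveI := isIso_of_isIso_map f
    (asIso f).symm
  leftUnitor A :=
    letI f : A ⟶ tensor (unit p T O) A := lam A
    haveI : IsIso f.map := inferInstanceAs (IsIso (lam A).map)
    haveI := isIso_of_isIso_map f
    (asIso f).symm
  rightUnitor A :=
    letI f : tensor A (unit p T O) ⟶ A := rho A
    haveI : IsIso f.map := inferInstanceAs (IsIso (rho A).map)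
    haveI := isIso_of_isIso_map f
    asIso f

end GraphOver

end Burroni

namespace Burroni

variable {B : Type u₁} [Category.{v₁} B] {E : Type u₂} [Category.{v₂} E]
variable {p : E ⥤ B} {T : Monad E} [p.IsFibered] [HasFibredPullbacks p] [IsFibredMonad p T]
variable [HasCartesianFibres p T] {O : E}

namespace GraphOver

open MonoidalCategory

theorem map_fst {A A' C C' : GraphOver p T O} (f : A ⟶ C) (f' : A' ⟶ C') :
    Hom.map (f ⊗ₘ f') ≫ fst C C' = fst A A' ≫ f.map :=
  tensorHom_fst f f'

theorem map_snd {A A' C C' : GraphOver p T O} (f : A ⟶ C) (f' : A' ⟶ C') :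
    Hom.map (f ⊗ₘ f') ≫ snd C C' = snd A A' ≫ T.map f'.map :=
  tensorHom_snd f f'

theorem assocInv_fst_fst (A A' A'' : GraphOver p T O) :
    Hom.map (α_ A A' A'').inv ≫ fst (A ⊗ A') A'' ≫ fst A A' = fst A (A' ⊗ A'') :=
  assoc_fst_fst A A' A''

theorem assocInv_fst_snd (A A' A'' : GraphOver p T O) :
    Hom.map (α_ A A' A'').inv ≫ fst (A ⊗ A') A'' ≫ snd A A' =
      snd A (A' ⊗ A'') ≫ T.map (fst A' A'') :=
  assoc_fst_snd A A' A''

theorem assocInv_snd (A A' A'' : GraphOver p T O) :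
    Hom.map (α_ A A' A'').inv ≫ snd (A ⊗ A') A'' =
      snd A (A' ⊗ A'') ≫ T.map (snd A' A'') ≫ T.μ.app A''.apex :=
  assoc_snd A A' A''

theorem leftInv_fst (A : GraphOver p T O) :
    Hom.map (λ_ A).inv ≫ fst (𝟙_ _) A = A.cod :=
  lam_fst A

theorem leftInv_snd (A : GraphOver p T O) :
    Hom.map (λ_ A).inv ≫ snd (𝟙_ _) A = T.η.app A.apex :=
  lam_snd A

theorem rightUnitor_hom_map (A : GraphOver p T O) : Hom.map (ρ_ A).hom = fst A (𝟙_ _) := rfl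

theorem apex_ext {A A' : GraphOver p T O} {X : E} {f g : X ⟶ (A ⊗ A').apex}
    (h₁ : f ≫ fst A A' = g ≫ fst A A') (h₂ : f ≫ snd A A' = g ≫ snd A A') : f = g :=
  (isPullback A A').hom_ext h₁ h₂

theorem id_tensor_id (A A' : GraphOver p T O) : (𝟙 A) ⊗ₘ (𝟙 A') = 𝟙 (A ⊗ A') := by
  refine hom_ext (apex_ext ?_ ?_) <;>
    simp only [map_fst, map_snd, id_map, Category.comp_id, Category.id_comp, T.map_id]

theorem comp_tensor_comp {A₁ A₂ A₃ C₁ C₂ C₃ : GraphOver p T O} (f : A₁ ⟶ A₂) (f' : C₁ ⟶ C₂)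
    (g : A₂ ⟶ A₃) (g' : C₂ ⟶ C₃) : (f ⊗ₘ f') ≫ (g ⊗ₘ g') = (f ≫ g) ⊗ₘ (f' ≫ g') := by
  refine hom_ext (apex_ext ?_ ?_) <;>
    simp only [comp_map, Category.assoc, map_fst, map_snd, reassoc_of% map_fst (p := p),
      reassoc_of% map_snd (p := p), T.map_comp]

theorem associatorInv_naturality {A₁ A₂ A₃ C₁ C₂ C₃ : GraphOver p T O} (f : A₁ ⟶ C₁) (g : A₂ ⟶ C₂)
    (h : A₃ ⟶ C₃) :
    (f ⊗ₘ (g ⊗ₘ h)) ≫ (α_ C₁ C₂ C₃).inv = (α_ A₁ A₂ A₃).inv ≫ ((f ⊗ₘ g) ⊗ₘ h) :=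
  hom_ext (tensorHom_assoc f g h)

theorem leftUnitorInv_naturality {A C : GraphOver p T O} (f : A ⟶ C) :
    (λ_ A).inv ≫ (𝟙 (𝟙_ (GraphOver p T O)) ⊗ₘ f) = f ≫ (λ_ C).inv :=
  hom_ext (tensorHom_lam f)

theorem rightUnitor_naturality {A C : GraphOver p T O} (f : A ⟶ C) :
    (f ⊗ₘ 𝟙 (𝟙_ (GraphOver p T O))) ≫ (ρ_ C).hom = (ρ_ A).hom ≫ f :=
  hom_ext (tensorHom_rho f)

/-- The pentagon is verified for the inverse associators, which are given by explicit projections.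
-/
theorem pentagonInv (W X Y Z : GraphOver p T O) :
    (𝟙 W ⊗ₘ (α_ X Y Z).inv) ≫ (α_ W (X ⊗ Y) Z).inv ≫ ((α_ W X Y).inv ⊗ₘ 𝟙 Z) =
      (α_ W X (Y ⊗ Z)).inv ≫ (α_ (W ⊗ X) Y Z).inv := by
  have hμ : T.map (T.map (snd Y Z)) ≫ T.μ.app (T.obj Z.apex) =
    T.μ.app (Y ⊗ Z).apex ≫ T.map (snd Y Z) := T.μ.naturality (snd Y Z)
  have hμ' : T.map (T.map (fst Y Z)) ≫ T.μ.app Y.apex =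
    T.μ.app (Y ⊗ Z).apex ≫ T.map (fst Y Z) := T.μ.naturality (fst Y Z)
  have ha : T.map (T.μ.app Z.apex) ≫ T.μ.app Z.apex = T.μ.app (T.obj Z.apex) ≫ T.μ.app Z.apex :=
    T.assoc Z.apex
  refine hom_ext (apex_ext (apex_ext (apex_ext ?_ ?_) ?_) ?_) <;>
    simp only [comp_map, Category.assoc, map_fst, map_snd,
      reassoc_of% map_snd (p := p), assocInv_fst_fst, assocInv_fst_snd, assocInv_snd, id_map,
      reassoc_of% assocInv_fst_snd (p := p),
      reassoc_of% assocInv_snd (p := p), ← T.map_comp, ← T.map_comp_assoc, Category.comp_id,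
      T.map_id]
  all_goals simp only [T.map_comp, Category.assoc, hμ', ha, reassoc_of% hμ]

theorem triangleInv (X Y : GraphOver p T O) :
    (𝟙 X ⊗ₘ (λ_ Y).inv) ≫ (α_ X (𝟙_ _) Y).inv ≫ ((ρ_ X).hom ⊗ₘ 𝟙 Y) = 𝟙 (X ⊗ Y) := by
  have hη : T.map (T.η.app Y.apex) ≫ T.μ.app Y.apex = 𝟙 (T.obj Y.apex) := T.right_unit Y.apex
  refine hom_ext (apex_ext ?_ ?_) <;>
    simp only [comp_map, Category.assoc, map_fst, map_snd,
      reassoc_of% map_snd (p := p), assocInv_fst_fst, assocInv_snd, id_map, rightUnitor_hom_map,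
      ← T.map_comp_assoc, leftInv_snd, Category.comp_id,
      Category.id_comp, T.map_id, hη]

/-- Pentagon and triangle follow from `pentagonInv` and `triangleInv` by inverting all morphisms. -/
noncomputable instance : MonoidalCategory (GraphOver p T O) :=
  MonoidalCategory.ofTensorHom
    (id_tensorHom_id := id_tensor_id)
    (id_tensorHom := fun X _ _ f => hom_ext rfl)
    (tensorHom_id := fun f Y => hom_ext rfl)
    (tensorHom_comp_tensorHom := comp_tensor_comp)
    (associator_naturality := fun f g h => by
      rw [← Iso.eq_comp_inv, Category.assoc, ← Iso.inv_comp_eq]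
      exact (associatorInv_naturality f g h).symm)
    (leftUnitor_naturality := fun f => by
      rw [← Iso.eq_comp_inv, Category.assoc, ← Iso.inv_comp_eq]
      exact leftUnitorInv_naturality f)
    (rightUnitor_naturality := rightUnitor_naturality)
    (pentagon := fun W X Y Z => by
      let a : (W ⊗ X ⊗ Y) ⊗ Z ≅ ((W ⊗ X) ⊗ Y) ⊗ Z :=
        { hom := (α_ W X Y).inv ⊗ₘ 𝟙 Z
          inv := (α_ W X Y).hom ⊗ₘ 𝟙 Z
          hom_inv_id := by rw [comp_tensor_comp, Iso.inv_hom_id, Category.comp_id, id_tensor_id]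
          inv_hom_id := by rw [comp_tensor_comp, Iso.hom_inv_id, Category.comp_id, id_tensor_id] }
      let c : W ⊗ X ⊗ Y ⊗ Z ≅ W ⊗ (X ⊗ Y) ⊗ Z :=
        { hom := 𝟙 W ⊗ₘ (α_ X Y Z).inv
          inv := 𝟙 W ⊗ₘ (α_ X Y Z).hom
          hom_inv_id := by rw [comp_tensor_comp, Iso.inv_hom_id, Category.comp_id, id_tensor_id]
          inv_hom_id := by rw [comp_tensor_comp, Iso.hom_inv_id, Category.comp_id, id_tensor_id] }
      have e : c ≪≫ (α_ W (X ⊗ Y) Z).symm ≪≫ a = (α_ W X (Y ⊗ Z)).symm ≪≫ (α_ (W ⊗ X) Y Z).symm :=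
        Iso.ext (pentagonInv W X Y Z)
      have := congrArg Iso.inv e
      simp only [Iso.trans_inv, Iso.symm_inv, Category.assoc] at this
      exact this)
    (triangle := fun X Y => by
      let c : X ⊗ Y ≅ X ⊗ 𝟙_ _ ⊗ Y :=
        { hom := 𝟙 X ⊗ₘ (λ_ Y).inv
          inv := 𝟙 X ⊗ₘ (λ_ Y).hom
          hom_inv_id := by rw [comp_tensor_comp, Iso.inv_hom_id, Category.comp_id, id_tensor_id]
          inv_hom_id := by rw [comp_tensor_comp, Iso.hom_inv_id, Category.comp_id, id_tensor_id] }
      have := triangleInv X Y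
      change c.hom ≫ _ = _ at this
      rw [← Iso.eq_inv_comp, Iso.inv_comp_eq, Category.comp_id] at this
      exact this.symm)

end GraphOver

end Burroni

/-! ### Exactness of the tensor product of graphs -/

namespace Burroni

/-- Fibre products over a fixed object of the corners of two pullback squares form a pullback
square. -/
theorem isPullback_of_fibreProducts {C : Type*} [Category* C]
    {S P X Y Z P' X' Y' Z' PP XX YY ZZ : C}
    {fst : P ⟶ X} {snd : P ⟶ Y} {f : X ⟶ Z} {g : Y ⟶ Z} (h : IsPullback fst snd f g)
    {fst' : P' ⟶ X'} {snd' : P' ⟶ Y'} {f' : X' ⟶ Z'} {g' : Y' ⟶ Z'}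
    (h' : IsPullback fst' snd' f' g')
    {p : P ⟶ S} {x : X ⟶ S} {y : Y ⟶ S} {z : Z ⟶ S} {p' : P' ⟶ S} {x' : X' ⟶ S} {y' : Y' ⟶ S}
    {z' : Z' ⟶ S} {p₁ : PP ⟶ P} {p₂ : PP ⟶ P'} {x₁ : XX ⟶ X} {x₂ : XX ⟶ X'} {y₁ : YY ⟶ Y}
    {y₂ : YY ⟶ Y'} {z₁ : ZZ ⟶ Z} {z₂ : ZZ ⟶ Z'} (hP : IsPullback p₁ p₂ p p')
    (hX : IsPullback x₁ x₂ x x') (hY : IsPullback y₁ y₂ y y') (hZ : IsPullback z₁ z₂ z z')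
    (hp : fst ≫ x = p) (hp' : fst' ≫ x' = p')
    {F : PP ⟶ XX} {G : PP ⟶ YY} {H : XX ⟶ ZZ} {K : YY ⟶ ZZ}
    (hF₁ : F ≫ x₁ = p₁ ≫ fst) (hF₂ : F ≫ x₂ = p₂ ≫ fst')
    (hG₁ : G ≫ y₁ = p₁ ≫ snd) (hG₂ : G ≫ y₂ = p₂ ≫ snd')
    (hH₁ : H ≫ z₁ = x₁ ≫ f) (hH₂ : H ≫ z₂ = x₂ ≫ f')
    (hK₁ : K ≫ z₁ = y₁ ≫ g) (hK₂ : K ≫ z₂ = y₂ ≫ g') : IsPullback F G H K := by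
  have ex (s : PullbackCone H K) : ∃ l : s.pt ⟶ PP, l ≫ F = s.fst ∧ l ≫ G = s.snd := by
    have e₁ : (s.fst ≫ x₁) ≫ f = (s.snd ≫ y₁) ≫ g := by
      rw [Category.assoc, Category.assoc, ← hH₁, ← hK₁, s.condition_assoc]
    have e₂ : (s.fst ≫ x₂) ≫ f' = (s.snd ≫ y₂) ≫ g' := by
      rw [Category.assoc, Category.assoc, ← hH₂, ← hK₂, s.condition_assoc]
    have e : h.lift _ _ e₁ ≫ p = h'.lift _ _ e₂ ≫ p' := by
      rw [← hp, ← hp', h.lift_fst_assoc, h'.lift_fst_assoc, Category.assoc, Category.assoc, hX.w]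
    refine ⟨hP.lift _ _ e, hX.hom_ext ?_ ?_, hY.hom_ext ?_ ?_⟩
    · rw [Category.assoc, hF₁, hP.lift_fst_assoc, h.lift_fst]
    · rw [Category.assoc, hF₂, hP.lift_snd_assoc, h'.lift_fst]
    · rw [Category.assoc, hG₁, hP.lift_fst_assoc, h.lift_snd]
    · rw [Category.assoc, hG₂, hP.lift_snd_assoc, h'.lift_snd]
  refine ⟨⟨hZ.hom_ext ?_ ?_⟩, ⟨PullbackCone.IsLimit.mk _ (fun s => (ex s).choose)
    (fun s => (ex s).choose_spec.1) (fun s => (ex s).choose_spec.2) fun s m h₁ h₂ => ?_⟩⟩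
  · rw [Category.assoc, Category.assoc, hH₁, hK₁, reassoc_of% hF₁, reassoc_of% hG₁, h.w]
  · rw [Category.assoc, Category.assoc, hH₂, hK₂, reassoc_of% hF₂, reassoc_of% hG₂, h'.w]
  · have e₁ := h₁.trans (ex s).choose_spec.1.symm
    have e₂ := h₂.trans (ex s).choose_spec.2.symm
    refine hP.hom_ext (h.hom_ext ?_ ?_) (h'.hom_ext ?_ ?_)
    · rw [Category.assoc, Category.assoc, ← hF₁, reassoc_of% e₁]
    · rw [Category.assoc, Category.assoc, ← hG₁, reassoc_of% e₂]
    · rw [Category.assoc, Category.assoc, ← hF₂, reassoc_of% e₁]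
    · rw [Category.assoc, Category.assoc, ← hG₂, reassoc_of% e₂]

theorem isPullback_congr {C : Type*} [Category* C] {P X Y Z : C} {f f' : P ⟶ X} {g : P ⟶ Y}
    {h : X ⟶ Z} {k k' : Y ⟶ Z} (sq : IsPullback f g h k) (hf : f' = f) (hk : k' = k) :
    IsPullback f' g h k' := by
  subst hf hk
  exact sq

variable {B : Type u₁} [Category.{v₁} B] {E : Type u₂} [Category.{v₂} E]
variable {p : E ⥤ B} {T : Monad E} [p.IsFibered] [HasFibredPullbacks p] [IsFibredMonad p T]
variable [HasCartesianFibres p T] {O : E}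

namespace GraphOver

open MonoidalCategory

theorem isPullback_tensorHom {P X Y Z P' X' Y' Z' : GraphOver p T O}
    {fst : P ⟶ X} {snd : P ⟶ Y} {f : X ⟶ Z} {g : Y ⟶ Z}
    {fst' : P' ⟶ X'} {snd' : P' ⟶ Y'} {f' : X' ⟶ Z'} {g' : Y' ⟶ Z'}
    (h : IsPullback fst snd f g) (h' : IsPullback fst' snd' f' g') :
    IsPullback (fst ⊗ₘ fst') (snd ⊗ₘ snd') (f ⊗ₘ f') (g ⊗ₘ g') := by
  have := isHomLift_map fst'
  have := isHomLift_map snd'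
  have := isHomLift_map f'
  have := isHomLift_map g'
  refine isPullback_of_map (isPullback_of_fibreProducts (isPullback_map h)
    (isPullback_monad_map p T (p.obj O) (isPullback_map h')) (isPullback P P') (isPullback X X')
    (isPullback Y Y') (isPullback Z Z') (map_dom fst) ?_ (map_fst _ _) (map_snd _ _) (map_fst _ _)
    (map_snd _ _) (map_fst _ _) (map_snd _ _) (map_fst _ _) (map_snd _ _))
  rw [← T.map_comp, map_cod]

/-- The first projection `A ⊗ X ⟶ A`, as a morphism of the fibre. -/
noncomputable def fstV (A X : GraphOver p T O) : (apexF p T O).obj (A ⊗ X) ⟶ (apexF p T O).obj A :=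
  vert (fst A X) (isHomLift_fst A X)

/-- The second projection `A ⊗ X ⟶ T X`, as a morphism of the fibre. -/
noncomputable def sndV (A X : GraphOver p T O) :
    (apexF p T O).obj (A ⊗ X) ⟶ (fibreMonad p T (p.obj O)).obj ((apexF p T O).obj X) :=
  vert (snd A X) (isHomLift_snd A X)

theorem isPullback_fstV (A X : GraphOver p T O) :
    IsPullback (fstV A X) (sndV A X) A.domV
      ((fibreMonad p T (p.obj O)).map X.codV : _ ⟶ targetV p T O) :=
  isPullback_fibre_of_tot (isPullback A X)

/-- Naturality squares of the first projection are pullbacks, by the pasting lemma. -/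
theorem isPullback_fstV_naturality {A A' : GraphOver p T O} (f : A ⟶ A') (X : GraphOver p T O) :
    IsPullback ((apexF p T O).map (f ▷ X)) (fstV A X) (fstV A' X) ((apexF p T O).map f) := by
  have e₁ : (apexF p T O).map (f ▷ X) ≫ sndV A' X = sndV A X :=
    Fiber.hom_ext ((tensorHom_snd f X.idHom).trans
      ((congrArg (snd A X ≫ ·) (T.map_id _)).trans (Category.comp_id _)))
  have e₂ : (apexF p T O).map f ≫ A'.domV = A.domV := Fiber.hom_ext (map_dom f)
  refine (IsPullback.of_right (h₁₂ := sndV A' X) (h₂₂ := A'.domV)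
    (v₁₃ := ((fibreMonad p T (p.obj O)).map X.codV : _ ⟶ targetV p T O)) ?_ ?_
    (isPullback_fstV A' X).flip)
  · exact isPullback_congr (isPullback_fstV A X).flip e₁ e₂
  · exact Fiber.hom_ext (tensorHom_fst f X.idHom)

/-- The functor `A ↦ A ⊗ X` is equifibered over the identity, so it inherits preservation of
universal colimits. -/
theorem preservesColimitsOfShape_tensorRight (h : IsSuitableCategory.{w} (Fiber p (p.obj O)))
    (X : GraphOver p T O) :
    PreservesColimitsOfShape (Discrete WalkingPair) (tensorRight X) := by
  have := h.hasFiniteCoproducts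
  let κ : tensorRight X ⋙ apexF p T O ⟶ apexF p T O :=
    { app := fun A => fstV A X
      naturality := fun A A' f => (isPullback_fstV_naturality f X).w }
  have hκ : NatTrans.Equifibered κ := fun A A' f => isPullback_fstV_naturality f X
  have := preservesColimitsOfShape_of_equifibered (J := Discrete WalkingPair) κ hκ
    fun F c hc => h.isUniversalColimit_of_finite hc
  exact preservesColimitsOfShape_of_reflects_of_preserves (tensorRight X) (apexF p T O)

/-- The tensor product is a pullback over the constant object `T O`, and `T` preserves filtered
colimits, so the claim follows from the commutation of filtered colimits with pullbacks. -/
theorem nonempty_isColimit_tensorCocone (h : IsSuitableCategory.{w} (Fiber p (p.obj O)))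
    (hT : PreservesFibreFilteredColimits.{w} p T) (J : Type w) [SmallCategory J] [IsFiltered J]
    {F G : J ⥤ GraphOver p T O} (c : Cocone F) (d : Cocone G) (hc : IsColimit c)
    (hd : IsColimit d) : Nonempty (IsColimit (tensorCocone c d)) := by
  have := h.hasFilteredColimits J
  have := hT (p.obj O) J
  have : IsConnected J := IsFiltered.isConnected J
  let P := tensorDiagram F G ⋙ apexF p T O
  let T' := (fibreMonad p T (p.obj O)).toFunctor
  let t : Cocone P := (apexF p T O).mapCocone (tensorCocone c d)
  have hP := colimit.isColimit P
  let dsc : colimit P ⟶ t.pt := hP.desc t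
  have hdsc (j : J) : (colimit.cocone P).ι.app j ≫ dsc = t.ι.app j := hP.fac t j
  have key := h.commute J (P := P) (X := F ⋙ apexF p T O) (Y := G ⋙ apexF p T O ⋙ T')
    (Z := (Functor.const J).obj (targetV p T O))
    { app := fun j => fstV (F.obj j) (G.obj j)
      naturality := fun i j f => Fiber.hom_ext (map_fst (F.map f) (G.map f)) }
    { app := fun j => sndV (F.obj j) (G.obj j)
      naturality := fun i j f => Fiber.hom_ext (map_snd (F.map f) (G.map f)) }
    { app := fun j => (F.obj j).domV
      naturality := fun i j f => (domN p T O).naturality (F.map f) }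
    { app := fun j => (T'.map (G.obj j).codV : _ ⟶ targetV p T O)
      naturality := fun i j f => by
        refine (T'.map_comp _ _).symm.trans (Eq.trans ?_ (Category.comp_id _).symm)
        exact congrArg T'.map (Fiber.hom_ext (map_cod (G.map f))) }
    (fun j => isPullback_fstV (F.obj j) (G.obj j)) _ _ _ _ hP
    (isColimitOfPreserves (apexF p T O) hc)
    (isColimitOfPreserves T' (isColimitOfPreserves (apexF p T O) hd))
    (isColimitConstCocone J (targetV p T O))
    (dsc ≫ fstV c.pt d.pt) (dsc ≫ sndV c.pt d.pt) c.pt.domV (T'.map d.pt.codV)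
    (fun j => ((reassoc_of% (hdsc j)) (fstV c.pt d.pt)).trans
      (Fiber.hom_ext (map_fst (c.ι.app j) (d.ι.app j))))
    (fun j => ((reassoc_of% (hdsc j)) (sndV c.pt d.pt)).trans
      (Fiber.hom_ext (map_snd (c.ι.app j) (d.ι.app j))))
    (fun j => (Fiber.hom_ext (map_dom (c.ι.app j)) :
      (apexF p T O).map (c.ι.app j) ≫ c.pt.domV = (F.obj j).domV).trans (Category.comp_id _).symm)
    (fun j => by
      refine (T'.map_comp _ _).symm.trans (Eq.trans ?_ (Category.comp_id _).symm)
      exact congrArg T'.map (Fiber.hom_ext (map_cod (d.ι.app j))))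
  have e : dsc = (key.isoIsPullback _ _ (isPullback_fstV c.pt d.pt)).hom :=
    (isPullback_fstV c.pt d.pt).hom_ext (key.isoIsPullback_hom_fst _ _ _).symm
      (key.isoIsPullback_hom_snd _ _ _).symm
  have : IsIso (hP.desc t) := by
    change IsIso dsc
    rw [e]
    exact Iso.isIso_hom _
  exact ⟨isColimitOfReflects (apexF p T O) hP.ofPointIso⟩

theorem isSuitableTensor (h : IsSuitableCategory.{w} (Fiber p (p.obj O)))
    (hT : PreservesFibreFilteredColimits.{w} p T) : IsSuitableTensor.{w} (GraphOver p T O) where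
  isPullback := isPullback_tensorHom
  filtered J _ _ _ _ c d hc hd := nonempty_isColimit_tensorCocone h hT J c d hc hd
  coproducts := preservesColimitsOfShape_tensorRight h

end GraphOver

end Burroni

/-! ### Relative categories as monoids, and their reindexing -/

namespace Burroni

variable {B : Type u₁} [Category.{v₁} B] {E : Type u₂} [Category.{v₂} E]
variable {p : E ⥤ B} {T : Monad E} [p.IsFibered] [HasFibredPullbacks p] [IsFibredMonad p T]

namespace GraphOver

section

variable {O Q : E} {u : O ⟶ Q}

/-- A morphism over `u` preceded by a morphism over `𝟙 O`. -/
@[simps]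
def Hom.precomp {A A' : GraphOver p T O} {C : GraphOver p T Q} (g : A ⟶ A') (f : A'.Hom u C) :
    A.Hom u C where
  map := g.map ≫ f.map
  cod_comm := by rw [Category.assoc, f.cod_comm, map_cod_assoc]
  dom_comm := by rw [Category.assoc, f.dom_comm, map_dom_assoc]

/-- A morphism over `u` followed by a morphism over `𝟙 Q`. -/
@[simps]
def Hom.postcomp {A : GraphOver p T O} {C C' : GraphOver p T Q} (f : A.Hom u C) (g : C ⟶ C') :
    A.Hom u C' where
  map := f.map ≫ g.map
  cod_comm := by rw [Category.assoc, map_cod, f.cod_comm]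
  dom_comm := by rw [Category.assoc, map_dom, f.dom_comm]

theorem tensorHom_map_comp {A A' : GraphOver p T O} {D D' : GraphOver p T O}
    {C C' : GraphOver p T Q} (g : A ⟶ D) (g' : A' ⟶ D') (f : D.Hom u C) (f' : D'.Hom u C')
    (k : A.Hom u C) (k' : A'.Hom u C') (h : g.map ≫ f.map = k.map) (h' : g'.map ≫ f'.map = k'.map) :
    (tensorHom g g').map ≫ (tensorHom f f').map = (tensorHom k k').map := by
  refine (isPullback _ _).hom_ext ?_ ?_
  · rw [Category.assoc, tensorHom_fst, tensorHom_fst, reassoc_of% tensorHom_fst (p := p), h]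
  · rw [Category.assoc, tensorHom_snd, tensorHom_snd, reassoc_of% tensorHom_snd (p := p),
      ← T.map_comp, h']

theorem tensorHom_comp_map {A A' : GraphOver p T O} {D D' C C' : GraphOver p T Q}
    (f : A.Hom u D) (f' : A'.Hom u D') (g : D ⟶ C) (g' : D' ⟶ C')
    (k : A.Hom u C) (k' : A'.Hom u C') (h : f.map ≫ g.map = k.map) (h' : f'.map ≫ g'.map = k'.map) :
    (tensorHom f f').map ≫ (tensorHom g g').map = (tensorHom k k').map := by
  refine (isPullback _ _).hom_ext ?_ ?_
  · rw [Category.assoc, tensorHom_fst, tensorHom_fst, reassoc_of% tensorHom_fst (p := p), h]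
  · rw [Category.assoc, tensorHom_snd, tensorHom_snd, reassoc_of% tensorHom_snd (p := p),
      ← T.map_comp, h']

end

end GraphOver

open GraphOver MonoidalCategory

variable [HasCartesianFibres p T]

/-- The relative category given by a monoid object in the category of graphs over `O`. -/
abbrev RelMon.ofMonObj {O : E} (X : GraphOver p T O) [MonObj X] : RelMon p T where
  base := O
  graph := X
  mul := MonObj.mul (X := X)
  one := MonObj.one (X := X)
  mul_assoc := congrArg Hom.map ((Iso.inv_comp_eq _).2 (MonObj.mul_assoc X))
  one_mul := congrArg Hom.map ((Iso.inv_comp_eq_id _).2 (MonObj.one_mul X))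
  mul_one := congrArg Hom.map (MonObj.mul_one X)

/-- A morphism over `u` from a monoid object to a relative category that respects units and
multiplications. -/
structure IsRelMonHom {O : E} {X : GraphOver p T O} [MonObj X] {N : RelMon p T} {u : O ⟶ N.base}
    (f : X.Hom u N.graph) : Prop where
  mul_comm : (GraphOver.tensorHom f f).map ≫ N.mul.map = Hom.map (MonObj.mul (X := X)) ≫ f.map
  one_comm : Hom.map (MonObj.one (X := X)) ≫ f.map = u ≫ N.one.map

/-- The graph of a relative category `N`, reindexed along `u`, carries a monoid structure such that
the cartesian morphism to `N` respects units and multiplications. -/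
theorem exists_monObj_reindexGraph {O : E} (N : RelMon p T) (u : O ⟶ N.base) :
    ∃ _ : MonObj (reindexGraph u N.graph), IsRelMonHom (reindexHom u N.graph) := by
  let K := reindexGraph u N.graph
  let π : K.Hom u N.graph := reindexHom u N.graph
  obtain ⟨mul, hmul⟩ : ∃ mul : K ⊗ K ⟶ K,
      mul.map ≫ π.map = (GraphOver.tensorHom π π).map ≫ N.mul.map :=
    exists_fac_reindexHom' ((GraphOver.tensorHom π π).postcomp N.mul)
  obtain ⟨one, hone⟩ : ∃ one : 𝟙_ _ ⟶ K, one.map ≫ π.map = (unitHom p T u).map ≫ N.one.map :=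
    exists_fac_reindexHom' ((unitHom p T u).postcomp N.one)
  have h_one_mul : one ▷ K ≫ mul = (λ_ K).hom := by
    rw [← Iso.inv_comp_eq_id]
    refine reindexMap_ext ?_
    have h₁ : (GraphOver.tensorHom one K.idHom).map ≫ (GraphOver.tensorHom π π).map =
        (GraphOver.tensorHom (unitHom p T u) π).map ≫
          (GraphOver.tensorHom N.one N.graph.idHom).map :=
      (tensorHom_map_comp (k := (unitHom p T u).postcomp N.one) (k' := π) _ _ _ _ hone
        (Category.id_comp _)).trans
        (tensorHom_comp_map _ π _ N.graph.idHom _ _ rfl (Category.comp_id _)).symm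
    change ((lam K).map ≫ (GraphOver.tensorHom one K.idHom).map ≫ mul.map) ≫ π.map =
      𝟙 K.apex ≫ π.map
    rw [Category.assoc, Category.assoc, hmul, reassoc_of% h₁, reassoc_of% (tensorHom_lam π),
      N.one_mul, Category.comp_id, Category.id_comp]
  have h_mul_one : K ◁ one ≫ mul = (ρ_ K).hom := by
    refine reindexMap_ext ?_
    have h₁ : (GraphOver.tensorHom K.idHom one).map ≫ (GraphOver.tensorHom π π).map =
        (GraphOver.tensorHom π (unitHom p T u)).map ≫
          (GraphOver.tensorHom N.graph.idHom N.one).map :=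
      (tensorHom_map_comp (k := π) (k' := (unitHom p T u).postcomp N.one) _ _ _ _
        (Category.id_comp _) hone).trans
        (tensorHom_comp_map π _ N.graph.idHom _ _ _ (Category.comp_id _) rfl).symm
    change ((GraphOver.tensorHom K.idHom one).map ≫ mul.map) ≫ π.map = (rho K).map ≫ π.map
    rw [Category.assoc, hmul, reassoc_of% h₁, N.mul_one, tensorHom_rho]
  have h_mul_assoc : mul ▷ K ≫ mul = (α_ K K K).hom ≫ K ◁ mul ≫ mul := by
    rw [← Iso.inv_comp_eq]
    refine reindexMap_ext ?_
    have h₁ : (GraphOver.tensorHom mul K.idHom).map ≫ (GraphOver.tensorHom π π).map =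
        (GraphOver.tensorHom (GraphOver.tensorHom π π) π).map ≫
          (GraphOver.tensorHom N.mul N.graph.idHom).map :=
      (tensorHom_map_comp (k := (GraphOver.tensorHom π π).postcomp N.mul) (k' := π) _ _ _ _ hmul
        (Category.id_comp _)).trans
        (tensorHom_comp_map _ π _ N.graph.idHom _ _ rfl (Category.comp_id _)).symm
    have h₂ : (GraphOver.tensorHom K.idHom mul).map ≫ (GraphOver.tensorHom π π).map =
        (GraphOver.tensorHom π (GraphOver.tensorHom π π)).map ≫
          (GraphOver.tensorHom N.graph.idHom N.mul).map :=
      (tensorHom_map_comp (k := π) (k' := (GraphOver.tensorHom π π).postcomp N.mul) _ _ _ _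
        (Category.id_comp _) hmul).trans
        (tensorHom_comp_map π _ N.graph.idHom _ _ _ (Category.comp_id _) rfl).symm
    change ((assoc K K K).map ≫ (GraphOver.tensorHom mul K.idHom).map ≫ mul.map) ≫ π.map =
      ((GraphOver.tensorHom K.idHom mul).map ≫ mul.map) ≫ π.map
    rw [Category.assoc, Category.assoc, Category.assoc, hmul, reassoc_of% h₁, reassoc_of% h₂,
      ← N.mul_assoc, reassoc_of% (tensorHom_assoc π π π)]
  let m : MonObj K :=
    { one := one, mul := mul, one_mul := h_one_mul, mul_one := h_mul_one, mul_assoc := h_mul_assoc }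
  exact ⟨m, ⟨hmul.symm, hone⟩⟩

/-- A morphism of relative categories over `u` corresponds to a monoid morphism to the reindexed
monoid. -/
theorem IsRelMonHom.isMonHom {O : E} {N : RelMon p T} {u : O ⟶ N.base}
    [MonObj (reindexGraph u N.graph)] (hπ : IsRelMonHom (reindexHom u N.graph))
    {X : GraphOver p T O} [MonObj X] {f : X.Hom u N.graph} (hf : IsRelMonHom f)
    (l : X ⟶ reindexGraph u N.graph) (hl : l.map ≫ (reindexHom u N.graph).map = f.map) :
    IsMonHom l where
  one_hom := reindexMap_ext (by
    rw [GraphOver.comp_map, Category.assoc, hl, hf.one_comm, hπ.one_comm])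
  mul_hom := reindexMap_ext (by
    rw [GraphOver.comp_map, Category.assoc, hl, GraphOver.comp_map, Category.assoc,
      ← hf.mul_comm, ← hπ.mul_comm, ← tensorHom_map_comp l l _ _ f f hl hl, Category.assoc]
    rfl)

theorem IsRelMonHom.precomp {O : E} {N : RelMon p T} {u : O ⟶ N.base}
    {X Y : GraphOver p T O} [MonObj X] [MonObj Y] {f : Y.Hom u N.graph} (hf : IsRelMonHom f)
    (l : X ⟶ Y) [IsMonHom l] : IsRelMonHom (Hom.precomp l f) where
  one_comm := by
    rw [← hf.one_comm, Hom.precomp_map, ← comp_map_assoc, IsMonHom.one_hom]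
  mul_comm := by
    rw [← tensorHom_map_comp l l f f _ _ rfl rfl, Category.assoc, hf.mul_comm]
    exact (Category.assoc _ _ _).symm.trans ((congrArg (fun k => Hom.map k ≫ f.map)
      (IsMonHom.mul_hom l).symm).trans (Category.assoc _ _ _))

/-! ### The left adjoint of the forgetful functor -/

variable (p T) in
/-- The categories of graphs over a fixed object have the colimits used in the construction of free
monoids, and these are preserved by tensoring. -/
class HasFreeMonoids : Prop where
  hasBinaryCoproducts (O : E) : HasBinaryCoproducts (GraphOver p T O)
  hasColimitsOfShape (O : E) : HasColimitsOfShape ℕ (GraphOver p T O)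
  tensorLeft (O : E) (X : GraphOver p T O) : PreservesColimitsOfShape ℕ (tensorLeft X)
  tensorRight (O : E) (X : GraphOver p T O) : PreservesColimitsOfShape ℕ (tensorRight X)
  tensorRight_coproducts (O : E) (X : GraphOver p T O) :
    PreservesColimitsOfShape (Discrete WalkingPair) (MonoidalCategory.tensorRight X)

attribute [instance] HasFreeMonoids.hasBinaryCoproducts HasFreeMonoids.hasColimitsOfShape
  HasFreeMonoids.tensorLeft HasFreeMonoids.tensorRight HasFreeMonoids.tensorRight_coproducts

theorem HasFreeMonoids.of_isSuitable (hp : IsSuitable.{w} p)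
    (hT : PreservesFibreFilteredColimits.{w} p T) : HasFreeMonoids p T where
  hasBinaryCoproducts O :=
    have := (GraphOver.isSuitableCategory (T := T) (hp.fibre (p.obj O))).hasFiniteCoproducts
    inferInstance
  hasColimitsOfShape O :=
    (GraphOver.isSuitableCategory (T := T) (hp.fibre (p.obj O))).hasColimitsOfShape ℕ
  tensorLeft O X := (isSuitableTensor (hp.fibre (p.obj O)) hT).tensorLeft_nat X
  tensorRight O X := (isSuitableTensor (hp.fibre (p.obj O)) hT).tensorRight_nat X
  tensorRight_coproducts O X := (isSuitableTensor (hp.fibre (p.obj O)) hT).coproducts X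

variable [HasFreeMonoids p T]

namespace FreeMonoid

variable {O : E} {A : GraphOver p T O} {N : RelMon p T} {u : O ⟶ N.base}

/-- Reindexing reduces the claim to monoid morphisms between graphs over `O`. -/
theorem isRelMonHom_ext {f f' : ((free (GraphOver p T O)).obj A).Hom u N.graph}
    (hf : IsRelMonHom f) (hf' : IsRelMonHom f')
    (h : (unit A).map ≫ f.map = (unit A).map ≫ f'.map) : f = f' := by
  obtain ⟨m, hπ⟩ := exists_monObj_reindexGraph N u
  obtain ⟨l, hl⟩ := exists_fac_reindexHom' f
  obtain ⟨l', hl'⟩ := exists_fac_reindexHom' f'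
  have := hπ.isMonHom hf l hl
  have := hπ.isMonHom hf' l' hl'
  have e : l = l' := hom_ext (reindexMap_ext (by
    rw [GraphOver.comp_map, GraphOver.comp_map, Category.assoc, Category.assoc, hl, hl', h]))
  exact Hom.ext (by rw [← hl, ← hl', e])

/-- A morphism over `u` from a graph to a relative category extends to the free monoid on the
graph: extend its factorization through the reindexed monoid. -/
theorem exists_isRelMonHom (k : A.Hom u N.graph) :
    ∃ f : ((free (GraphOver p T O)).obj A).Hom u N.graph,
      IsRelMonHom f ∧ (unit A).map ≫ f.map = k.map := by
  obtain ⟨m, hπ⟩ := exists_monObj_reindexGraph N u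
  obtain ⟨l, hl⟩ := exists_fac_reindexHom' k
  refine ⟨_, hπ.precomp (lift l), ?_⟩
  rw [Hom.precomp_map, ← GraphOver.comp_map_assoc, unit_lift, hl]

end FreeMonoid

/-- The relative category freely generated by a graph. -/
noncomputable def freeRelMon (A : RelGraph p T) : RelMon p T :=
  RelMon.ofMonObj ((FreeMonoid.free (GraphOver p T A.base)).obj A.graph)

/-- Restriction of a morphism out of `freeRelMon A` along the inclusion of the generators. -/
noncomputable def restrict (A : RelGraph p T) (N : RelMon p T) (g : freeRelMon A ⟶ N) :
    A ⟶ (forget p T).obj N :=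
  ⟨g.base, Hom.precomp (FreeMonoid.unit A.graph) g.hom⟩

theorem restrict_injective (A : RelGraph p T) (N : RelMon p T) :
    Function.Injective (restrict A N) := by
  rintro ⟨u, g, h₁, h₂⟩ ⟨u', g', h₁', h₂'⟩ h
  obtain rfl : u = u' := congrArg RelGraph.Hom.base h
  exact RelMon.Hom.ext' rfl (congrArg Hom.map (FreeMonoid.isRelMonHom_ext (A := A.graph) ⟨h₁, h₂⟩
    ⟨h₁', h₂'⟩ (congrArg (fun k : A ⟶ (forget p T).obj N => k.hom.map) h)))

theorem restrict_surjective (A : RelGraph p T) (N : RelMon p T) :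
    Function.Surjective (restrict A N) := by
  rintro ⟨u, k⟩
  obtain ⟨f, hf, h⟩ := FreeMonoid.exists_isRelMonHom k
  exact ⟨⟨u, f, hf.mul_comm, hf.one_comm⟩, RelGraph.Hom.ext' rfl h⟩

/-- Morphisms out of the free relative category on a graph. -/
noncomputable def restrictEquiv (A : RelGraph p T) (N : RelMon p T) :
    (freeRelMon A ⟶ N) ≃ (A ⟶ (forget p T).obj N) :=
  Equiv.ofBijective (restrict A N) ⟨restrict_injective A N, restrict_surjective A N⟩

theorem restrictEquiv_comp (A : RelGraph p T) (N N' : RelMon p T) (g : N ⟶ N')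
    (h : freeRelMon A ⟶ N) :
    restrictEquiv A N' (h ≫ g) = restrictEquiv A N h ≫ (forget p T).map g :=
  RelGraph.Hom.ext' rfl (Category.assoc _ _ _).symm

variable (p T) in
/-- The free relative category functor. -/
noncomputable def freeF : RelGraph p T ⥤ RelMon p T :=
  Adjunction.leftAdjointOfEquiv restrictEquiv restrictEquiv_comp

variable (p T) in
/-- The free relative category functor is left adjoint to the forgetful functor. -/
noncomputable def freeAdj : freeF p T ⊣ forget p T :=
  Adjunction.adjunctionOfEquivLeft restrictEquiv restrictEquiv_comp

theorem freeAdj_unit_app (A : RelGraph p T) :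
    (freeAdj p T).unit.app A = ⟨𝟙 A.base, FreeMonoid.unit A.graph⟩ :=
  (Adjunction.adjunctionOfEquivLeft_unit_app restrictEquiv restrictEquiv_comp A).trans
    (RelGraph.Hom.ext' rfl (Category.comp_id (FreeMonoid.unit A.graph).map))

theorem restrictEquiv_symm_base (A : RelGraph p T) (N : RelMon p T)
    (k : A ⟶ (forget p T).obj N) : ((restrictEquiv A N).symm k).base = k.base :=
  congrArg RelGraph.Hom.base ((restrictEquiv A N).apply_symm_apply k)

theorem freeF_map_base {A A' : RelGraph p T} (f : A ⟶ A') : ((freeF p T).map f).base = f.base :=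
  (restrictEquiv_symm_base _ _ _).trans (Category.comp_id _)

theorem freeAdj_counit_base (N : RelMon p T) :
    ((freeAdj p T).counit.app N).base = 𝟙 N.base := by
  have := congrArg RelGraph.Hom.base ((freeAdj p T).right_triangle_components N)
  rw [freeAdj_unit_app] at this
  exact (Category.id_comp _).symm.trans this

theorem isFibredAdjunction_freeAdj : IsFibredAdjunction (freeAdj p T) where
  comp_eq := CategoryTheory.Functor.ext (fun _ => rfl) fun A A' f =>
    (freeF_map_base f).trans ((Category.id_comp _).trans (Category.comp_id _)).symm
  unit_vertical A := by
    have := CategoryTheory.IsHomLift.map (proj p T) ((freeAdj p T).unit.app A)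
    rw [freeAdj_unit_app] at this ⊢
    exact this
  counit_vertical N := by
    have := CategoryTheory.IsHomLift.map (monProj p T) ((freeAdj p T).counit.app N)
    have e : (monProj p T).map ((freeAdj p T).counit.app N) = 𝟙 N.base := freeAdj_counit_base N
    rw [e] at this
    exact this

end Burroni

/-! ### The monad induced by a fibred adjunction -/

namespace Burroni

section Transport

variable {C D : Type*} [Category* C] [Category* D]

/-- An endofunctor that corresponds to `T` under an equivalence is conjugate to `T`. -/
theorem nonempty_iso_of_comp_iso {T : C ⥤ C} {T' : D ⥤ D} (G : C ⥤ D) [G.IsEquivalence]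
    (σ : G ⋙ T' ≅ T ⋙ G) : Nonempty (G.inv ⋙ T ⋙ G ≅ T') :=
  ⟨isoWhiskerLeft G.inv σ.symm ≪≫ G.asEquivalence.invFunIdAssoc T'⟩

/-- Cartesian monads can be transported along an equivalence of categories, here supposed to be
surjective on objects. -/
theorem IsCartesianMonad.of_comp_iso {T : Monad C} {T' : Monad D} (G : C ⥤ D) [G.IsEquivalence]
    (σ : G ⋙ T'.toFunctor ≅ T.toFunctor ⋙ G) (hT : IsCartesianMonad T)
    (hG : ∀ X, ∃ A, X = G.obj A)
    (hη : ∀ A, T'.η.app (G.obj A) ≫ σ.hom.app A = G.map (T.η.app A))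
    (hμ : ∀ A, T'.μ.app (G.obj A) ≫ σ.hom.app A =
      T'.map (σ.hom.app A) ≫ σ.hom.app (T.obj A) ≫ G.map (T.μ.app A)) : IsCartesianMonad T' where
  preserves := by
    obtain ⟨e⟩ := nonempty_iso_of_comp_iso G σ
    have := hT.preserves
    exact preservesLimitsOfShape_of_natIso e
  unit {X Y} f := by
    obtain ⟨A, rfl⟩ := hG X
    obtain ⟨A', rfl⟩ := hG Y
    obtain ⟨f, rfl⟩ := G.map_surjective f
    exact IsPullback.of_iso' ((hT.unit f).map G) (Iso.refl _) (Iso.refl _) (σ.app A) (σ.app A')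
      ((Category.id_comp _).trans (Category.comp_id _).symm)
      ((Category.id_comp _).trans (hη A).symm) ((Category.id_comp _).trans (hη A').symm)
      (σ.hom.naturality f).symm
  mul {X Y} f := by
    obtain ⟨A, rfl⟩ := hG X
    obtain ⟨A', rfl⟩ := hG Y
    obtain ⟨f, rfl⟩ := G.map_surjective f
    have hσ {A A' : C} (f : A ⟶ A') : T'.map (G.map f) ≫ σ.hom.app A' =
      σ.hom.app A ≫ G.map (T.map f) := σ.hom.naturality f
    refine IsPullback.of_iso' ((hT.mul f).map G)
      (T'.mapIso (σ.app A) ≪≫ σ.app (T.obj A))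
      (T'.mapIso (σ.app A') ≪≫ σ.app (T.obj A')) (σ.app A) (σ.app A') ?_ ?_ ?_ (hσ f).symm
    · change (T'.map (σ.hom.app A) ≫ σ.hom.app (T.obj A)) ≫ G.map (T.map (T.map f)) =
        T'.map (T'.map (G.map f)) ≫ T'.map (σ.hom.app A') ≫ σ.hom.app (T.obj A')
      rw [Category.assoc, ← hσ, ← T'.map_comp_assoc, ← T'.map_comp_assoc, hσ]
    · exact (Category.assoc _ _ _).trans (hμ A).symm
    · exact (Category.assoc _ _ _).trans (hμ A').symm

end Transport

/-- The comparison of two left adjoints of `G` is compatible with the counits, hence with the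
multiplications of the induced monads. -/
theorem counit_leftAdjointUniq {C D : Type*} [Category* C] [Category* D] {F F' : C ⥤ D} {G : D ⥤ C}
    (adj : F ⊣ G) (adj' : F' ⊣ G) (A : C) :
    G.map (adj.counit.app (F.obj A)) ≫ G.map ((adj.leftAdjointUniq adj').hom.app A) =
      G.map (F.map (G.map ((adj.leftAdjointUniq adj').hom.app A))) ≫
        G.map ((adj.leftAdjointUniq adj').hom.app (G.obj (F'.obj A))) ≫
          G.map (adj'.counit.app (F'.obj A)) := by
  rw [← G.map_comp, ← G.map_comp, ← G.map_comp, adj.leftAdjointUniq_hom_app_counit]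
  simp

section Vertical

variable {B : Type u₁} [Category.{v₁} B] {E : Type u₂} [Category.{v₂} E]

theorem isHomLift_of_vertical_comp (p : E ⥤ B) {a b : B} (v : a ⟶ b) {W X Y : E} (f : W ⟶ X)
    (h : X ⟶ Y) [hf : p.IsHomLift (𝟙 a) f] [hv : p.IsHomLift v (f ≫ h)] : p.IsHomLift v h := by
  have hX : p.obj X = a := IsHomLift.codomain_eq p (𝟙 a) f
  subst hX
  have hY : p.obj Y = b := IsHomLift.codomain_eq p v (f ≫ h)
  subst hY
  have h1 := IsHomLift.fac' p v (f ≫ h)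
  have h2 := IsHomLift.fac' p (𝟙 (p.obj X)) f
  refine IsHomLift.of_fac' p v h rfl rfl ?_
  rw [p.map_comp, h2] at h1
  simp only [eqToHom_refl, Category.comp_id, Category.id_comp] at h1 ⊢
  exact (cancel_epi _).1 h1

theorem isHomLift_inv (p : E ⥤ B) {a : B} {X Y : E} (f : X ≅ Y) [hf : p.IsHomLift (𝟙 a) f.hom] :
    p.IsHomLift (𝟙 a) f.inv := by
  have : p.IsHomLift (𝟙 a) (f.hom ≫ f.inv) := by
    rw [f.hom_inv_id]
    exact IsHomLift.id (IsHomLift.domain_eq p (𝟙 a) f.hom)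
  exact isHomLift_of_vertical_comp p (𝟙 a) f.hom f.inv

end Vertical

variable {B : Type u₁} [Category.{v₁} B] {E : Type u₂} [Category.{v₂} E]
variable {p : E ⥤ B} {T : Monad E} [p.IsFibered] [HasFibredPullbacks p] [IsFibredMonad p T]

open GraphOver MonoidalCategory

theorem isHomLift_forget_map {M N : RelMon p T} {Q R : E} {u : Q ⟶ R} {f : M ⟶ N}
    (h : (monProj p T).IsHomLift u f) : (proj p T).IsHomLift u ((forget p T).map f) := by
  cases h
  exact CategoryTheory.IsHomLift.map (proj p T) ((forget p T).map f)

theorem IsFibredAdjunction.isFibredMonad {F : RelGraph p T ⥤ RelMon p T} {adj : F ⊣ forget p T}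
    (h : IsFibredAdjunction adj) : IsFibredMonad (proj p T) adj.toMonad where
  comp_eq := h.comp_eq
  unit_vertical := h.unit_vertical
  mul_vertical A := by
    have e : (monProj p T).obj (F.obj A) = (proj p T).obj A := Functor.congr_obj h.comp_eq A
    have := h.counit_vertical (F.obj A)
    rw [e] at this
    exact isHomLift_forget_map this

variable [HasCartesianFibres p T] [HasFreeMonoids p T]

/-- A monoid morphism between graphs over `O`, as a morphism of relative categories. -/
def RelMon.homMk {O : E} {X Y : GraphOver p T O} [MonObj X] [MonObj Y] (l : X ⟶ Y) [IsMonHom l] :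
    RelMon.ofMonObj X ⟶ RelMon.ofMonObj Y :=
  RelMon.Hom.mk (𝟙 O) l (congrArg Hom.map (IsMonHom.mul_hom l).symm)
    ((congrArg Hom.map (IsMonHom.one_hom l)).trans (Category.id_comp _).symm)

/-- On graphs over a fixed `O`, the left adjoint is the free monoid functor. -/
theorem freeF_map {O : E} {A A' : GraphOver p T O} (f : A ⟶ A') :
    (freeF p T).map (X := ⟨O, A⟩) (Y := ⟨O, A'⟩) (RelGraph.Hom.mk (𝟙 O) f) =
      RelMon.homMk ((FreeMonoid.free (GraphOver p T O)).map f) := by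
  refine (restrictEquiv ⟨O, A⟩ (freeRelMon ⟨O, A'⟩)).symm_apply_eq.2 ?_
  refine RelGraph.Hom.ext' (Category.comp_id _) ?_
  have h := congrArg Hom.map (FreeMonoid.unit_map f)
  exact (congrArg (f.map ≫ ·) (Category.comp_id _)).trans h.symm

theorem restrictEquiv_eq (A : RelGraph p T) (N : RelMon p T) (g : freeRelMon A ⟶ N) :
    restrictEquiv A N g = (freeAdj p T).unit.app A ≫ (forget p T).map g := by
  rw [freeAdj_unit_app]
  exact RelGraph.Hom.ext' (Category.id_comp _).symm rfl

/-- On graphs over a fixed `O`, the counit is that of the free monoid adjunction. -/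
theorem freeAdj_counit {O : E} (A : GraphOver p T O) :
    (freeAdj p T).counit.app (freeRelMon ⟨O, A⟩) =
      RelMon.homMk (FreeMonoid.lift (𝟙 ((FreeMonoid.free (GraphOver p T O)).obj A))) := by
  refine (restrictEquiv _ (freeRelMon ⟨O, A⟩)).injective ?_
  have h : restrictEquiv ((forget p T).obj (freeRelMon ⟨O, A⟩)) _
      ((freeAdj p T).counit.app (freeRelMon ⟨O, A⟩)) = 𝟙 _ :=
    (restrictEquiv_eq _ _ _).trans ((freeAdj p T).right_triangle_components _)
  refine h.trans (RelGraph.Hom.ext' rfl ?_)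
  exact congrArg Hom.map
    (FreeMonoid.unit_lift (𝟙 ((FreeMonoid.free (GraphOver p T O)).obj A))).symm

section Comparison

variable {F : RelGraph p T ⥤ RelMon p T} {adj : F ⊣ forget p T}

/-- The comparison of a left adjoint of the forgetful functor with the free relative category
functor, on underlying graphs. -/
noncomputable def comparison (adj : F ⊣ forget p T) (A : RelGraph p T) :
    (forget p T).obj (F.obj A) ≅ (forget p T).obj (freeRelMon A) :=
  (forget p T).mapIso ((adj.leftAdjointUniq (freeAdj p T)).app A)

theorem unit_comparison (adj : F ⊣ forget p T) (A : RelGraph p T) :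
    adj.unit.app A ≫ (comparison adj A).hom = (freeAdj p T).unit.app A :=
  adj.unit_leftAdjointUniq_hom_app (freeAdj p T) A

theorem comparison_naturality (adj : F ⊣ forget p T) {A A' : RelGraph p T} (f : A ⟶ A') :
    (forget p T).map (F.map f) ≫ (comparison adj A').hom =
      (comparison adj A).hom ≫ (forget p T).map ((freeF p T).map f) := by
  have h := (adj.leftAdjointUniq (freeAdj p T)).hom.naturality f
  exact ((forget p T).map_comp _ _).symm.trans
    ((congrArg (forget p T).map h).trans ((forget p T).map_comp _ _))

theorem mul_comparison (adj : F ⊣ forget p T) (A : RelGraph p T) :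
    adj.toMonad.μ.app A ≫ (comparison adj A).hom =
      adj.toMonad.map (comparison adj A).hom ≫ (comparison adj _).hom ≫
        (forget p T).map ((freeAdj p T).counit.app (freeRelMon A)) :=
  counit_leftAdjointUniq adj (freeAdj p T) A

theorem IsFibredAdjunction.isHomLift_comparison (hadj : IsFibredAdjunction adj) {O : E}
    (A : GraphOver p T O) : (proj p T).IsHomLift (𝟙 O) (comparison adj ⟨O, A⟩).hom := by
  have h₁ : (proj p T).IsHomLift (𝟙 O) (adj.unit.app ⟨O, A⟩) := hadj.unit_vertical ⟨O, A⟩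
  have h₂ : (proj p T).IsHomLift (𝟙 O) ((freeAdj p T).unit.app ⟨O, A⟩) :=
    isFibredAdjunction_freeAdj.unit_vertical ⟨O, A⟩
  rw [← unit_comparison adj] at h₂
  exact @isHomLift_of_vertical_comp _ _ _ _ (proj p T) _ _ (𝟙 O) _ _ _ (adj.unit.app ⟨O, A⟩) _ h₁ h₂

variable [IsFibredMonad (proj p T) adj.toMonad]

/-- The restriction of the monad induced by a fibred adjunction to the fibre over `O` is the free
monoid monad of the category of graphs over `O`. -/
noncomputable def fibreComparison (hadj : IsFibredAdjunction adj) (O : E) :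
    toFiber p T O ⋙ (fibreMonad (proj p T) adj.toMonad O).toFunctor ≅
      (FreeMonoid.adjunction (GraphOver p T O)).toMonad.toFunctor ⋙ toFiber p T O :=
  NatIso.ofComponents
    (fun A =>
      { hom := vert (comparison adj ⟨O, A⟩).hom (hadj.isHomLift_comparison A)
        inv := vert (comparison adj ⟨O, A⟩).inv
          (@isHomLift_inv _ _ _ _ (proj p T) _ _ _ _ (hadj.isHomLift_comparison A))
        hom_inv_id := Fiber.hom_ext (comparison adj ⟨O, A⟩).hom_inv_id
        inv_hom_id := Fiber.hom_ext (comparison adj ⟨O, A⟩).inv_hom_id })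
    fun {A A'} f => Fiber.hom_ext (by
      have h := comparison_naturality adj (A := ⟨O, A⟩) (A' := ⟨O, A'⟩) ⟨𝟙 O, f⟩
      exact h.trans (congrArg ((comparison adj ⟨O, A⟩).hom ≫ ·)
        (congrArg (forget p T).map (freeF_map f))))

theorem isCartesianMonad_fibreMonad (hadj : IsFibredAdjunction adj) (O : E)
    (hO : IsCartesianMonad (FreeMonoid.adjunction (GraphOver p T O)).toMonad) :
    IsCartesianMonad (fibreMonad (proj p T) adj.toMonad O) :=
  hO.of_comp_iso (toFiber p T O) (fibreComparison hadj O) exists_eq_toFiber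
    (fun A => Fiber.hom_ext ((unit_comparison adj ⟨O, A⟩).trans ((freeAdj_unit_app ⟨O, A⟩).trans
      (RelGraph.Hom.ext' rfl
        (congrArg Hom.map (FreeMonoid.adjunction_unit_app A).symm)))))
    (fun A => Fiber.hom_ext ((mul_comparison adj ⟨O, A⟩).trans (by
      have h := congrArg (forget p T).map (freeAdj_counit (p := p) (T := T) A)
      exact congrArg (fun k => adj.toMonad.map (comparison adj ⟨O, A⟩).hom ≫
        (comparison adj _).hom ≫ k) h)))

theorem preservesColimitsOfShape_fibreMonad (hadj : IsFibredAdjunction adj) (O : E) (J : Type*)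
    [Category* J] [PreservesColimitsOfShape J (FreeMonoid.free (GraphOver p T O))] :
    PreservesColimitsOfShape J (fibreMonad (proj p T) adj.toMonad O).toFunctor := by
  obtain ⟨e⟩ := nonempty_iso_of_comp_iso (toFiber p T O) (fibreComparison hadj O)
  have : PreservesColimitsOfShape J
    (FreeMonoid.adjunction (GraphOver p T O)).toMonad.toFunctor :=
    inferInstanceAs (PreservesColimitsOfShape J (FreeMonoid.free (GraphOver p T O)))
  exact preservesColimitsOfShape_of_natIso e

end Comparison

end Burroni

/-! ### Monadicity of the forgetful functor -/

namespace Burroni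

variable {B : Type u₁} [Category.{v₁} B] {E : Type u₂} [Category.{v₂} E]
variable {p : E ⥤ B} {T : Monad E} [p.IsFibered] [HasFibredPullbacks p] [IsFibredMonad p T]

open GraphOver

namespace GraphOver

variable {O Q : E} {u : O ⟶ Q} {v : Q ⟶ O}

/-- The tensor square of a split epimorphism of graphs over possibly different bases is split. -/
theorem tensorHom_section {A A' : GraphOver p T O} {C C' : GraphOver p T Q} (s : C.Hom v A)
    (s' : C'.Hom v A') (e : A.Hom u C) (e' : A'.Hom u C') (h : s.map ≫ e.map = 𝟙 _)
    (h' : s'.map ≫ e'.map = 𝟙 _) :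
    (tensorHom s s').map ≫ (tensorHom e e').map = 𝟙 _ := by
  refine (isPullback _ _).hom_ext ?_ ?_
  · rw [Category.assoc, tensorHom_fst, reassoc_of% (tensorHom_fst s s'), h, Category.comp_id,
      Category.id_comp]
  · rw [Category.assoc, tensorHom_snd, reassoc_of% (tensorHom_snd s s'), ← T.map_comp, h',
      T.map_id, Category.comp_id, Category.id_comp]

theorem tensorHom_cancel {A A' : GraphOver p T O} {C C' : GraphOver p T Q} (s : C.Hom v A)
    (s' : C'.Hom v A') (e : A.Hom u C) (e' : A'.Hom u C') (h : s.map ≫ e.map = 𝟙 _)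
    (h' : s'.map ≫ e'.map = 𝟙 _) {Z : E} {k k' : (tensor C C').apex ⟶ Z}
    (hk : (tensorHom e e').map ≫ k = (tensorHom e e').map ≫ k') : k = k' := by
  have w := tensorHom_section s s' e e' h h'
  rw [← Category.id_comp k, ← Category.id_comp k', ← w, Category.assoc, Category.assoc, hk]

end GraphOver

/-- A split epimorphism of graphs that is compatible with operations on its codomain transports the
laws of a relative category. -/
def RelMon.quotient {N : RelMon p T} {Q : E} {K : GraphOver p T Q} {u : N.base ⟶ Q}
    (e : N.graph.Hom u K) {v : Q ⟶ N.base} (s : K.Hom v N.graph) (huv : v ≫ u = 𝟙 Q)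
    (hs : s.map ≫ e.map = 𝟙 K.apex)
    (mul : (tensor K K).Hom (𝟙 Q) K) (one : (unit p T Q).Hom (𝟙 Q) K)
    (hmul : (tensorHom e e).map ≫ mul.map = N.mul.map ≫ e.map)
    (hone : (unitHom p T u).map ≫ one.map = N.one.map ≫ e.map) : RelMon p T where
  base := Q
  graph := K
  mul := mul
  one := one
  mul_assoc := by
    refine tensorHom_cancel s (tensorHom s s) e (tensorHom e e) hs
      (tensorHom_section s s e e hs hs) ?_
    have h₁ : (tensorHom (tensorHom e e) e).map ≫ (tensorHom mul K.idHom).map =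
        (tensorHom N.mul N.graph.idHom).map ≫ (tensorHom e e).map :=
      (tensorHom_comp_map _ e _ K.idHom ((tensorHom e e).postcomp mul) e rfl
        (Category.comp_id _)).trans
        (tensorHom_map_comp _ N.graph.idHom _ e _ e hmul.symm (Category.id_comp _)).symm
    have h₂ : (tensorHom e (tensorHom e e)).map ≫ (tensorHom K.idHom mul).map =
        (tensorHom N.graph.idHom N.mul).map ≫ (tensorHom e e).map :=
      (tensorHom_comp_map e _ K.idHom _ e ((tensorHom e e).postcomp mul) (Category.comp_id _)
        rfl).trans
        (tensorHom_map_comp N.graph.idHom _ e _ e _ (Category.id_comp _) hmul.symm).symm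
    rw [reassoc_of% (tensorHom_assoc e e e), reassoc_of% h₁, reassoc_of% h₂, hmul,
      reassoc_of% N.mul_assoc]
  one_mul := by
    have h₁ : (tensorHom (unitHom p T u) e).map ≫ (tensorHom one K.idHom).map =
        (tensorHom N.one N.graph.idHom).map ≫ (tensorHom e e).map :=
      (tensorHom_comp_map _ e _ K.idHom ((unitHom p T u).postcomp one) e rfl
        (Category.comp_id _)).trans
        (tensorHom_map_comp _ N.graph.idHom _ e _ e hone.symm (Category.id_comp _)).symm
    have h₂ : e.map ≫ (lam K).map ≫ (tensorHom one K.idHom).map ≫ mul.map = e.map := by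
      rw [← reassoc_of% (tensorHom_lam e), reassoc_of% h₁, hmul, reassoc_of% N.one_mul]
    rw [← Category.id_comp (Hom.map _ ≫ _), ← hs, Category.assoc, h₂]
  mul_one := by
    refine tensorHom_cancel s (unitHom p T v) e (unitHom p T u) hs huv ?_
    have h₁ : (tensorHom e (unitHom p T u)).map ≫ (tensorHom K.idHom one).map =
        (tensorHom N.graph.idHom N.one).map ≫ (tensorHom e e).map :=
      (tensorHom_comp_map e _ K.idHom _ e ((unitHom p T u).postcomp one) (Category.comp_id _)
        rfl).trans
        (tensorHom_map_comp N.graph.idHom _ e _ e _ (Category.id_comp _) hone.symm).symm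
    rw [reassoc_of% h₁, hmul, reassoc_of% N.mul_one, tensorHom_rho]

/-- A morphism of graphs over an arbitrary base morphism, regarded over an equal base morphism. -/
@[simps]
def GraphOver.Hom.copy {O Q : E} {u u' : O ⟶ Q} {A : GraphOver p T O} {C : GraphOver p T Q}
    (f : A.Hom u C) (h : u = u') : A.Hom u' C where
  map := f.map
  cod_comm := h ▸ f.cod_comm
  dom_comm := h ▸ f.dom_comm

theorem tensorHom_comp_congr {O Q Q' R : E} {u : O ⟶ Q} {v : Q ⟶ R} {u' : O ⟶ Q'} {v' : Q' ⟶ R}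
    {A : GraphOver p T O} {C : GraphOver p T Q} {C' : GraphOver p T Q'} {D : GraphOver p T R}
    (f : A.Hom u C) (g : C.Hom v D) (f' : A.Hom u' C') (g' : C'.Hom v' D)
    (h : f.map ≫ g.map = f'.map ≫ g'.map) :
    (tensorHom f f).map ≫ (tensorHom g g).map = (tensorHom f' f').map ≫ (tensorHom g' g').map := by
  refine (isPullback D D).hom_ext ?_ ?_ <;>
    simp only [Category.assoc, tensorHom_fst, tensorHom_snd, reassoc_of% tensorHom_fst (p := p),
      reassoc_of% tensorHom_snd (p := p), h, ← T.map_comp]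

/-- A split coequalizer, in the category of graphs, of two morphisms `f` and `g` of relative
categories. -/
structure SplitQuotient {M N : RelMon p T} (f g : M ⟶ N) (K : RelGraph p T) where
  projBase : N.base ⟶ K.base
  proj : N.graph.Hom projBase K.graph
  sectBase : K.base ⟶ N.base
  sect : K.graph.Hom sectBase N.graph
  liftBase : N.base ⟶ M.base
  lift : N.graph.Hom liftBase M.graph
  sectBase_projBase : sectBase ≫ projBase = 𝟙 _
  sect_proj : sect.map ≫ proj.map = 𝟙 _
  condition_base : f.base ≫ projBase = g.base ≫ projBase
  condition : f.hom.map ≫ proj.map = g.hom.map ≫ proj.map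
  liftBase_right : liftBase ≫ g.base = 𝟙 _
  lift_right : lift.map ≫ g.hom.map = 𝟙 _
  liftBase_left : liftBase ≫ f.base = projBase ≫ sectBase
  lift_left : lift.map ≫ f.hom.map = proj.map ≫ sect.map

namespace SplitQuotient

variable {M N : RelMon p T} {f g : M ⟶ N} {K : RelGraph p T}

/-- The data of a split coequalizer in the category of graphs, in components. -/
def ofIsSplitCoequalizer {e : (forget p T).obj N ⟶ K}
    (q : IsSplitCoequalizer ((forget p T).map f) ((forget p T).map g) e) : SplitQuotient f g K where
  projBase := e.base
  proj := e.hom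
  sectBase := q.rightSection.base
  sect := q.rightSection.hom
  liftBase := q.leftSection.base
  lift := q.leftSection.hom
  sectBase_projBase := congrArg RelGraph.Hom.base q.rightSection_π
  sect_proj := congrArg (fun k => k.hom.map) q.rightSection_π
  condition_base := congrArg RelGraph.Hom.base q.condition
  condition := congrArg (fun k => k.hom.map) q.condition
  liftBase_right := congrArg RelGraph.Hom.base q.leftSection_bottom
  lift_right := congrArg (fun k => k.hom.map) q.leftSection_bottom
  liftBase_left := congrArg RelGraph.Hom.base q.leftSection_top
  lift_left := congrArg (fun k => k.hom.map) q.leftSection_top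

variable (q : SplitQuotient f g K)

/-- The multiplication transported along the section commutes with the projection: the idempotent
`proj ≫ sect` factors as `lift ≫ f`, and `f` and `g` are morphisms of relative categories. -/
theorem mul_proj : (tensorHom q.proj q.proj).map ≫ (tensorHom q.sect q.sect).map ≫
    N.mul.map ≫ q.proj.map = N.mul.map ≫ q.proj.map := by
  have h₁ := tensorHom_comp_congr q.proj q.sect q.lift f.hom q.lift_left.symm
  have h₂ := tensorHom_section q.lift q.lift g.hom g.hom q.lift_right q.lift_right
  rw [reassoc_of% h₁, reassoc_of% f.mul_comm, q.condition, ← reassoc_of% g.mul_comm,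
    reassoc_of% h₂]

theorem one_proj : q.projBase ≫ q.sectBase ≫ N.one.map ≫ q.proj.map =
    N.one.map ≫ q.proj.map := by
  have hf : f.base ≫ N.one.map = M.one.map ≫ f.hom.map := f.one_comm.symm
  have hg : g.base ≫ N.one.map = M.one.map ≫ g.hom.map := g.one_comm.symm
  rw [← reassoc_of% q.liftBase_left, reassoc_of% hf, q.condition, ← reassoc_of% hg,
    reassoc_of% q.liftBase_right]

/-- The relative category structure on the codomain of a split coequalizer. -/
noncomputable def relMon : RelMon p T :=
  have hb : q.sectBase ≫ 𝟙 N.base ≫ q.projBase = 𝟙 K.base := by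
    rw [Category.id_comp, q.sectBase_projBase]
  RelMon.quotient q.proj q.sect q.sectBase_projBase q.sect_proj
    (((tensorHom q.sect q.sect).comp (N.mul.comp q.proj)).copy hb)
    (((unitHom p T q.sectBase).comp (N.one.comp q.proj)).copy hb) q.mul_proj q.one_proj

/-- The projection to the split coequalizer, as a morphism of relative categories. -/
noncomputable def hom : N ⟶ q.relMon :=
  RelMon.Hom.mk (N := q.relMon) q.projBase q.proj q.mul_proj q.one_proj.symm

theorem condition_hom : f ≫ q.hom = g ≫ q.hom :=
  RelMon.Hom.ext' q.condition_base q.condition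

theorem exists_desc {P : RelMon p T} (h : N ⟶ P) (hfg : f ≫ h = g ≫ h) :
    ∃ k : q.relMon ⟶ P, q.hom ≫ k = h := by
  have hfg₁ : f.base ≫ h.base = g.base ≫ h.base := congrArg RelMon.Hom.base hfg
  have hfg₂ : f.hom.map ≫ h.hom.map = g.hom.map ≫ h.hom.map := congrArg (fun k => k.hom.map) hfg
  have hb : q.projBase ≫ q.sectBase ≫ h.base = h.base := by
    rw [← reassoc_of% q.liftBase_left, hfg₁, reassoc_of% q.liftBase_right]
  have hm : q.proj.map ≫ q.sect.map ≫ h.hom.map = h.hom.map := by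
    rw [← reassoc_of% q.lift_left, hfg₂, reassoc_of% q.lift_right]
  let k : K.graph.Hom (q.sectBase ≫ h.base) P.graph := q.sect.comp h.hom
  have hk : (tensorHom k k).map = (tensorHom q.sect q.sect).map ≫ (tensorHom h.hom h.hom).map :=
    tensorHom_comp _ _ _ _
  refine ⟨RelMon.Hom.mk (M := q.relMon) (q.sectBase ≫ h.base) k ?_ ?_, RelMon.Hom.ext' hb hm⟩
  · change (tensorHom k k).map ≫ P.mul.map = ((tensorHom q.sect q.sect).map ≫
      N.mul.map ≫ q.proj.map) ≫ q.sect.map ≫ h.hom.map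
    rw [Category.assoc, Category.assoc, hm, hk, Category.assoc, h.mul_comm]
  · change (q.sectBase ≫ N.one.map ≫ q.proj.map) ≫ q.sect.map ≫ h.hom.map =
      (q.sectBase ≫ h.base) ≫ P.one.map
    have h₁ : N.one.map ≫ h.hom.map = h.base ≫ P.one.map := h.one_comm
    rw [Category.assoc, Category.assoc, hm, h₁, Category.assoc]

theorem hom_ext {P : RelMon p T} {k k' : q.relMon ⟶ P} (h : q.hom ≫ k = q.hom ≫ k') : k = k' := by
  have h₁ : q.projBase ≫ k.base = q.projBase ≫ k'.base := congrArg RelMon.Hom.base h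
  have h₂ : q.proj.map ≫ k.hom.map = q.proj.map ≫ k'.hom.map := congrArg (fun k => k.hom.map) h
  have : Epi q.projBase := (SplitEpi.mk q.sectBase q.sectBase_projBase).epi
  have : Epi q.proj.map := (SplitEpi.mk q.sect.map q.sect_proj).epi
  exact RelMon.Hom.ext' ((cancel_epi q.projBase).1 h₁) ((cancel_epi q.proj.map).1 h₂)

/-- The projection to a split coequalizer is a coequalizer of relative categories. -/
noncomputable def isColimit : IsColimit (Cofork.ofπ q.hom q.condition_hom) :=
  Cofork.IsColimit.mk _ (fun s => (q.exists_desc s.π s.condition).choose)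
    (fun s => (q.exists_desc s.π s.condition).choose_spec)
    fun s _ hm => q.hom_ext (hm.trans (q.exists_desc s.π s.condition).choose_spec.symm)

end SplitQuotient

theorem exists_isColimit_of_isSplitPair {M N : RelMon p T} (f g : M ⟶ N)
    [h : (forget p T).IsSplitPair f g] :
    ∃ c : Cofork f g, Nonempty (IsColimit c) ∧ Nonempty (IsColimit ((forget p T).mapCocone c)) := by
  obtain ⟨K, e, ⟨q⟩⟩ := h.splittable
  let q' := SplitQuotient.ofIsSplitCoequalizer q
  exact ⟨_, ⟨q'.isColimit⟩, ⟨(isColimitMapCoconeCoforkEquiv (forget p T) q'.condition_hom).symm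
    q.isCoequalizer⟩⟩

/-- A morphism of relative categories whose underlying morphism of graphs is invertible is itself
invertible. -/
theorem isIso_of_inverse {M N : RelMon p T} (f : M ⟶ N) (v : N.base ⟶ M.base)
    (k : N.graph.Hom v M.graph) (h₁ : f.base ≫ v = 𝟙 _) (h₂ : v ≫ f.base = 𝟙 _)
    (h₃ : f.hom.map ≫ k.map = 𝟙 _) (h₄ : k.map ≫ f.hom.map = 𝟙 _) : IsIso f := by
  have h₅ := tensorHom_section k k f.hom f.hom h₄ h₄
  have hf : M.one.map ≫ f.hom.map = f.base ≫ N.one.map := f.one_comm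
  refine ⟨RelMon.Hom.mk v k ?_ ?_, RelMon.Hom.ext' h₁ h₃, RelMon.Hom.ext' h₂ h₄⟩
  · rw [← Category.comp_id (_ ≫ M.mul.map), ← h₃, Category.assoc, ← reassoc_of% f.mul_comm,
      reassoc_of% h₅]
  · change N.one.map ≫ k.map = v ≫ M.one.map
    rw [← Category.comp_id (v ≫ M.one.map), ← h₃, Category.assoc, reassoc_of% hf, reassoc_of% h₂]

instance : (forget p T).ReflectsIsomorphisms where
  reflects f hf := by
    obtain ⟨k, hfk, hkf⟩ := hf.out
    exact isIso_of_inverse f k.base k.hom (congrArg RelGraph.Hom.base hfk)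
      (congrArg RelGraph.Hom.base hkf) (congrArg (fun k => k.hom.map) hfk)
      (congrArg (fun k => k.hom.map) hkf)

instance : Monad.HasCoequalizerOfIsSplitPair (forget p T) where
  out f g _ := by
    obtain ⟨c, ⟨hc⟩, -⟩ := exists_isColimit_of_isSplitPair f g
    exact ⟨⟨⟨c, hc⟩⟩⟩

instance : Monad.PreservesColimitOfIsSplitPair (forget p T) where
  out f g _ := by
    obtain ⟨c, ⟨hc⟩, ⟨hc'⟩⟩ := exists_isColimit_of_isSplitPair f g
    exact preservesColimit_of_preserves_colimit_cocone hc hc'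

/-- Beck's theorem, applied to the forgetful functor. -/
theorem nonempty_monadicRightAdjoint {F : RelGraph p T ⥤ RelMon p T} (adj : F ⊣ forget p T) :
    Nonempty (MonadicRightAdjoint (forget p T)) :=
  ⟨Monad.monadicOfHasPreservesGSplitCoequalizersOfReflectsIsomorphisms adj⟩

end Burroni

/-! ### Iterating the construction -/

namespace Burroni

section Step

variable {B : Type u₁} [Category.{v₁} B] {E : Type u₂} [Category.{v₂} E]
variable {p : E ⥤ B} {T : Monad E} [p.IsFibered] [HasFibredPullbacks p] [IsFibredMonad p T]

theorem exists_isFibredAdjunction (hp : IsSuitable.{w} p) (hT : IsSuitableMonad.{w} p T) :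
    ∃ (F : RelGraph p T ⥤ RelMon p T) (adj : F ⊣ forget p T), IsFibredAdjunction adj :=
  have : HasCartesianFibres p T := ⟨hT.relCartesian.cartesian⟩
  have := HasFreeMonoids.of_isSuitable hp hT.preserves
  ⟨freeF p T, freeAdj p T, isFibredAdjunction_freeAdj⟩

variable {F : RelGraph p T ⥤ RelMon p T} {adj : F ⊣ forget p T}

theorem IsFibredAdjunction.preservesFibreFilteredColimits (hadj : IsFibredAdjunction adj)
    [IsFibredMonad (proj p T) adj.toMonad] (hp : IsSuitable.{w} p)
    (hT : IsSuitableMonad.{w} p T) :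
    PreservesFibreFilteredColimits.{w} (proj p T) adj.toMonad := fun O J _ _ => by
  have : HasCartesianFibres p T := ⟨hT.relCartesian.cartesian⟩
  have := HasFreeMonoids.of_isSuitable hp hT.preserves
  have := FreeMonoid.preservesColimitsOfShape_free (J := J)
    (GraphOver.isSuitableTensor (O := O) (hp.fibre (p.obj O)) hT.preserves)
  exact preservesColimitsOfShape_fibreMonad hadj O J

theorem IsFibredAdjunction.isSuitableMonad (hadj : IsFibredAdjunction adj)
    (hp : IsSuitable.{w} p) (hT : IsSuitableMonad.{w} p T) (h : HasDisjointFibreCoproducts p) :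
    IsSuitableMonad.{w} (proj p T) adj.toMonad where
  relCartesian :=
    { fibred := hadj.isFibredMonad
      cartesian := fun O => by
        have := hadj.isFibredMonad
        have : HasCartesianFibres p T := ⟨hT.relCartesian.cartesian⟩
        have := HasFreeMonoids.of_isSuitable hp hT.preserves
        have := h (p.obj O)
        have := GraphOver.binaryCoproductsDisjoint (T := T) (O := O) (hp.fibre (p.obj O))
        exact isCartesianMonad_fibreMonad hadj O (FreeMonoid.isCartesianMonad _
          (GraphOver.isSuitableCategory (hp.fibre (p.obj O)))
          (GraphOver.isSuitableTensor (hp.fibre (p.obj O)) hT.preserves)) }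
  preserves := by
    have := hadj.isFibredMonad
    exact hadj.preservesFibreFilteredColimits hp hT

end Step

section Tower

/-- The hypothesis on `(p, T)` under which the construction can be repeated: a suitable fibration
with disjoint coproducts and a suitable monad. -/
structure IsSuitablePair {B : Type u₁} [Category.{v₁} B] {E : Type u₂} [Category.{v₂} E]
    (p : E ⥤ B) (T : Monad E) : Prop where
  fib : IsSuitable.{w} p
  disjoint : HasDisjointFibreCoproducts p
  monad : IsSuitableMonad.{w} p T

variable {B : Type u₁} [Category.{v₁} B] {E : Type (max u v)} [Category.{v} E]
variable {p : E ⥤ B} {T : Monad E}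

theorem IsSuitablePair.exists_isIterate (h : IsSuitablePair.{w} p T) :
    ∃ S : Stage.{v, u}, IsIterate p T S := by
  have := h.fib.isFibered
  have := h.fib.fibredPullbacks
  have := h.monad.relCartesian.fibred
  obtain ⟨F, adj, hadj⟩ := exists_isFibredAdjunction h.fib h.monad
  exact ⟨_, inferInstance, inferInstance, inferInstance, F, adj, hadj, rfl⟩

theorem IsSuitablePair.of_isIterate (h : IsSuitablePair.{w} p T) {S : Stage.{v, u}}
    (hS : IsIterate p T S) : IsSuitablePair.{w} S.fib S.monad := by
  obtain ⟨_, _, _, F, adj, hadj, rfl⟩ := hS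
  exact ⟨isSuitable_proj h.fib, hasDisjointFibreCoproducts_proj h.fib h.disjoint,
    hadj.isSuitableMonad h.fib h.monad h.disjoint⟩

theorem IsSuitablePair.of_isTower (h : IsSuitablePair.{w} p T) {S : ℕ → Stage.{v, u}}
    (hS : IsTower p T S) (n : ℕ) : IsSuitablePair.{w} (S n).fib (S n).monad := by
  induction n with
  | zero => exact h.of_isIterate hS.zero
  | succ n ih => exact ih.of_isIterate (hS.succ n)

theorem IsSuitablePair.exists_isTower (h : IsSuitablePair.{w} p T) :
    ∃ S : ℕ → Stage.{v, u}, IsTower p T S := by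
  obtain ⟨S₀, h₀⟩ := h.exists_isIterate
  have step (S : {S : Stage.{v, u} // IsSuitablePair.{w} S.fib S.monad}) :
      ∃ S' : {S : Stage.{v, u} // IsSuitablePair.{w} S.fib S.monad},
        IsIterate S.1.fib S.1.monad S'.1 := by
    obtain ⟨S', h'⟩ := S.2.exists_isIterate
    exact ⟨⟨S', S.2.of_isIterate h'⟩, h'⟩
  choose next hnext using step
  let S (n : ℕ) : {S : Stage.{v, u} // IsSuitablePair.{w} S.fib S.monad} :=
    Nat.rec ⟨S₀, h.of_isIterate h₀⟩ (fun _ => next) n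
  exact ⟨fun n => (S n).1, h₀, fun n => hnext (S n)⟩

end Tower

end Burroni

/-! ### The fibration of sets over the point, and identity monads -/

namespace Burroni

section Identity

/-- If the unit is invertible, so is the multiplication, and all naturality squares are pullbacks.
-/
theorem IsCartesianMonad.of_isIso_unit {C : Type u₁} [Category.{v₁} C] (T : Monad C)
    [∀ X, IsIso (T.η.app X)] : IsCartesianMonad T where
  preserves :=
    have : IsIso T.η := NatIso.isIso_of_isIso_app _
    preservesLimitsOfShape_of_natIso (asIso T.η)
  unit f := IsPullback.of_vert_isIso ⟨T.η.naturality f⟩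
  mul {X Y} f := by
    have h (X : C) : IsIso (T.μ.app X) :=
      ⟨T.η.app (T.obj X), (cancel_epi (T.η.app (T.obj X))).1 (by
        rw [← Category.assoc, T.left_unit]
        exact (Category.id_comp _).trans (Category.comp_id _).symm), T.left_unit X⟩
    exact IsPullback.of_vert_isIso ⟨T.μ.naturality f⟩

variable {B : Type u₁} [Category.{v₁} B] {E : Type u₂} [Category.{v₂} E] (p : E ⥤ B)

instance : IsFibredMonad p (Monad.id E) where
  comp_eq := Functor.id_comp p
  unit_vertical X := inferInstanceAs (p.IsHomLift (𝟙 (p.obj X)) (𝟙 X))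
  mul_vertical X := inferInstanceAs (p.IsHomLift (𝟙 (p.obj X)) (𝟙 X))

theorem isSuitableMonad_id : IsSuitableMonad.{w} p (Monad.id E) := by
  have h (b : B) (X : Fiber p b) : IsIso ((fibreMonad p (Monad.id E) b).η.app X) :=
    inferInstanceAs (IsIso (𝟙 X))
  refine ⟨⟨inferInstance, fun b => .of_isIso_unit _⟩, fun b J _ _ => ?_⟩
  have : IsIso (fibreMonad p (Monad.id E) b).η := NatIso.isIso_of_isIso_app _
  exact preservesColimitsOfShape_of_natIso (asIso (fibreMonad p (Monad.id E) b).η)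

end Identity

section Types

/-- A cocone of sets over a filtered diagram is a colimit if it is jointly surjective and elements
are identified only if they are so at some later stage; both conditions are stable under pullback.
-/
theorem isUniversalColimit_of_isFiltered_types {J : Type v₁} [Category.{v₂} J] [IsFiltered J]
    {D : J ⥤ Type w} {c : Cocone D} (hc : IsColimit c) : IsUniversalColimit c := by
  intro D' c' α f _ _ hpb
  refine ⟨Types.FilteredColimit.isColimitOf' _ _ (fun x => ?_) fun i x y hxy => ?_⟩
  · obtain ⟨j, y, hy⟩ := Types.jointly_surjective_of_isColimit hc (f x)
    obtain ⟨z, hz, -⟩ := Types.exists_of_isPullback (hpb j) x y hy.symm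
    exact ⟨j, z, hz.symm⟩
  · have hα : c.ι.app i (α.app i x) = c.ι.app i (α.app i y) := by
      have h := (hpb i).w
      exact (ConcreteCategory.congr_hom h x).symm.trans
        ((congrArg f hxy).trans (ConcreteCategory.congr_hom h y))
    obtain ⟨j, g, hg⟩ := (Types.FilteredColimit.isColimit_eq_iff' hc _ _).1 hα
    refine ⟨j, g, Types.ext_of_isPullback (hpb j) ?_ ?_⟩
    · have h := c'.w g
      exact (ConcreteCategory.congr_hom h x).trans
        (hxy.trans (ConcreteCategory.congr_hom h y).symm)
    · have h := α.naturality g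
      exact (ConcreteCategory.congr_hom h x).trans
        (hg.trans (ConcreteCategory.congr_hom h y).symm)

theorem isSuitableCategory_types : IsSuitableCategory.{w} (Type w) where
  hasPullbacks := inferInstance
  hasFiniteCoproducts := inferInstance
  hasFilteredColimits _ _ _ := inferInstance
  universal_coproducts _ _ _ _ hc :=
    (FinitaryExtensive.isVanKampen_finiteCoproducts hc).isUniversal
  universal_filteredColimits _ _ _ _ _ hc := isUniversalColimit_of_isFiltered_types hc
  commute _ _ _ := colimitsCommutePullbacks_of_preserves

/-- The base has only identities, so every function lies over every morphism of the base. -/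
instance isHomLift_setToOne {b b' : Discrete PUnit.{1}} (u : b ⟶ b') {X Y : Type w} (f : X ⟶ Y) :
    (setToOne.{w}).IsHomLift u f := by
  obtain ⟨⟨⟩⟩ := b
  obtain ⟨⟨⟩⟩ := b'
  exact IsHomLift.of_fac _ _ _ rfl rfl (Subsingleton.elim _ _)

instance : (setToOne.{w}).IsFibered :=
  IsFibered.of_exists_isStronglyCartesian fun X b u => by
    refine ⟨X, 𝟙 X, ?_⟩
    exact { universal_property' := fun g φ' _ => ⟨φ', ⟨inferInstance, Category.comp_id _⟩,
      fun ψ h => (Category.comp_id _).symm.trans h.2⟩ }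

variable (b : Discrete PUnit.{1})

instance : (Fiber.fiberInclusion : Fiber setToOne.{w} b ⥤ Type w).Full where
  map_surjective f := ⟨vert f inferInstance, rfl⟩

instance : (Fiber.fiberInclusion : Fiber setToOne.{w} b ⥤ Type w).EssSurj where
  mem_essImage X := ⟨Fiber.mk (a := X) (Subsingleton.elim _ _), ⟨Iso.refl X⟩⟩

instance : (Fiber.fiberInclusion : Fiber setToOne.{w} b ⥤ Type w).IsEquivalence where

theorem isSuitableCategory_fiber_setToOne : IsSuitableCategory.{w} (Fiber setToOne.{w} b) :=
  isSuitableCategory_types.of_creates Fiber.fiberInclusion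

instance isEquivalence_reindex_setToOne {b b' : Discrete PUnit.{1}} (u : b ⟶ b') :
    (reindex setToOne.{w} u).IsEquivalence := by
  -- Cartesian morphisms are invertible, as all functions are vertical.
  have h (X : Fiber setToOne.{w} b') : IsIso (prone setToOne.{w} u X)  :=
    ⟨IsCartesian.map setToOne.{w} u (prone setToOne.{w} u X) (𝟙 (tot X)),
      IsCartesian.ext setToOne.{w} u (prone setToOne.{w} u X) _ _ (by
        rw [Category.assoc, IsCartesian.fac, Category.comp_id, Category.id_comp]),
      IsCartesian.fac setToOne.{w} u _ _⟩
  let e : reindex setToOne.{w} u ⋙ Fiber.fiberInclusion ≅ Fiber.fiberInclusion :=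
    NatIso.ofComponents (fun X => asIso (prone setToOne.{w} u X))
      fun f => reindex_map_prone setToOne.{w} u f
  have := Functor.isEquivalence_of_iso e.symm
  exact Functor.isEquivalence_of_comp_right _ Fiber.fiberInclusion

theorem isSuitable_setToOne : IsSuitable.{w} setToOne.{w} :=
  .mk_of_fibres isSuitableCategory_fiber_setToOne (fun _ => inferInstance)
    (fun _ _ _ => inferInstance) (fun _ _ _ _ => inferInstance)

theorem hasDisjointFibreCoproducts_setToOne : HasDisjointFibreCoproducts setToOne.{w} := fun b => by
  have := (isSuitableCategory_fiber_setToOne.{w} b).hasPullbacks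
  have := (isSuitableCategory_fiber_setToOne.{w} b).hasFiniteCoproducts
  exact binaryCoproductsDisjoint_of_functor (C := Type w) Fiber.fiberInclusion

end Types

end Burroni

theorem mainTheorem6 {B : Type u₁} [Category.{v₁} B] {E : Type (max u v)} [Category.{v} E]
    (p : E ⥤ B) (T : Monad E) (hp : Burroni.IsSuitable.{w} p)
    (hT : Burroni.IsSuitableMonad.{w} p T) :
    haveI := hp.isFibered
    haveI := hp.fibredPullbacks
    haveI := hT.relCartesian.fibred
    -- the relative Burroni fibration is suitable
    (Burroni.IsSuitable.{w} (Burroni.proj p T) ∧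
      (Burroni.HasDisjointFibreCoproducts p →
        Burroni.HasDisjointFibreCoproducts (Burroni.proj p T))) ∧
    -- the forgetful functor is monadic
    Nonempty (MonadicRightAdjoint (Burroni.forget p T)) ∧
    -- it has a left adjoint fibred over `E`, and the induced monad is suitable
    (∃ (F : Burroni.RelGraph p T ⥤ Burroni.RelMon p T) (adj : F ⊣ Burroni.forget p T),
      Burroni.IsFibredAdjunction adj) ∧
    (∀ (F : Burroni.RelGraph p T ⥤ Burroni.RelMon p T) (adj : F ⊣ Burroni.forget p T),
      Burroni.IsFibredAdjunction adj →
        (∃ _ : Burroni.IsFibredMonad (Burroni.proj p T) adj.toMonad,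
          Burroni.PreservesFibreFilteredColimits.{w} (Burroni.proj p T) adj.toMonad) ∧
        (Burroni.HasDisjointFibreCoproducts p →
          Burroni.IsSuitableMonad.{w} (Burroni.proj p T) adj.toMonad)) ∧
    -- the construction can be iterated
    (Burroni.HasDisjointFibreCoproducts p →
      (∃ S : ℕ → Burroni.Stage.{v, u}, Burroni.IsTower p T S) ∧
      ∀ S : ℕ → Burroni.Stage.{v, u}, Burroni.IsTower p T S → ∀ n : ℕ,
        Burroni.IsSuitable.{w} (S n).fib ∧ Burroni.HasDisjointFibreCoproducts (S n).fib ∧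
          Burroni.IsSuitableMonad.{w} (S n).fib (S n).monad) ∧
    -- in particular it can be iterated starting with the identity monad on `Set ⟶ 1`
    (Burroni.IsSuitable.{w} Burroni.setToOne.{w} ∧
      Burroni.HasDisjointFibreCoproducts Burroni.setToOne.{w} ∧
      Burroni.IsSuitableMonad.{w} Burroni.setToOne.{w} (Monad.id (Type w)) ∧
      (∃ S : ℕ → Burroni.Stage.{w, w + 1},
        Burroni.IsTower Burroni.setToOne.{w} (Monad.id (Type w)) S) ∧
      ∀ S : ℕ → Burroni.Stage.{w, w + 1},
        Burroni.IsTower Burroni.setToOne.{w} (Monad.id (Type w)) S → ∀ n : ℕ,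
          Burroni.IsSuitable.{w} (S n).fib ∧ Burroni.HasDisjointFibreCoproducts (S n).fib ∧
            Burroni.IsSuitableMonad.{w} (S n).fib (S n).monad) := by
  have := hp.isFibered
  have := hp.fibredPullbacks
  have := hT.relCartesian.fibred
  have hpair (h : Burroni.HasDisjointFibreCoproducts p) : Burroni.IsSuitablePair.{w} p T :=
    ⟨hp, h, hT⟩
  have hset : Burroni.IsSuitablePair.{w} Burroni.setToOne.{w} (Monad.id (Type w)) :=
    ⟨Burroni.isSuitable_setToOne, Burroni.hasDisjointFibreCoproducts_setToOne,
      Burroni.isSuitableMonad_id _⟩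
  obtain ⟨F, adj, hadj⟩ := Burroni.exists_isFibredAdjunction hp hT
  refine ⟨⟨Burroni.isSuitable_proj hp, Burroni.hasDisjointFibreCoproducts_proj hp⟩,
    Burroni.nonempty_monadicRightAdjoint adj, ⟨F, adj, hadj⟩, fun F adj hadj => ?_, fun h => ?_,
    hset.fib, hset.disjoint, hset.monad, hset.exists_isTower, fun S hS n => ?_⟩
  · have := hadj.isFibredMonad
    exact ⟨⟨this, hadj.preservesFibreFilteredColimits hp hT⟩, hadj.isSuitableMonad hp hT⟩
  · refine ⟨(hpair h).exists_isTower, fun S hS n => ?_⟩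
    have key := (hpair h).of_isTower hS n
    exact ⟨key.fib, key.disjoint, key.monad⟩
  · have key := hset.of_isTower hS n
    exact ⟨key.fib, key.disjoint, key.monad⟩
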